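/- Let $N\ge 3$ be an integer, $\alpha\in(0,N)$, $p,q>1$ real numbers and $K>0$ a constant. Consider the system $$ \left\{ \begin{aligned} -\Delta u+u+K\phi |u|^{q-2}u&=(I_\alpha*|u|^p)|u|^{p-2}u &&\text{in }\mathbb R^N,\\ -\Delta \phi&=K|u|^q&&\text{in }\mathbb R^N, \end{aligned} \right. $$ for real-valued $u,\phi$, understood in the weak sense (tested against $C_c^\infty(\mathbb R^N)$), where $I_\alpha(x)=A_\alpha|x|^{-(N-\alpha)}$ with $A_\alpha=\Gamma\big(\tfrac{N-\alpha}{2}\big)\big/\big(\Gamma(\tfrac{\alpha}{2})\,\pi^{N/2}\,2^\alpha\big)$ is the Riesz potential. Assume that one of the following two conditions holds: 1. $p\ge\frac{N+\alpha}{N-2}$ and $\frac{N+\alpha}{p}\le\frac{N+2}{q}$; 2. $p\le\frac{N+\alpha}{N}$ and $\frac{N+\alpha}{p}>\frac{N+2}{q}$. Then the only solution $(u,\phi)$ of the system which satisfies $$ u\in H^1(\mathbb R^N)\cap L^{\frac{2Np}{N+\alpha}}(\mathbb R^N),\qquad \phi\in H^1(\mathbb R^N), $$ $$ K|u|^q\in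 L^{\frac{2N}{N+2}}(\mathbb R^N),\qquad |\nabla u|\in H^1_{loc}(\mathbb R^N)\cap L^{\frac{2Np}{N+\alpha}}_{loc}(\mathbb R^N) $$ is the trivial one, $u=\phi=0$ almost everywhere. -/

import Mathlib

open MeasureTheory
open scoped ContDiff ENNReal

noncomputable section

namespace ChoquardSP

/-- The Euclidean space `ℝᴺ`. -/
abbrev E (N : ℕ) : Type := EuclideanSpace ℝ (Fin N)

/-- Test functions: the class `C_c^∞(ℝᴺ)`. -/
def IsTest {N : ℕ} (η : E N → ℝ) : Prop :=
  ContDiff ℝ ∞ η ∧ HasCompactSupport η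

/-- `G` is the weak (distributional) gradient of `f`: both are locally integrable and
`∫ f ∂ᵥη = - ∫ η (G · v)` for all test functions `η` and all directions `v`. -/
def HasWeakGradient {N : ℕ} (f : E N → ℝ) (G : E N → E N) : Prop :=
  LocallyIntegrable f volume ∧ LocallyIntegrable G volume ∧
    ∀ η : E N → ℝ, IsTest η → ∀ v : E N,
      ∫ x, f x * fderiv ℝ η x v = - ∫ x, η x * inner ℝ (G x) v

/-- The space `L^s_loc(ℝᴺ)`. -/
def MemLpLoc {N : ℕ} {F : Type*} [NormedAddCommGroup F] (f : E N → F) (s : ℝ≥0∞) : Prop :=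
  ∀ C : Set (E N), IsCompact C → MemLp f s (volume.restrict C)

/-- The Sobolev space `H¹(ℝᴺ)`. -/
def MemH1 {N : ℕ} (f : E N → ℝ) : Prop :=
  MemLp f 2 volume ∧ ∃ G : E N → E N, HasWeakGradient f G ∧ MemLp G 2 volume

/-- The local Sobolev space `H¹_loc(ℝᴺ)`. -/
def MemH1Loc {N : ℕ} (f : E N → ℝ) : Prop :=
  MemLpLoc f 2 ∧ ∃ G : E N → E N, HasWeakGradient f G ∧ MemLpLoc G 2

/-- The Riesz potential `I_α(x) = A_α / |x|^{N-α}`, where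
`A_α = Γ((N-α)/2) / (Γ(α/2) π^{N/2} 2^α)`. -/
def riesz (N : ℕ) (α : ℝ) (x : E N) : ℝ :=
  (Real.Gamma (((N : ℝ) - α) / 2) /
      (Real.Gamma (α / 2) * Real.pi ^ ((N : ℝ) / 2) * (2 : ℝ) ^ α)) /
    ‖x‖ ^ ((N : ℝ) - α)

/-- The convolution `I_α * f`. -/
def rieszConv {N : ℕ} (α : ℝ) (f : E N → ℝ) (x : E N) : ℝ :=
  ∫ y, riesz N α (x - y) * f y

/-- `(u, φ)` is a weak solution of the system
`-Δu + u + K φ |u|^{q-2} u = (I_α * |u|^p) |u|^{p-2} u`, `-Δφ = K |u|^q` in `ℝᴺ`.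
Here `fderiv ℝ η x (Du x)` is `∇u · ∇η`, and similarly for `φ`. Under the regularity conditions
`IsRegular` below, all the integrals converge. -/
def IsWeakSolution {N : ℕ} (α p q : ℝ) (K u φ : E N → ℝ) : Prop :=
  ∃ Du Dφ : E N → E N, HasWeakGradient u Du ∧ HasWeakGradient φ Dφ ∧
    (∀ η : E N → ℝ, IsTest η →
      (∫ x, fderiv ℝ η x (Du x)) + (∫ x, u x * η x) +
          (∫ x, K x * φ x * (|u x| ^ (q - 2) * u x) * η x) =
        ∫ x, rieszConv α (fun y => |u y| ^ p) x * (|u x| ^ (p - 2) * u x) * η x) ∧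
    (∀ η : E N → ℝ, IsTest η →
      ∫ x, fderiv ℝ η x (Dφ x) = ∫ x, K x * |u x| ^ q * η x)

/-- The regularity class: `u ∈ H¹ ∩ L^{2Np/(N+α)}`, `φ ∈ H¹`, `K |u|^q ∈ L^{2N/(N+2)}`,
`|∇u| ∈ H¹_loc ∩ L^{2Np/(N+α)}_loc`. -/
def IsRegular {N : ℕ} (α p q : ℝ) (K u φ : E N → ℝ) : Prop :=
  MemH1 u ∧
    MemLp u (ENNReal.ofReal (2 * N * p / (N + α))) volume ∧
    MemH1 φ ∧
    MemLp (fun x => K x * |u x| ^ q) (ENNReal.ofReal (2 * N / (N + 2))) volume ∧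
    ∃ Du : E N → E N, HasWeakGradient u Du ∧
      MemH1Loc (fun x => ‖Du x‖) ∧
      MemLpLoc (fun x => ‖Du x‖) (ENNReal.ofReal (2 * N * p / (N + α)))

end ChoquardSP

end

noncomputable section

/-! Write A = ∫|∇u|², B = ∫u², D = ∫|∇φ|² and Q = ∫(I_α*|u|^p)|u|^p. Testing the first equation with
u and the second with φ gives A + B + D = Q (`Solution.nehari`). The Pohozaev identity is (N-2)/2 A
+ N/2 B + (N+2)/(2q) D = (N+α)/(2p) Q (`Solution.pohozaev`). Put a = (N+α)/p and b = (N+2)/q.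
Eliminating Q leaves (N-2-a)A + (N-a)B + (b-a)D = 0. Under condition 1 all three coefficients are
nonnegative and that of B is at least 2, so B = 0. Under condition 2 all three are nonpositive and
that of A is at most -2, so A = 0 and the Sobolev inequality gives u = 0. Then D = ∫K|u|^qφ = 0 and
φ = 0.

The work lies in the Pohozaev identity. Formally one tests with η x·∇u, η a cutoff. Instead
`Solution.local_pohozaev` tests with η(u(l·) - u) for l > 0, which has finite energy. Young's
inequality bounds the quadratic terms, and convexity of |t|^q together with φ ≥ 0
(`Solution.φ_nonneg`) bounds the coupling term, by functions explicitly differentiable in l. The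
result is an inequality valid for all l > 0 with equality at l = 1, so the l-derivative vanishes
there, and this is the localised identity. The same minimum principle replaces the chain rule for
|u|^p in `Solution.integral_rpow_dilation`.

The nonlocal term is treated by smoothing the Riesz kernel, symmetrising in (x, y), and removing the
smoothing by dominated convergence (`Solution.integral_choquard_dilation`). The domination comes
from a Hardy-Littlewood-Sobolev bound (`lintegral_mul_rieszPot_le`). Finally the cutoff radius tends
to infinity. Density of test functions (`HasWeakGradient.exists_test_seq`) underlies the Sobolev
inequality, the chain rule and the enlargement of the class of test functions. -/

namespace ChoquardSP

open Filter Topology Set Metric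

variable {N : ℕ}

/-! ### Test functions and the calculus of weak gradients -/

lemma IsTest.continuous {η : E N → ℝ} (h : IsTest η) : Continuous η := h.1.continuous

lemma IsTest.differentiable {η : E N → ℝ} (h : IsTest η) : Differentiable ℝ η :=
  h.1.differentiable (by simp)

lemma contDiff_gradient {ζ : E N → ℝ} (hζ : ContDiff ℝ ∞ ζ) : ContDiff ℝ ∞ (gradient ζ) :=
  (InnerProductSpace.toDual ℝ (E N)).symm.toContinuousLinearEquiv.contDiff.comp
    (hζ.fderiv_right (m := ∞) (by simp))

lemma contDiff_fderiv_apply {ζ : E N → ℝ} (hζ : ContDiff ℝ ∞ ζ) (v : E N) :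
    ContDiff ℝ ∞ (fun x => fderiv ℝ ζ x v) :=
  (hζ.fderiv_right (m := ∞) (by simp)).clm_apply contDiff_const

lemma IsTest.fderiv_apply {η : E N → ℝ} (h : IsTest η) (v : E N) :
    IsTest (fun x => fderiv ℝ η x v) :=
  ⟨contDiff_fderiv_apply h.1 v, h.2.fderiv_apply ℝ v⟩

lemma IsTest.contDiff_mul {η ζ : E N → ℝ} (h : IsTest η) (hζ : ContDiff ℝ ∞ ζ) :
    IsTest (fun x => ζ x * η x) :=
  ⟨hζ.mul h.1, h.2.mul_left⟩

lemma norm_gradient (ζ : E N → ℝ) (x : E N) : ‖gradient ζ x‖ = ‖fderiv ℝ ζ x‖ := by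
  simp [gradient]

lemma IsTest.gradient_hasCompactSupport {η : E N → ℝ} (h : IsTest η) :
    HasCompactSupport (gradient η) :=
  (h.2.fderiv ℝ).comp_left (g := (InnerProductSpace.toDual ℝ (E N)).symm) (map_zero _)

lemma _root_.MeasureTheory.LocallyIntegrable.integrable_mul_test {f : E N → ℝ} (hf : LocallyIntegrable f volume)
    {η : E N → ℝ} (hη : Continuous η) (h2 : HasCompactSupport η) :
    Integrable (fun x => f x * η x) := by
  simpa using hf.integrable_smul_right_of_hasCompactSupport hη h2

lemma _root_.MeasureTheory.LocallyIntegrable.integrable_test_mul {f : E N → ℝ} (hf : LocallyIntegrable f volume)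
    {η : E N → ℝ} (hη : Continuous η) (h2 : HasCompactSupport η) :
    Integrable (fun x => η x * f x) := by
  simpa using hf.integrable_smul_left_of_hasCompactSupport hη h2

lemma _root_.MeasureTheory.LocallyIntegrable.inner_const {G : E N → E N} (hG : LocallyIntegrable G volume) (v : E N) :
    LocallyIntegrable (fun x => inner ℝ (G x) v) volume := by
  intro x
  obtain ⟨s, hs, h⟩ := hG x
  exact ⟨s, hs, h.inner_const v⟩

lemma _root_.MeasureTheory.LocallyIntegrable.comp_smul {F : Type*} [NormedAddCommGroup F] {f : E N → F}
    (hf : LocallyIntegrable f volume) {l : ℝ} (hl : l ≠ 0) :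
    LocallyIntegrable (fun x => f (l • x)) volume := by
  rw [locallyIntegrable_iff] at hf ⊢
  intro k hk
  have hk' : IsCompact ((l • ·) '' k : Set (E N)) := hk.image (continuous_const_smul l)
  have h := (integrable_indicator_iff hk'.measurableSet).2 (hf _ hk')
  have h2 := h.comp_smul hl
  refine ((integrable_indicator_iff hk.measurableSet).1 (h2.congr (.of_forall fun x => ?_)))
  simp only [indicator]
  congr 1
  simp only [mem_image, eq_iff_iff]
  exact ⟨fun ⟨y, hy, h⟩ => (smul_right_injective _ hl h) ▸ hy, fun h => ⟨x, h, rfl⟩⟩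

lemma HasWeakGradient.congr {f g : E N → ℝ} {F G : E N → E N} (h : HasWeakGradient f F)
    (hfg : f =ᵐ[volume] g) (hFG : F =ᵐ[volume] G) : HasWeakGradient g G := by
  refine ⟨h.1.congr hfg, h.2.1.congr hFG, fun η hη v => ?_⟩
  have e1 : ∫ x, g x * fderiv ℝ η x v = ∫ x, f x * fderiv ℝ η x v :=
    integral_congr_ae (hfg.mono fun x hx => by simp only [hx])
  have e2 : ∫ x, η x * inner ℝ (G x) v = ∫ x, η x * inner ℝ (F x) v :=
    integral_congr_ae (hFG.mono fun x hx => by simp only [hx])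
  rw [e1, e2, h.2.2 η hη v]

/-- Pairing with a fixed vector v reduces the claim to the fundamental lemma of the calculus of
variations. It identifies the gradients that `IsWeakSolution`, `MemH1` and `IsRegular` each supply
existentially. -/
lemma HasWeakGradient.unique {f : E N → ℝ} {F G : E N → E N} (h : HasWeakGradient f F)
    (h' : HasWeakGradient f G) : F =ᵐ[volume] G := by
  refine ae_eq_of_integral_contDiff_smul_eq h.2.1 h'.2.1 fun g hg hg2 => ?_
  refine ext_inner_right ℝ fun v => ?_
  have e : ∀ F : E N → E N, LocallyIntegrable F volume →
      inner ℝ (∫ x, g x • F x) v = ∫ x, g x * inner ℝ (F x) v := by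
    intro F hF
    rw [real_inner_comm, ← integral_inner
      (hF.integrable_smul_left_of_hasCompactSupport hg.continuous hg2)]
    simp [inner_smul_right, real_inner_comm]
  rw [e F h.2.1, e G h'.2.1, ← neg_inj, ← h.2.2 g ⟨hg, hg2⟩ v, h'.2.2 g ⟨hg, hg2⟩ v]

lemma HasWeakGradient.sub {f g : E N → ℝ} {F G : E N → E N} (h : HasWeakGradient f F)
    (h' : HasWeakGradient g G) :
    HasWeakGradient (fun x => f x - g x) (fun x => F x - G x) := by
  refine ⟨h.1.sub h'.1, h.2.1.sub h'.2.1, fun η hη v => ?_⟩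
  have hv := hη.fderiv_apply v
  simp only [sub_mul, inner_sub_left, mul_sub]
  rw [integral_sub (h.1.integrable_mul_test hv.continuous hv.2)
    (h'.1.integrable_mul_test hv.continuous hv.2), integral_sub
    ((h.2.1.inner_const v).integrable_test_mul hη.continuous hη.2)
    ((h'.2.1.inner_const v).integrable_test_mul hη.continuous hη.2), h.2.2 η hη v, h'.2.2 η hη v]
  ring

lemma HasWeakGradient.const_mul {f : E N → ℝ} {F : E N → E N} (h : HasWeakGradient f F) (c : ℝ) :
    HasWeakGradient (fun x => c * f x) (fun x => c • F x) := by
  refine ⟨h.1.smul c, h.2.1.smul c, fun η hη v => ?_⟩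
  simp only [mul_assoc, inner_smul_left, mul_left_comm _ c, conj_trivial]
  rw [integral_const_mul, integral_const_mul, h.2.2 η hη v]
  ring

lemma HasWeakGradient.contDiff_mul {f ζ : E N → ℝ} {F : E N → E N} (h : HasWeakGradient f F)
    (hζ : ContDiff ℝ ∞ ζ) :
    HasWeakGradient (fun x => ζ x * f x) (fun x => ζ x • F x + f x • gradient ζ x) := by
  have hc := (contDiff_gradient hζ).continuous
  refine ⟨h.1.continuous_mul hζ.continuous, (h.2.1.continuous_smul hζ.continuous).add
    (h.1.smul_continuous hc), fun η hη v => ?_⟩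
  have e := h.2.2 _ (hη.contDiff_mul hζ) v
  have hd : ∀ x, fderiv ℝ (fun x => ζ x * η x) x v
      = ζ x * fderiv ℝ η x v + η x * fderiv ℝ ζ x v := by
    intro x
    rw [fderiv_fun_mul (hζ.differentiable (by simp) x) (hη.differentiable x)]
    simp
  have i1 : Integrable fun x => f x * (ζ x * fderiv ℝ η x v) :=
    h.1.integrable_mul_test (hζ.continuous.mul (hη.fderiv_apply v).continuous)
      (hη.fderiv_apply v).2.mul_left
  have i2 : Integrable fun x => f x * (η x * fderiv ℝ ζ x v) :=
    h.1.integrable_mul_test (hη.continuous.mul (contDiff_fderiv_apply hζ v).continuous)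
      hη.2.mul_right
  have i3 : Integrable fun x => ζ x * η x * inner ℝ (F x) v :=
    (h.2.1.inner_const v).integrable_test_mul (hζ.continuous.mul hη.continuous) hη.2.mul_left
  simp only [hd, mul_add] at e
  rw [integral_add i1 i2] at e
  have e1 : ∀ x, ζ x * f x * fderiv ℝ η x v = f x * (ζ x * fderiv ℝ η x v) := fun x => by ring
  have e2 : ∀ x, η x * inner ℝ (ζ x • F x + f x • gradient ζ x) v
      = ζ x * η x * inner ℝ (F x) v + f x * (η x * fderiv ℝ ζ x v) := fun x => by
    rw [inner_add_left, inner_smul_left, inner_smul_left, inner_gradient_left]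
    simp only [conj_trivial]
    ring
  simp only [e1, e2]
  rw [integral_add i3 i2]
  linarith

lemma IsTest.comp_smul {η : E N → ℝ} (hη : IsTest η) {l : ℝ} (hl : l ≠ 0) :
    IsTest (fun x => η (l • x)) :=
  ⟨hη.1.comp (contDiff_const_smul l), hη.2.comp_homeomorph (Homeomorph.smulOfNeZero l hl)⟩

lemma fderiv_comp_const_smul {η : E N → ℝ} (hη : Differentiable ℝ η) (l : ℝ) (x v : E N) :
    fderiv ℝ (fun x => η (l • x)) x v = l * fderiv ℝ η (l • x) v := by
  have : HasFDerivAt (fun x => η (l • x)) _ x :=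
    (hη (l • x)).hasFDerivAt.comp x ((hasFDerivAt_id x).const_smul l)
  rw [this.fderiv]
  simp

lemma HasWeakGradient.comp_smul {f : E N → ℝ} {F : E N → E N} (h : HasWeakGradient f F)
    {l : ℝ} (hl : 0 < l) :
    HasWeakGradient (fun x => f (l • x)) (fun x => l • F (l • x)) := by
  refine ⟨h.1.comp_smul hl.ne', (h.2.1.comp_smul hl.ne').smul l, fun η hη v => ?_⟩
  have e := h.2.2 _ (hη.comp_smul (inv_ne_zero hl.ne')) v
  simp only [fderiv_comp_const_smul hη.differentiable] at e
  have h1 := Measure.integral_comp_smul volume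
    (fun x : E N => f x * (l⁻¹ * fderiv ℝ η (l⁻¹ • x) v)) l
  have h2 := Measure.integral_comp_smul volume
    (fun x : E N => η (l⁻¹ • x) * inner ℝ (F x) v) l
  simp only [smul_smul, inv_mul_cancel₀ hl.ne', one_smul, smul_eq_mul] at h1 h2
  rw [e] at h1
  simp only [mul_left_comm _ l⁻¹] at h1
  rw [integral_const_mul] at h1
  simp only [inner_smul_left, mul_left_comm _ l, conj_trivial]
  rw [integral_const_mul, h2, ← mul_right_inj' (inv_ne_zero hl.ne'), h1]
  field_simp

/-- The left factor is div(ζ(x)x): use the test functions x_i ζ in the directions e_i and sum over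
i. This is where the generator x·∇ of dilations is integrated by parts. -/
lemma HasWeakGradient.integral_div {f : E N → ℝ} {F : E N → E N} (h : HasWeakGradient f F)
    {ζ : E N → ℝ} (hζ : IsTest ζ) :
    ∫ x, f x * (N * ζ x + fderiv ℝ ζ x x) = - ∫ x, ζ x * inner ℝ (F x) x := by
  have hc : ∀ i : Fin N, ContDiff ℝ ∞ (fun x : E N => x i) := fun i =>
    (EuclideanSpace.proj (𝕜 := ℝ) i).contDiff
  have ht : ∀ i : Fin N, IsTest (fun x : E N => x i * ζ x) := fun i => hζ.contDiff_mul (hc i)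
  have hd : ∀ (i : Fin N) (x : E N), fderiv ℝ (fun x : E N => x i * ζ x) x
      (EuclideanSpace.single i 1) = x i * fderiv ℝ ζ x (EuclideanSpace.single i 1) + ζ x := by
    intro i x
    rw [fderiv_fun_mul ((hc i).differentiable (by simp) x) (hζ.differentiable x)]
    have : fderiv ℝ (fun x : E N => x i) x = EuclideanSpace.proj (𝕜 := ℝ) i :=
      (EuclideanSpace.proj (𝕜 := ℝ) i).fderiv
    rw [this]
    simp
  have hb : ∀ x : E N, x = ∑ i, x i • EuclideanSpace.single i (1 : ℝ) := fun x => by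
    ext j
    simp [Finset.sum_apply, Pi.single_apply]
  have hs : ∀ x : E N, N * ζ x + fderiv ℝ ζ x x = ∑ i, fderiv ℝ (fun x : E N => x i * ζ x) x
      (EuclideanSpace.single i 1) := fun x => by
    simp only [hd]
    rw [Finset.sum_add_distrib, add_comm]
    congr 1
    · conv_lhs => rw [hb x]
      simp only [map_sum, map_smul, smul_eq_mul]
      rw [← hb x]
    · simp
  have hs' : ∀ x : E N, ζ x * inner ℝ (F x) x = ∑ i, (x i * ζ x) *
      inner ℝ (F x) (EuclideanSpace.single i (1:ℝ)) := fun x => by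
    conv_lhs => rw [hb x]
    simp only [inner_sum, inner_smul_right]
    rw [← hb x, Finset.mul_sum]
    exact Finset.sum_congr rfl fun i _ => by ring
  simp only [hs, hs', Finset.mul_sum]
  rw [integral_finsetSum _ fun i _ => h.1.integrable_mul_test ((ht i).fderiv_apply _).continuous
      ((ht i).fderiv_apply _).2, integral_finsetSum _ fun i _ =>
      (h.2.1.inner_const _).integrable_test_mul (ht i).continuous (ht i).2,
      ← Finset.sum_neg_distrib]
  exact Finset.sum_congr rfl fun i _ => h.2.2 _ (ht i) _

lemma HasWeakGradient.zero : HasWeakGradient (fun _ : E N => (0 : ℝ)) (fun _ => 0) :=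
  ⟨locallyIntegrable_zero, locallyIntegrable_zero, fun η _ v => by simp⟩

/-! ### Elementary facts about powers -/

lemma abs_rpow_sub_two_mul_self (a : ℝ) {q : ℝ} (hq : 1 < q) :
    |(|a| ^ (q - 2) * a)| = |a| ^ (q - 1) := by
  rcases eq_or_ne a 0 with rfl | ha
  · simp [Real.zero_rpow (show q - 1 ≠ 0 by linarith)]
  · have := abs_pos.2 ha
    rw [abs_mul, abs_of_nonneg (by positivity), ← Real.rpow_add_one this.ne']
    ring_nf

lemma rpow_sub_two_mul_self_mul_self (a : ℝ) {q : ℝ} (hq : 1 < q) :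
    |a| ^ (q - 2) * a * a = |a| ^ q := by
  rcases eq_or_ne a 0 with rfl | ha
  · simp [Real.zero_rpow (show q ≠ 0 by linarith)]
  · have := abs_pos.2 ha
    rw [mul_assoc, ← abs_mul_abs_self a, ← mul_assoc, ← Real.rpow_add_one this.ne',
      ← Real.rpow_add_one this.ne']
    ring_nf

/-- Tangent-line inequality for the convex function |t|^q / q, obtained from Young's inequality for
|a|^(q-1)·|b|. It turns finite differences of u under dilation into differences of |u|^q, so that no
derivative of |u|^q is needed. -/
lemma rpow_convexity (a b : ℝ) {q : ℝ} (hq : 1 < q) :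
    |a| ^ (q - 2) * a * (b - a) ≤ (|b| ^ q - |a| ^ q) / q := by
  have h1 : |a| ^ (q - 2) * a * b ≤ |a| ^ (q - 1) * |b| := by
    rw [← abs_rpow_sub_two_mul_self a hq, ← abs_mul]
    exact le_abs_self _
  have hc : (q / (q - 1)).HolderConjugate q :=
    (Real.HolderConjugate.conjExponent hq).symm
  have h2 := Real.young_inequality_of_nonneg (a := |a| ^ (q - 1)) (b := |b|) (by positivity)
    (abs_nonneg b) hc
  rw [← Real.rpow_mul (abs_nonneg a), mul_div_cancel₀ _ (by linarith : q - 1 ≠ 0)] at h2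
  have h3 := rpow_sub_two_mul_self_mul_self a hq
  rw [mul_sub, h3]
  have : |a| ^ q / (q / (q - 1)) = |a| ^ q - |a| ^ q / q := by
    field_simp
  rw [sub_div]
  linarith

/-! ### Mollification in Lebesgue spaces -/

/-- A sequence of smooth bump functions whose supports shrink to the origin. -/
def bump (N n : ℕ) : ContDiffBump (0 : E N) where
  rIn := 1 / (2 * ((n : ℝ) + 1))
  rOut := 1 / ((n : ℝ) + 1)
  rIn_pos := by positivity
  rIn_lt_rOut := by
    have : (0 : ℝ) < n + 1 := by positivity
    exact one_div_lt_one_div_of_lt this (by linarith)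

/-- Mollification at scale `1 / (n + 1)`. -/
def mollify {F : Type*} [NormedAddCommGroup F] [NormedSpace ℝ F] (n : ℕ) (w : E N → F) : E N → F :=
  convolution ((bump N n).normed volume) w (ContinuousLinearMap.lsmul ℝ ℝ) volume

section Mollify

variable {F : Type*} [NormedAddCommGroup F] [NormedSpace ℝ F]

lemma mollify_apply (n : ℕ) (w : E N → F) (x : E N) :
    mollify n w x = ∫ t, (bump N n).normed volume t • w (x - t) := rfl

lemma mollify_congr (n : ℕ) {w w' : E N → F} (h : w =ᵐ[volume] w') :
    mollify n w = mollify n w' :=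
  convolution_congr _ (ae_eq_refl _) h

/-- The kernel is a probability density, so monotonicity of L^r norms over the measure `κ` bounds
|mollify w|^r by the average of |w(x - t)|^r. Tonelli and translation invariance finish. -/
lemma eLpNorm_mollify_le_of_stronglyMeasurable (n : ℕ) {w : E N → F} (hw : StronglyMeasurable w)
    {r : ℝ≥0∞} (hr : 1 ≤ r) (hr' : r ≠ ⊤) :
    eLpNorm (mollify n w) r volume ≤ eLpNorm w r volume := by
  set ρ := (bump N n).normed volume with hρ
  set κ : Measure (E N) := volume.withDensity fun t => ENNReal.ofReal (ρ t) with hκ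
  have hρm : Measurable fun t => ENNReal.ofReal (ρ t) :=
    (bump N n).continuous_normed.measurable.ennreal_ofReal
  have hκ1 : IsProbabilityMeasure κ := ⟨by
    rw [hκ, withDensity_apply _ MeasurableSet.univ, Measure.restrict_univ,
      ← ofReal_integral_eq_lintegral_ofReal (bump N n).integrable_normed
        (.of_forall fun t => (bump N n).nonneg_normed t), (bump N n).integral_normed]
    simp⟩
  have hr0 : 0 < r.toReal := ENNReal.toReal_pos (by positivity) hr'
  have hr1 : 1 ≤ r.toReal := by
    rw [← ENNReal.toReal_one]; exact ENNReal.toReal_mono hr' hr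
  have hpt : ∀ x, ‖mollify n w x‖ₑ ^ r.toReal ≤
      ∫⁻ t, ENNReal.ofReal (ρ t) * ‖w (x - t)‖ₑ ^ r.toReal := by
    intro x
    have hm : StronglyMeasurable fun t => w (x - t) :=
      hw.comp_measurable (measurable_const.sub measurable_id)
    have h1 : ‖mollify n w x‖ₑ ≤ ∫⁻ t, ‖w (x - t)‖ₑ ∂κ := by
      rw [hκ, lintegral_withDensity_eq_lintegral_mul _ hρm hm.enorm, mollify_apply]
      refine (enorm_integral_le_lintegral_enorm _).trans (lintegral_mono fun t => ?_)
      rw [enorm_smul, Real.enorm_of_nonneg ((bump N n).nonneg_normed t)]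
      rfl
    have h2 := eLpNorm'_le_eLpNorm'_of_exponent_le (μ := κ) zero_lt_one hr1
      hm.aestronglyMeasurable
    simp only [eLpNorm', ENNReal.rpow_one, div_one] at h2
    calc ‖mollify n w x‖ₑ ^ r.toReal
        ≤ ((∫⁻ t, ‖w (x - t)‖ₑ ^ r.toReal ∂κ) ^ (1 / r.toReal)) ^ r.toReal := by
          gcongr; exact h1.trans h2
      _ = ∫⁻ t, ‖w (x - t)‖ₑ ^ r.toReal ∂κ := by
          rw [← ENNReal.rpow_mul, one_div_mul_cancel hr0.ne', ENNReal.rpow_one]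
      _ = _ := by
          rw [hκ, lintegral_withDensity_eq_lintegral_mul _ hρm (hm.enorm.pow_const _)]
          rfl
  rw [eLpNorm_eq_lintegral_rpow_enorm_toReal (by positivity) hr',
    eLpNorm_eq_lintegral_rpow_enorm_toReal (by positivity) hr']
  refine ENNReal.rpow_le_rpow ?_ (by positivity)
  have hm2 : Measurable (Function.uncurry fun (x t : E N) =>
      ENNReal.ofReal (ρ t) * ‖w (x - t)‖ₑ ^ r.toReal) :=
    (hρm.comp measurable_snd).mul
      ((hw.comp_measurable (measurable_fst.sub measurable_snd)).enorm.pow_const _)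
  calc ∫⁻ x, ‖mollify n w x‖ₑ ^ r.toReal
      ≤ ∫⁻ x, ∫⁻ t, ENNReal.ofReal (ρ t) * ‖w (x - t)‖ₑ ^ r.toReal := lintegral_mono hpt
    _ = ∫⁻ t, ∫⁻ x, ENNReal.ofReal (ρ t) * ‖w (x - t)‖ₑ ^ r.toReal :=
        lintegral_lintegral_swap hm2.aemeasurable
    _ = ∫⁻ t, ENNReal.ofReal (ρ t) * ∫⁻ x, ‖w x‖ₑ ^ r.toReal := by
        refine lintegral_congr fun t => ?_
        rw [lintegral_const_mul' _ _ ENNReal.ofReal_ne_top,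
          lintegral_sub_right_eq_self (fun x => ‖w x‖ₑ ^ r.toReal) t]
    _ = (∫⁻ t, ENNReal.ofReal (ρ t)) * ∫⁻ x, ‖w x‖ₑ ^ r.toReal :=
        lintegral_mul_const _ hρm
    _ = ∫⁻ x, ‖w x‖ₑ ^ r.toReal := by
        have := hκ1.measure_univ
        rw [hκ, withDensity_apply _ MeasurableSet.univ, Measure.restrict_univ] at this
        rw [this, one_mul]

lemma eLpNorm_mollify_le (n : ℕ) {w : E N → F} (hw : AEStronglyMeasurable w volume)
    {r : ℝ≥0∞} (hr : 1 ≤ r) (hr' : r ≠ ⊤) :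
    eLpNorm (mollify n w) r volume ≤ eLpNorm w r volume := by
  rw [mollify_congr n hw.ae_eq_mk, eLpNorm_congr_ae hw.ae_eq_mk]
  exact eLpNorm_mollify_le_of_stronglyMeasurable n hw.stronglyMeasurable_mk hr hr'

lemma continuous_mollify (n : ℕ) {w : E N → F} (hw : LocallyIntegrable w volume) :
    Continuous (mollify n w) :=
  (bump N n).hasCompactSupport_normed.continuous_convolution_left _
    (bump N n).continuous_normed hw

lemma mollify_sub (n : ℕ) {w w' : E N → F} (hw : LocallyIntegrable w volume)
    (hw' : LocallyIntegrable w' volume) :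
    mollify n (fun x => w x - w' x) = fun x => mollify n w x - mollify n w' x := by
  ext x
  have h : ∀ w : E N → F, LocallyIntegrable w volume →
      Integrable fun t => (bump N n).normed volume t • w (x - t) := fun w hw =>
    (bump N n).hasCompactSupport_normed.convolutionExists_left
      (ContinuousLinearMap.lsmul ℝ ℝ) (bump N n).continuous_normed hw x
  simp only [mollify_apply, smul_sub]
  exact integral_sub (h w hw) (h w' hw')

lemma hasCompactSupport_mollify (n : ℕ) {w : E N → F} (hw : HasCompactSupport w) :
    HasCompactSupport (mollify n w) :=
  (bump N n).hasCompactSupport_normed.convolution _ hw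

lemma tendsto_bump_rOut : Tendsto (fun n => (bump N n).rOut) atTop (𝓝 0) :=
  tendsto_one_div_add_atTop_nhds_zero_nat

/-- Uniform continuity makes the error uniformly small, and once the mollification radius is below 1
both functions live in one compact set `S`. The L^r error is therefore at most c·|S|^(1/r), which
dictates the choice of c. -/
lemma tendsto_mollify_of_continuous [CompleteSpace F] {w : E N → F} (hw : Continuous w)
    (hc : HasCompactSupport w) {r : ℝ≥0∞} (hr' : r ≠ ⊤) :
    Tendsto (fun n => eLpNorm (fun x => mollify n w x - w x) r volume) atTop (𝓝 0) := by
  have hK : IsCompact (cthickening 1 (tsupport w)) := hc.isCompact.cthickening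
  set S := cthickening 1 (tsupport w)
  have hS : volume S ^ (1 / r.toReal) ≠ ⊤ :=
    ENNReal.rpow_ne_top_of_nonneg (by simp) hK.measure_lt_top.ne
  have huc := hc.uniformContinuous_of_continuous hw
  rw [ENNReal.tendsto_nhds_zero]
  intro ε hε
  obtain ⟨c, hc0, hcε⟩ : ∃ c : ℝ, 0 < c ∧ ENNReal.ofReal c * volume S ^ (1 / r.toReal) ≤ ε := by
    obtain ⟨c, hc0, hc⟩ := ENNReal.exists_nnreal_pos_mul_lt hS hε.ne'
    exact ⟨c, hc0, by rw [ENNReal.ofReal_coe_nnreal]; exact hc.le⟩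
  obtain ⟨δ, hδ, hd⟩ := Metric.uniformContinuous_iff.1 huc c hc0
  filter_upwards [(tendsto_bump_rOut (N := N)).eventually_lt_const hδ,
    (tendsto_bump_rOut (N := N)).eventually_lt_const zero_lt_one] with n hn hn1
  have hsupp : Function.support w ⊆ S :=
    (subset_tsupport w).trans (self_subset_cthickening _)
  have hsupp2 : Function.support (mollify n w) ⊆ S := by
    refine (support_convolution_subset _).trans ?_
    rw [(bump N n).support_normed_eq]
    rintro _ ⟨a, ha, b, hb, rfl⟩
    refine mem_cthickening_of_dist_le _ b _ _ (subset_tsupport w hb) ?_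
    simp only [mem_ball, dist_zero_right] at ha
    simpa using (ha.trans hn1).le
  refine (eLpNorm_sub_le_of_dist_bdd volume hr' hK.measurableSet hc0.le (fun x => ?_)
    hsupp2 hsupp).trans hcε
  refine (bump N n).dist_normed_convolution_le hw.aestronglyMeasurable fun y hy => ?_
  exact (hd (lt_of_lt_of_le hy hn.le)).le

lemma tendsto_mollify [CompleteSpace F] {w : E N → F} {r : ℝ≥0∞} (hr : 1 ≤ r) (hr' : r ≠ ⊤)
    (hw : MemLp w r volume) :
    Tendsto (fun n => eLpNorm (fun x => mollify n w x - w x) r volume) atTop (𝓝 0) := by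
  rw [ENNReal.tendsto_nhds_zero]
  intro ε hε
  have hε3 : ε / 3 ≠ 0 := (ENNReal.div_pos hε.ne' (by simp)).ne'
  obtain ⟨g, hg, hgw, hgc, hgm⟩ := hw.exists_hasCompactSupport_eLpNorm_sub_le hr' hε3
  filter_upwards [ENNReal.tendsto_nhds_zero.1 (tendsto_mollify_of_continuous hgc hg hr') _
    (pos_iff_ne_zero.2 hε3)] with n hn
  have hwl := hw.locallyIntegrable hr
  have hgl := hgm.locallyIntegrable hr
  have e : (fun x => mollify n w x - w x) = (mollify n (fun x => w x - g x)) +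
      ((fun x => mollify n g x - g x) - (w - g)) := by
    rw [mollify_sub n hwl hgl]
    ext x
    simp only [Pi.add_apply, Pi.sub_apply]
    abel
  have m1 : AEStronglyMeasurable (mollify n (fun x => w x - g x)) volume :=
    (continuous_mollify n (hwl.sub hgl)).aestronglyMeasurable
  have m2 : AEStronglyMeasurable (fun x => mollify n g x - g x) volume :=
    ((continuous_mollify n hgl).sub hgc).aestronglyMeasurable
  have m3 : AEStronglyMeasurable (w - g) volume :=
    hw.1.sub hgc.aestronglyMeasurable
  rw [e]
  refine (eLpNorm_add_le m1 (m2.sub m3) hr).trans ?_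
  have h1 := (eLpNorm_mollify_le n m3 hr hr').trans hgw
  have h2 := (eLpNorm_sub_le m2 m3 hr).trans (add_le_add hn hgw)
  refine (add_le_add h1 h2).trans ?_
  rw [← add_assoc, ENNReal.add_thirds]

end Mollify

lemma contDiff_mollify (n : ℕ) {w : E N → ℝ} (hw : LocallyIntegrable w volume) :
    ContDiff ℝ ∞ (mollify n w) :=
  (bump N n).hasCompactSupport_normed.contDiff_convolution_left (n := ⊤) _
    (bump N n).contDiff_normed hw

lemma IsTest.comp_sub {η : E N → ℝ} (hη : IsTest η) (x : E N) : IsTest (fun t => η (x - t)) :=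
  ⟨hη.1.comp (contDiff_const.sub contDiff_id), hη.2.comp_homeomorph (Homeomorph.subLeft x)⟩

/-- The derivative falls on the kernel, and the definition of weak gradient with test function t ↦
ρ(x - t) moves it onto w. The sign from the definition cancels the one from differentiating in -t.
-/
lemma gradient_mollify (n : ℕ) {w : E N → ℝ} {G : E N → E N} (h : HasWeakGradient w G) :
    gradient (mollify n w) = mollify n G := by
  have hρ : IsTest ((bump N n).normed volume) :=
    ⟨(bump N n).contDiff_normed, (bump N n).hasCompactSupport_normed⟩
  ext1 x
  refine ext_inner_right ℝ fun v => ?_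
  rw [inner_gradient_left]
  have h1 := (hρ.2.hasFDerivAt_convolution_left (ContinuousLinearMap.lsmul ℝ ℝ)
    (hρ.1.of_le (by simp)) h.1 x).fderiv
  have h2 : fderiv ℝ (mollify n w) x v = ∫ t, w t * fderiv ℝ ((bump N n).normed volume) (x - t) v := by
    unfold mollify
    rw [h1, convolution_eq_swap, ContinuousLinearMap.integral_apply]
    · refine integral_congr_ae (.of_forall fun t => ?_)
      simp [ContinuousLinearMap.precompL_apply, mul_comm]
    · have hc : Continuous fun t => fderiv ℝ ((bump N n).normed volume) (x - t) :=
        (hρ.1.continuous_fderiv (by simp)).comp (continuous_const.sub continuous_id)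
      have hs : HasCompactSupport fun t => fderiv ℝ ((bump N n).normed volume) (x - t) :=
        (hρ.2.fderiv ℝ).comp_homeomorph (Homeomorph.subLeft x)
      refine (h.1.integrable_smul_right_of_hasCompactSupport hc hs).congr (.of_forall fun t => ?_)
      ext v
      simp [ContinuousLinearMap.precompL_apply, mul_comm]
  have h3 := h.2.2 _ (hρ.comp_sub x) v
  have h4 : ∀ t, fderiv ℝ (fun t => (bump N n).normed volume (x - t)) t v
      = - fderiv ℝ ((bump N n).normed volume) (x - t) v := by
    intro t
    have : HasFDerivAt (fun t => (bump N n).normed volume (x - t)) _ t :=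
      (hρ.differentiable (x - t)).hasFDerivAt.comp t ((hasFDerivAt_id t).const_sub x)
    rw [this.fderiv]
    simp
  simp only [h4, mul_neg] at h3
  rw [integral_neg, neg_inj] at h3
  have hi : Integrable fun t => (bump N n).normed volume (x - t) • G t :=
    h.2.1.integrable_smul_left_of_hasCompactSupport (hρ.comp_sub x).continuous (hρ.comp_sub x).2
  have h5 : mollify n G x = ∫ t, (bump N n).normed volume (x - t) • G t := by
    unfold mollify
    rw [convolution_eq_swap]
    rfl
  rw [h2, h3, h5, real_inner_comm, ← integral_inner hi]
  simp [inner_smul_right, real_inner_comm]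

/-! ### Cutoffs, density of test functions and the Sobolev inequality -/

/-- The bump function equal to `1` on the unit ball and supported in the ball of radius `2`. -/
def unitBump (N : ℕ) : ContDiffBump (0 : E N) := ⟨1, 2, one_pos, one_lt_two⟩

/-- The smooth cutoff equal to `1` on the ball of radius `R`, supported in the ball of radius
`2 R`. -/
def cutoff (N : ℕ) (R : ℝ) (x : E N) : ℝ := unitBump N (R⁻¹ • x)

lemma isTest_cutoff {R : ℝ} (hR : 0 < R) : IsTest (cutoff N R) :=
  IsTest.comp_smul (η := unitBump N) ⟨(unitBump N).contDiff, (unitBump N).hasCompactSupport⟩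
    (inv_ne_zero hR.ne')

lemma cutoff_nonneg (R : ℝ) (x : E N) : 0 ≤ cutoff N R x := (unitBump N).nonneg

lemma cutoff_le_one (R : ℝ) (x : E N) : cutoff N R x ≤ 1 := (unitBump N).le_one

lemma cutoff_eq_one {R : ℝ} (hR : 0 < R) {x : E N} (hx : ‖x‖ ≤ R) : cutoff N R x = 1 := by
  refine (unitBump N).one_of_mem_closedBall ?_
  simp only [mem_closedBall, dist_zero_right, norm_smul, norm_inv, Real.norm_of_nonneg hR.le]
  rw [inv_mul_le_iff₀ hR]
  simpa [unitBump] using hx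

lemma cutoff_eq_zero {R : ℝ} (hR : 0 < R) {x : E N} (hx : 2 * R ≤ ‖x‖) : cutoff N R x = 0 := by
  refine (unitBump N).zero_of_le_dist ?_
  simp only [dist_zero_right, norm_smul, norm_inv, Real.norm_of_nonneg hR.le]
  rw [le_inv_mul_iff₀ hR]
  simp only [unitBump]
  linarith

lemma fderiv_cutoff {R : ℝ} (x v : E N) :
    fderiv ℝ (cutoff N R) x v = R⁻¹ * fderiv ℝ (unitBump N) (R⁻¹ • x) v :=
  fderiv_comp_const_smul ((unitBump N).contDiff (n := 1).differentiable (by simp)) _ _ _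

lemma fderiv_cutoff_eq_zero {R : ℝ} (hR : 0 < R) {x : E N} (hx : ‖x‖ < R) :
    fderiv ℝ (cutoff N R) x = 0 := by
  have : cutoff N R =ᶠ[𝓝 x] fun _ => 1 := by
    filter_upwards [(isOpen_lt continuous_norm continuous_const).mem_nhds hx] with y hy
    exact cutoff_eq_one hR (le_of_lt hy)
  rw [this.fderiv_eq]
  simp

lemma fderiv_cutoff_eq_zero_of_lt {R : ℝ} (hR : 0 < R) {x : E N} (hx : 2 * R < ‖x‖) :
    fderiv ℝ (cutoff N R) x = 0 := by
  have : cutoff N R =ᶠ[𝓝 x] fun _ => 0 := by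
    filter_upwards [(isOpen_lt continuous_const continuous_norm).mem_nhds hx] with y hy
    exact cutoff_eq_zero hR (le_of_lt hy)
  rw [this.fderiv_eq]
  simp

/-- A bound for the derivative of the unit bump function. -/
lemma exists_fderiv_cutoff_le (N : ℕ) : ∃ C : ℝ, 0 ≤ C ∧ ∀ R : ℝ, 0 < R → ∀ x : E N,
    ‖fderiv ℝ (cutoff N R) x‖ ≤ C / R := by
  have hc : Continuous fun x => fderiv ℝ (unitBump N) x :=
    ((unitBump N).contDiff (n := 1)).continuous_fderiv (by simp)
  obtain ⟨C, hC⟩ := ((unitBump N).hasCompactSupport.fderiv ℝ).exists_bound_of_continuous hc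
  refine ⟨C, (norm_nonneg _).trans (hC 0), fun R hR x => ?_⟩
  refine ContinuousLinearMap.opNorm_le_bound _ (div_nonneg ((norm_nonneg _).trans (hC 0)) hR.le)
    fun v => ?_
  rw [fderiv_cutoff, norm_mul, norm_inv, Real.norm_of_nonneg hR.le, div_mul_eq_mul_div,
    div_eq_inv_mul]
  gcongr
  exact (ContinuousLinearMap.le_opNorm _ _).trans (by gcongr; exact hC _)

lemma tendsto_eLpNorm_of_dominated {F F' : Type*} [NormedAddCommGroup F] [NormedAddCommGroup F']
    {r : ℝ≥0∞} (hr : r ≠ ⊤)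
    {w : ℕ → E N → F} {b : E N → F'} (hb : MemLp b r volume)
    (hm : ∀ n, AEStronglyMeasurable (w n) volume) (hwb : ∀ n x, ‖w n x‖ ≤ ‖b x‖)
    (hlim : ∀ x, Tendsto (fun n => w n x) atTop (𝓝 0)) :
    Tendsto (fun n => eLpNorm (w n) r volume) atTop (𝓝 0) := by
  rcases eq_or_ne r 0 with rfl | hr0
  · simp
  have hrp := ENNReal.toReal_pos hr0 hr
  have h := tendsto_lintegral_of_dominated_convergence' (μ := volume)
    (F := fun n x => ‖w n x‖ₑ ^ r.toReal) (f := fun _ => 0) (fun x => ‖b x‖ₑ ^ r.toReal)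
    (fun n => (hm n).enorm.pow_const _)
    (fun n => .of_forall fun x => by
      dsimp only
      gcongr
      exact enorm_le_iff_norm_le.2 (hwb n x))
    (lintegral_rpow_enorm_lt_top_of_eLpNorm_lt_top hr0 hr hb.2).ne
    (.of_forall fun x => by
      have := (hlim x).enorm.ennrpow_const r.toReal
      simpa [hrp] using this)
  simp only [eLpNorm_eq_lintegral_rpow_enorm_toReal hr0 hr]
  simpa [hrp] using h.ennrpow_const (1 / r.toReal)

lemma tendsto_cutoff_mul {F : Type*} [NormedAddCommGroup F] [NormedSpace ℝ F] {r : ℝ≥0∞}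
    (hr : r ≠ ⊤) {w : E N → F} (hw : MemLp w r volume) :
    Tendsto (fun n : ℕ => eLpNorm (fun x => cutoff N (n + 1) x • w x - w x) r volume)
      atTop (𝓝 0) := by
  refine tendsto_eLpNorm_of_dominated hr hw (fun n => ?_) (fun n x => ?_) fun x => ?_
  · exact ((isTest_cutoff (N := N) (R := n + 1)
      (by positivity)).continuous.aestronglyMeasurable.smul hw.1).sub hw.1
  · have : cutoff N (n + 1) x • w x - w x = (cutoff N (n + 1) x - 1) • w x := by
      rw [sub_smul, one_smul]
    rw [this, norm_smul]
    refine mul_le_of_le_one_left (norm_nonneg _) ?_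
    rw [Real.norm_eq_abs, abs_le]
    constructor <;> linarith [cutoff_nonneg (n + 1 : ℝ) x, cutoff_le_one (n + 1 : ℝ) x]
  · refine tendsto_const_nhds.congr' ?_
    filter_upwards [eventually_ge_atTop ⌈‖x‖⌉₊] with n hn
    rw [cutoff_eq_one (by positivity) ((Nat.ceil_le.1 hn).trans (by linarith))]
    simp

/-- Truncate, then mollify. The point of the form is that one sequence serves for the gradient in L²
and for v in every L^r containing it: an equation whose terms live in different Lebesgue spaces can
then be passed to the limit as a whole. -/
lemma HasWeakGradient.exists_test_seq {v : E N → ℝ} {G : E N → E N} (h : HasWeakGradient v G)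
    (hv : MemLp v 2 volume) (hG : MemLp G 2 volume) :
    ∃ η : ℕ → E N → ℝ, (∀ n, IsTest (η n)) ∧
      Tendsto (fun n => eLpNorm (fun x => gradient (η n) x - G x) 2 volume) atTop (𝓝 0) ∧
      ∀ r : ℝ≥0∞, 1 ≤ r → r ≠ ⊤ → MemLp v r volume →
        Tendsto (fun n => eLpNorm (fun x => η n x - v x) r volume) atTop (𝓝 0) := by
  have hχ : ∀ n : ℕ, IsTest (cutoff N (n + 1)) := fun n => isTest_cutoff (by positivity)
  have hw : ∀ n : ℕ, HasWeakGradient (fun x => cutoff N (n + 1) x * v x)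
    (fun x => cutoff N (n + 1) x • G x + v x • gradient (cutoff N (n + 1)) x) := fun n =>
    h.contDiff_mul (hχ n).1
  have key : ∀ {F : Type} [NormedAddCommGroup F] [NormedSpace ℝ F] [CompleteSpace F]
      (w : ℕ → E N → F) (w' : E N → F) (r : ℝ≥0∞), 1 ≤ r → r ≠ ⊤ → MemLp w' r volume →
      (∀ n, LocallyIntegrable (w n) volume) →
      Tendsto (fun n => eLpNorm (fun x => w n x - w' x) r volume) atTop (𝓝 0) →
      Tendsto (fun n => eLpNorm (fun x => mollify n (w n) x - w' x) r volume) atTop (𝓝 0) := by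
    intro F _ _ _ w w' r hr hr' hw' hw h
    refine tendsto_of_tendsto_of_tendsto_of_le_of_le tendsto_const_nhds
      (by simpa using h.add (tendsto_mollify hr hr' hw')) (fun n => zero_le) fun n => ?_
    have hl := hw'.locallyIntegrable hr
    have e : (fun x => mollify n (w n) x - w' x) = mollify n (fun x => w n x - w' x) +
        fun x => mollify n w' x - w' x := by
      rw [mollify_sub n (hw n) hl]
      ext x
      simp
    rw [e]
    have m1 := ((hw n).sub hl).aestronglyMeasurable
    refine (eLpNorm_add_le (continuous_mollify n ((hw n).sub hl)).aestronglyMeasurable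
      ((continuous_mollify n hl).aestronglyMeasurable.sub hw'.1) hr).trans ?_
    exact add_le_add_left (eLpNorm_mollify_le n m1 hr hr') _
  refine ⟨fun n => mollify n fun x => cutoff N (n + 1) x * v x, fun n =>
    ⟨contDiff_mollify n (hw n).1, hasCompactSupport_mollify n (hχ n).2.mul_right⟩, ?_, ?_⟩
  · simp only [gradient_mollify _ (hw _)]
    refine key _ G 2 (by norm_num) (by norm_num) hG (fun n => (hw n).2.1) ?_
    obtain ⟨C, hC0, hC⟩ := exists_fderiv_cutoff_le N
    have h1 := tendsto_cutoff_mul (r := 2) (by norm_num) hG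
    -- The commutator v∇χ is dominated by C|v| ∈ L², and at each point it vanishes once the plateau
    -- of the cutoff contains that point.
    have h2 : Tendsto (fun n : ℕ => eLpNorm (fun x => v x • gradient (cutoff N (n + 1)) x) 2 volume)
        atTop (𝓝 0) := by
      refine tendsto_eLpNorm_of_dominated (by norm_num) (hv.const_mul C) (fun n => ?_)
        (fun n x => ?_) fun x => ?_
      · exact hv.1.smul (contDiff_gradient (hχ n).1).continuous.aestronglyMeasurable
      · rw [norm_smul, norm_gradient, mul_comm, norm_mul, Real.norm_of_nonneg hC0]
        gcongr
        refine (hC _ (by positivity) x).trans (div_le_self hC0 (by linarith [n.cast_nonneg (α := ℝ)]))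
      · refine tendsto_const_nhds.congr' ?_
        filter_upwards [eventually_ge_atTop ⌈‖x‖⌉₊] with n hn
        have : gradient (cutoff N (n + 1)) x = 0 := by
          rw [← norm_eq_zero, norm_gradient, fderiv_cutoff_eq_zero (by positivity)
            ((Nat.ceil_le.1 hn).trans_lt (by linarith)), norm_zero]
        simp [this]
    refine tendsto_of_tendsto_of_tendsto_of_le_of_le tendsto_const_nhds
      (by simpa using h1.add h2) (fun n => zero_le) fun n => ?_
    have e : (fun x => cutoff N (n + 1) x • G x + v x • gradient (cutoff N (n + 1)) x - G x) =
      (fun x => cutoff N (n + 1) x • G x - G x) + fun x => v x • gradient (cutoff N (n + 1)) x := by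
      ext1 x
      simp only [Pi.add_apply]
      abel
    rw [e]
    exact eLpNorm_add_le (((hχ n).continuous.aestronglyMeasurable.smul hG.1).sub hG.1)
      (hv.1.smul (contDiff_gradient (hχ n).1).continuous.aestronglyMeasurable) (by norm_num)
  · intro r hr hr' hvr
    exact key _ v r hr hr' hvr (fun n => (hw n).1) (tendsto_cutoff_mul hr' hvr)

/-- The Gagliardo-Nirenberg-Sobolev inequality for test functions passes to the limit: gradients
converge in L², a subsequence of the functions converges almost everywhere, and the left-hand norm
is lower semicontinuous by Fatou. -/
lemma HasWeakGradient.sobolev (hN : 3 ≤ N) : ∃ C : ℝ≥0∞, C ≠ ⊤ ∧ ∀ {v : E N → ℝ} {G : E N → E N},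
    HasWeakGradient v G → MemLp v 2 volume → MemLp G 2 volume →
    eLpNorm v (ENNReal.ofReal (2 * N / (N - 2))) volume ≤ C * eLpNorm G 2 volume := by
  have hN' : (3 : ℝ) ≤ N := by exact_mod_cast hN
  set p' : NNReal := Real.toNNReal (2 * N / (N - 2)) with hp'
  refine ⟨SNormLESNormFDerivOfEqConst ℝ (volume : Measure (E N)) 2, ENNReal.coe_ne_top,
    fun {v G} h hv hG => ?_⟩
  obtain ⟨η, hη, hη2, hη3⟩ := h.exists_test_seq hv hG
  have h1 : ∀ n, eLpNorm (η n) p' volume ≤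
      SNormLESNormFDerivOfEqConst ℝ (volume : Measure (E N)) 2 *
        eLpNorm (gradient (η n)) 2 volume := by
    intro n
    have := eLpNorm_le_eLpNorm_fderiv_of_eq (volume : Measure (E N)) (u := η n) (p := 2) (p' := p')
      ((hη n).1.of_le (by simp)) (hη n).2 (by norm_num) (by simp; omega) (by
        rw [hp', Real.coe_toNNReal _ (div_nonneg (by linarith) (by linarith))]
        have : (N : ℝ) - 2 ≠ 0 := by linarith
        simp
        field_simp)
    refine this.trans (le_of_eq ?_)
    congr 1
    exact eLpNorm_congr_norm_ae (.of_forall fun x => (norm_gradient _ _).symm)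
  have h2 : Tendsto (fun n => eLpNorm (gradient (η n)) 2 volume) atTop
      (𝓝 (eLpNorm G 2 volume)) := by
    have hm : ∀ n, AEStronglyMeasurable (gradient (η n)) volume := fun n =>
      (contDiff_gradient (hη n).1).continuous.aestronglyMeasurable
    have b1 : ∀ n, eLpNorm (gradient (η n)) 2 volume ≤
        eLpNorm G 2 volume + eLpNorm (fun x => gradient (η n) x - G x) 2 volume := fun n => by
      have := eLpNorm_add_le hG.1 ((hm n).sub hG.1) (p := 2) (by norm_num)
      rwa [add_sub_cancel] at this
    have b2 : ∀ n, eLpNorm G 2 volume - eLpNorm (fun x => gradient (η n) x - G x) 2 volume ≤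
        eLpNorm (gradient (η n)) 2 volume := fun n => by
      have := eLpNorm_sub_le (hm n) ((hm n).sub hG.1) (p := 2) (by norm_num)
      rw [tsub_le_iff_right]
      rwa [sub_sub_cancel] at this
    refine tendsto_of_tendsto_of_tendsto_of_le_of_le ?_ ?_ b2 b1
    · simpa using ENNReal.Tendsto.sub tendsto_const_nhds hη2 (Or.inl hG.2.ne)
    · simpa using tendsto_const_nhds.add hη2
  obtain ⟨ns, hns, hae⟩ := (tendstoInMeasure_of_tendsto_eLpNorm (p := 2) (by norm_num)
    (fun n => (hη n).continuous.aestronglyMeasurable) hv.1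
    (hη3 2 (by norm_num) (by norm_num) hv)).exists_seq_tendsto_ae
  have h3 := Lp.eLpNorm_lim_le_liminf_eLpNorm (p := (p' : ℝ≥0∞))
    (fun n => (hη (ns n)).continuous.aestronglyMeasurable) v hae
  refine h3.trans ?_
  have h4 : Tendsto (fun n => SNormLESNormFDerivOfEqConst ℝ (volume : Measure (E N)) 2 *
      eLpNorm (gradient (η (ns n))) 2 volume) atTop
      (𝓝 (SNormLESNormFDerivOfEqConst ℝ (volume : Measure (E N)) 2 * eLpNorm G 2 volume)) :=
    ENNReal.Tendsto.const_mul (h2.comp hns.tendsto_atTop) (Or.inr ENNReal.coe_ne_top)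
  rw [← h4.liminf_eq]
  exact liminf_le_liminf (.of_forall fun n => h1 _)

lemma HasWeakGradient.memLp_sobolev (hN : 3 ≤ N) {v : E N → ℝ} {G : E N → E N}
    (h : HasWeakGradient v G) (hv : MemLp v 2 volume) (hG : MemLp G 2 volume) :
    MemLp v (ENNReal.ofReal (2 * N / (N - 2))) volume := by
  obtain ⟨C, hC, h'⟩ := HasWeakGradient.sobolev hN
  exact ⟨hv.1, (h' h hv hG).trans_lt (ENNReal.mul_lt_top hC.lt_top hG.2)⟩

/-- The Sobolev inequality does the job of "a function with zero gradient is constant, and a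
constant in L² is zero". -/
lemma HasWeakGradient.eq_zero (hN : 3 ≤ N) {v : E N → ℝ} {G : E N → E N}
    (h : HasWeakGradient v G) (hv : MemLp v 2 volume) (hG : G =ᵐ[volume] 0) : v =ᵐ[volume] 0 := by
  obtain ⟨C, hC, h'⟩ := HasWeakGradient.sobolev hN
  have hN' : (3 : ℝ) ≤ N := by exact_mod_cast hN
  have h0 := h' h hv ((memLp_congr_ae hG).2 MemLp.zero)
  rw [eLpNorm_congr_ae hG, eLpNorm_zero, mul_zero, nonpos_iff_eq_zero] at h0
  refine (eLpNorm_eq_zero_iff hv.1 ?_).1 h0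
  simp only [ne_eq, ENNReal.ofReal_eq_zero, not_le]
  exact div_pos (by linarith) (by linarith)

/-! ### Limits of dual pairings and the chain rule -/

lemma enorm_integral_mul_le {r r' : ℝ≥0∞} [hr : ENNReal.HolderConjugate r r'] {k d : E N → ℝ}
    (hk : AEStronglyMeasurable k volume) (hd : AEStronglyMeasurable d volume) :
    ‖∫ x, k x * d x‖ₑ ≤ eLpNorm k r volume * eLpNorm d r' volume := by
  refine (enorm_integral_le_lintegral_enorm _).trans ?_
  rw [← eLpNorm_one_eq_lintegral_enorm]
  have := eLpNorm_smul_le_mul_eLpNorm (p := r) (q := r') (r := 1) hd hk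
  exact this

lemma tendsto_integral_mul {r r' : ℝ≥0∞} [hr : ENNReal.HolderConjugate r r'] {k d : E N → ℝ}
    {e : ℕ → E N → ℝ} (hk : MemLp k r volume) (hd : MemLp d r' volume)
    (he : ∀ n, AEStronglyMeasurable (e n) volume)
    (h : Tendsto (fun n => eLpNorm (fun x => e n x - d x) r' volume) atTop (𝓝 0)) :
    Tendsto (fun n => ∫ x, k x * e n x) atTop (𝓝 (∫ x, k x * d x)) := by
  rw [tendsto_iff_edist_tendsto_0]
  refine tendsto_of_tendsto_of_tendsto_of_le_of_le' tendsto_const_nhds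
    (by simpa using ENNReal.Tendsto.const_mul h (Or.inr hk.2.ne)) (.of_forall fun n => zero_le) ?_
  filter_upwards [h.eventually_lt_const one_pos] with n hn
  have hm := (he n).sub hd.1
  have hL : MemLp (fun x => e n x - d x) r' volume := ⟨hm, hn.trans ENNReal.one_lt_top⟩
  have hi : Integrable fun x => k x * (e n x - d x) := hk.integrable_mul hL
  have hi2 : Integrable fun x => k x * d x := hk.integrable_mul hd
  have hi3 : Integrable fun x => k x * e n x := (hi.add hi2).congr (.of_forall fun x => by
    simp only [Pi.add_apply]; ring)
  rw [edist_eq_enorm_sub, ← integral_sub hi3 hi2]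
  simp only [← mul_sub]
  exact enorm_integral_mul_le hk.1 hm

lemma integrable_inner {F : Type*} [NormedAddCommGroup F] [InnerProductSpace ℝ F] {k d : E N → F}
    (hk : MemLp k 2 volume) (hd : MemLp d 2 volume) :
    Integrable fun x => inner ℝ (k x) (d x) :=
  (hk.norm.integrable_mul hd.norm).mono (hk.1.inner hd.1) (.of_forall fun x => by
    simpa using abs_real_inner_le_norm _ _)

lemma tendsto_integral_inner {k d : E N → E N}
    {e : ℕ → E N → E N} (hk : MemLp k 2 volume) (hd : MemLp d 2 volume)
    (he : ∀ n, AEStronglyMeasurable (e n) volume)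
    (h : Tendsto (fun n => eLpNorm (fun x => e n x - d x) 2 volume) atTop (𝓝 0)) :
    Tendsto (fun n => ∫ x, inner ℝ (e n x) (k x)) atTop (𝓝 (∫ x, inner ℝ (d x) (k x))) := by
  rw [tendsto_iff_edist_tendsto_0]
  refine tendsto_of_tendsto_of_tendsto_of_le_of_le' tendsto_const_nhds
    (by simpa using ENNReal.Tendsto.const_mul h (Or.inr hk.2.ne)) (.of_forall fun n => zero_le) ?_
  filter_upwards [h.eventually_lt_const one_pos] with n hn
  have hm := (he n).sub hd.1
  have hL : MemLp (fun x => e n x - d x) 2 volume := ⟨hm, hn.trans ENNReal.one_lt_top⟩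
  have hi : Integrable fun x => inner ℝ (e n x - d x) (k x) := integrable_inner hL hk
  have hi2 : Integrable fun x => inner ℝ (d x) (k x) := integrable_inner hd hk
  have hi3 : Integrable fun x => inner ℝ (e n x) (k x) := (hi.add hi2).congr
    (.of_forall fun x => by simp only [Pi.add_apply, inner_sub_left]; ring)
  rw [edist_eq_enorm_sub, ← integral_sub hi3 hi2]
  simp only [← inner_sub_left]
  have := enorm_integral_mul_le (r := 2) (r' := 2) (k := fun x => ‖k x‖)
    (d := fun x => ‖e n x - d x‖) hk.1.norm hm.norm
  rw [eLpNorm_norm, eLpNorm_norm] at this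
  refine le_trans ?_ this
  refine enorm_le_iff_norm_le.2 ?_
  have h0 : 0 ≤ ∫ x, ‖k x‖ * ‖e n x - d x‖ := integral_nonneg fun x => by positivity
  rw [Real.norm_of_nonneg h0]
  refine norm_integral_le_of_norm_le (hk.norm.integrable_mul hL.norm) (.of_forall fun x => ?_)
  exact (norm_inner_le_norm _ _).trans_eq (mul_comm _ _)

/-- With test functions η_n → v, the gradient error splits as F'(η_n)(∇η_n - G) + (F'(η_n) -
F'(v))G. The first part tends to zero in L² since |F'| ≤ 1. The second tends to zero when paired
with ζw, because F' is 1-Lipschitz and ζ G·w lies in L². -/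
lemma HasWeakGradient.comp {v : E N → ℝ} {G : E N → E N} (h : HasWeakGradient v G)
    (hv : MemLp v 2 volume) (hG : MemLp G 2 volume) {F F' : ℝ → ℝ}
    (hF : ∀ t, HasDerivAt F (F' t) t) (hb : ∀ t, |F' t| ≤ 1) (hL : ∀ a b, |F' a - F' b| ≤ |a - b|)
    (h0 : F 0 = 0) :
    HasWeakGradient (fun x => F (v x)) (fun x => F' (v x) • G x) := by
  have hFL : ∀ a b, |F a - F b| ≤ |a - b| := fun a b => by
    have := Convex.norm_image_sub_le_of_norm_hasDerivWithin_le (f := F) (f' := F') (s := univ)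
      (C := 1) (x := b) (y := a) (fun x _ => (hF x).hasDerivWithinAt) (fun x _ => hb x) convex_univ
      (mem_univ _) (mem_univ _)
    simpa using this
  have hFc : Continuous F := continuous_iff_continuousAt.2 fun t => (hF t).continuousAt
  have hF'c : Continuous F' := by
    have : LipschitzWith 1 F' := LipschitzWith.of_dist_le_mul fun a b => by
      simpa [Real.dist_eq] using hL a b
    exact this.continuous
  obtain ⟨η, hη, hη2, hη3⟩ := h.exists_test_seq hv hG
  have hη2v := hη3 2 (by norm_num) (by norm_num) hv
  have mF : AEStronglyMeasurable (fun x => F (v x)) volume := hFc.comp_aestronglyMeasurable hv.1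
  have mF' : AEStronglyMeasurable (fun x => F' (v x)) volume := hF'c.comp_aestronglyMeasurable hv.1
  have hFv : MemLp (fun x => F (v x)) 2 volume := hv.mono mF (.of_forall fun x => by
    simpa [h0] using hFL (v x) 0)
  have hFG : MemLp (fun x => F' (v x) • G x) 2 volume := hG.mono (mF'.smul hG.1)
    (.of_forall fun x => by
      rw [norm_smul]
      exact mul_le_of_le_one_left (norm_nonneg _) (hb _))
  refine ⟨hFv.locallyIntegrable (by norm_num), hFG.locallyIntegrable (by norm_num),
    fun ζ hζ w => ?_⟩
  have hζw := hζ.fderiv_apply w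
  have e : ∀ n, ∫ x, F (η n x) * fderiv ℝ ζ x w =
      - ∫ x, ζ x * (F' (η n x) * inner ℝ (gradient (η n) x) w) := by
    intro n
    have hd : ∀ x, HasFDerivAt (fun x => F (η n x)) (F' (η n x) • fderiv ℝ (η n) x) x := fun x =>
      (hF _).comp_hasFDerivAt x ((hη n).differentiable x).hasFDerivAt
    have hc : Continuous fun x => F (η n x) := hFc.comp (hη n).continuous
    have hc' : Continuous fun x => fderiv ℝ (fun x => F (η n x)) x w := by
      simp only [(hd _).fderiv]
      exact (hF'c.comp (hη n).continuous).mul ((hη n).fderiv_apply w).continuous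
    rw [integral_mul_fderiv_eq_neg_fderiv_mul_of_integrable]
    · simp only [(hd _).fderiv, inner_gradient_left]
      simp [mul_comm]
    · exact (hc'.mul hζ.continuous).integrable_of_hasCompactSupport hζ.2.mul_left
    · exact (hc.mul hζw.continuous).integrable_of_hasCompactSupport hζw.2.mul_left
    · exact (hc.mul hζ.continuous).integrable_of_hasCompactSupport hζ.2.mul_left
    · exact fun x _ => (hd x).differentiableAt
    · exact fun x _ => hζ.differentiable x
  have t1 : Tendsto (fun n => ∫ x, F (η n x) * fderiv ℝ ζ x w) atTop
      (𝓝 (∫ x, F (v x) * fderiv ℝ ζ x w)) := by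
    have := tendsto_integral_mul (r := 2) (r' := 2) (k := fun x => fderiv ℝ ζ x w)
      (d := fun x => F (v x)) (e := fun n x => F (η n x))
      (hζw.continuous.memLp_of_hasCompactSupport hζw.2) hFv
      (fun n => (hFc.comp (hη n).continuous).aestronglyMeasurable)
      (tendsto_of_tendsto_of_tendsto_of_le_of_le tendsto_const_nhds hη2v (fun n => zero_le)
        fun n => eLpNorm_mono fun x => hFL _ _)
    simpa only [mul_comm] using this
  have t2 : Tendsto (fun n => ∫ x, ζ x * (F' (η n x) * inner ℝ (gradient (η n) x) w)) atTop
      (𝓝 (∫ x, ζ x * inner ℝ (F' (v x) • G x) w)) := by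
    have hζ2 : MemLp ζ 2 volume := hζ.continuous.memLp_of_hasCompactSupport hζ.2
    have hcg : ∀ n, Continuous (gradient (η n)) := fun n => (contDiff_gradient (hη n).1).continuous
    have a1 : Tendsto (fun n => ∫ x, inner ℝ (F' (η n x) • (gradient (η n) x - G x)) (ζ x • w)) atTop
        (𝓝 (∫ x, inner ℝ (0 : E N) (ζ x • w))) := by
      refine tendsto_integral_inner (k := fun x => ζ x • w) (d := fun _ => 0)
        (e := fun n x => F' (η n x) • (gradient (η n) x - G x)) ?_ MemLp.zero (fun n => ?_) ?_
      · exact (hζ.continuous.smul continuous_const).memLp_of_hasCompactSupport hζ.2.smul_right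
      · exact (hF'c.comp (hη n).continuous).aestronglyMeasurable.smul
          ((hcg n).aestronglyMeasurable.sub hG.1)
      · refine tendsto_of_tendsto_of_tendsto_of_le_of_le tendsto_const_nhds hη2 (fun n => zero_le)
          fun n => eLpNorm_mono fun x => ?_
        rw [sub_zero, norm_smul]
        exact mul_le_of_le_one_left (norm_nonneg _) (hb _)
    obtain ⟨Z, hZ⟩ := hζ.2.exists_bound_of_continuous hζ.continuous
    have hk : MemLp (fun x => ζ x * inner ℝ (G x) w) 2 volume := by
      refine (hG.norm.const_mul (Z * ‖w‖)).mono
        (hζ.continuous.aestronglyMeasurable.mul (hG.1.inner_const)) (.of_forall fun x => ?_)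
      have hZ0 : 0 ≤ Z := (norm_nonneg _).trans (hZ 0)
      rw [norm_mul, norm_mul, norm_mul, norm_norm, norm_norm, Real.norm_of_nonneg hZ0, mul_assoc,
        mul_comm ‖w‖]
      exact mul_le_mul (hZ x) (norm_inner_le_norm _ _) (norm_nonneg _) hZ0
    have a2 : Tendsto (fun n => ∫ x, (ζ x * inner ℝ (G x) w) * (F' (η n x) - F' (v x))) atTop
        (𝓝 (∫ x, (ζ x * inner ℝ (G x) w) * 0)) := by
      refine tendsto_integral_mul (r := 2) (r' := 2) (d := fun _ => 0)
        (e := fun n x => F' (η n x) - F' (v x)) hk MemLp.zero (fun n => ?_) ?_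
      · exact (hF'c.comp (hη n).continuous).aestronglyMeasurable.sub mF'
      · refine tendsto_of_tendsto_of_tendsto_of_le_of_le tendsto_const_nhds hη2v
          (fun n => zero_le) fun n => eLpNorm_mono fun x => ?_
        rw [sub_zero]
        exact hL _ _
    have a3 := (a1.add a2).add_const (∫ x, ζ x * inner ℝ (F' (v x) • G x) w)
    simp only [inner_zero_left, mul_zero, integral_zero, add_zero, zero_add] at a3
    refine a3.congr fun n => ?_
    have hli : LocallyIntegrable (fun x => F' (η n x) * inner ℝ (G x) w) volume :=
      (h.2.1.inner_const w).continuous_mul (hF'c.comp (hη n).continuous)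
    have i1 : Integrable fun x => inner ℝ (F' (η n x) • (gradient (η n) x - G x)) (ζ x • w) := by
      have hl2 : LocallyIntegrable (fun x => F' (η n x) • (gradient (η n) x - G x)) volume :=
        ((hcg n).locallyIntegrable.sub h.2.1).continuous_smul (hF'c.comp (hη n).continuous)
      refine ((hl2.inner_const w).integrable_test_mul hζ.continuous hζ.2).congr
        (.of_forall fun x => ?_)
      simp only [inner_smul_right]
    have i3 : Integrable fun x => ζ x * inner ℝ (F' (v x) • G x) w :=
      ((hFG.locallyIntegrable (by norm_num)).inner_const w).integrable_test_mul hζ.continuous hζ.2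
    have i2 : Integrable fun x => (ζ x * inner ℝ (G x) w) * (F' (η n x) - F' (v x)) := by
      refine ((hli.integrable_test_mul hζ.continuous hζ.2).sub i3).congr (.of_forall fun x => ?_)
      simp only [Pi.sub_apply, inner_smul_left, conj_trivial]
      ring
    rw [← integral_add i1 i2]
    have i12 : Integrable fun x => inner ℝ (F' (η n x) • (gradient (η n) x - G x)) (ζ x • w) +
      (ζ x * inner ℝ (G x) w) * (F' (η n x) - F' (v x)) := i1.add i2
    rw [← integral_add i12 i3]
    refine integral_congr_ae (.of_forall fun x => ?_)
    simp only [inner_smul_left, inner_smul_right, inner_sub_left, conj_trivial]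
    ring
  exact tendsto_nhds_unique t1 (by simpa only [e] using t2.neg)

lemma integrable_mul_of_memLp {r r' : ℝ≥0∞} [ENNReal.HolderConjugate r r'] {k d : E N → ℝ}
    (hk : MemLp k r volume) (hd : MemLp d r' volume) : Integrable fun x => k x * d x :=
  hk.integrable_mul hd

/-! ### Differentiating integrals under dilations -/

lemma hasDerivAt_integral_comp_smul {g ζ : E N → ℝ} (hg : LocallyIntegrable g volume)
    (hζ : IsTest ζ) :
    HasDerivAt (fun l : ℝ => ∫ x, g x * ζ (l • x)) (∫ x, g x * fderiv ℝ ζ x x) 1 := by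
  obtain ⟨R, hR0, hR⟩ := hζ.2.isCompact.isBounded.exists_pos_norm_le
  have hc : Continuous (fderiv ℝ ζ) := hζ.1.continuous_fderiv (by simp)
  obtain ⟨C, hC⟩ := (hζ.2.fderiv ℝ).exists_bound_of_continuous hc
  have hC0 : 0 ≤ C := (norm_nonneg _).trans (hC 0)
  have hcl : Continuous fun x => fderiv ℝ ζ x x := hc.clm_apply continuous_id
  have hm : ∀ l : ℝ, AEStronglyMeasurable (fun x => g x * ζ (l • x)) volume := fun l =>
    hg.aestronglyMeasurable.mul (hζ.continuous.comp (continuous_const_smul l)).aestronglyMeasurable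
  have key := hasDerivAt_integral_of_dominated_loc_of_deriv_le (μ := volume) (x₀ := (1 : ℝ))
    (s := ball 1 (1 / 2)) (F := fun l x => g x * ζ (l • x))
    (F' := fun l x => g x * fderiv ℝ ζ (l • x) x)
    -- For l > 1/2 the support of x ↦ ζ(l x) lies in the ball of radius 2R, where |x| ≤ 2R also
    -- bounds the l-derivative.
    (bound := (closedBall (0 : E N) (2 * R)).indicator fun x => ‖g x‖ * (C * (2 * R)))
    (ball_mem_nhds _ (by norm_num)) (.of_forall hm)
    (by simpa using hg.integrable_mul_test hζ.continuous hζ.2)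
    (by simp only [one_smul]; exact hg.aestronglyMeasurable.mul hcl.aestronglyMeasurable)
    (.of_forall fun x l hl => ?_) ?_ (.of_forall fun x l hl => ?_)
  · simpa using key.2
  · have hl2 : 1 / 2 < l := by
      have := abs_lt.1 (by simpa [Real.dist_eq] using hl : |l - 1| < 2⁻¹)
      norm_num at this ⊢
      linarith [this.1]
    by_cases hx : x ∈ closedBall (0 : E N) (2 * R)
    · rw [indicator_of_mem hx, norm_mul]
      gcongr
      refine (ContinuousLinearMap.le_opNorm _ _).trans ?_
      gcongr
      · exact hC _
      · simpa using hx
    · rw [indicator_of_notMem hx]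
      simp only [mem_closedBall, dist_zero_right, not_le] at hx
      have : fderiv ℝ ζ (l • x) = 0 := by
        by_contra hne
        have h1 := hR _ (support_fderiv_subset ℝ hne)
        rw [norm_smul, Real.norm_of_nonneg (by linarith)] at h1
        nlinarith
      simp [this]
  · rw [integrable_indicator_iff measurableSet_closedBall]
    exact ((hg.integrableOn_isCompact (isCompact_closedBall _ _)).norm.mul_const _)
  · have : HasDerivAt (fun l : ℝ => ζ (l • x)) (fderiv ℝ ζ (l • x) x) l := by
      have h1 : HasDerivAt (fun l : ℝ => l • x) x l := by
        simpa using (hasDerivAt_id l).smul_const x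
      exact (hζ.differentiable _).hasFDerivAt.comp_hasDerivAt l h1
    exact this.const_mul _

lemma hasDerivAt_integral_comp_inv_smul {g ζ : E N → ℝ} (hg : LocallyIntegrable g volume)
    (hζ : IsTest ζ) :
    HasDerivAt (fun l : ℝ => ∫ x, g x * ζ (l⁻¹ • x)) (-∫ x, g x * fderiv ℝ ζ x x) 1 := by
  have h1 := hasDerivAt_inv (one_ne_zero (α := ℝ))
  have h2 : HasDerivAt (fun l : ℝ => ∫ x, g x * ζ (l • x)) (∫ x, g x * fderiv ℝ ζ x x)
    ((1 : ℝ)⁻¹) := by simpa using hasDerivAt_integral_comp_smul hg hζ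
  simpa [Function.comp_def] using h2.comp 1 h1

lemma integral_test_comp_smul {w ζ : E N → ℝ} {l : ℝ} (hl : 0 < l) :
    ∫ x, ζ x * w (l • x) = (l ^ N)⁻¹ * ∫ x, w x * ζ (l⁻¹ • x) := by
  have := Measure.integral_comp_smul volume (fun x : E N => w x * ζ (l⁻¹ • x)) l
  simp only [smul_smul, inv_mul_cancel₀ hl.ne', one_smul, smul_eq_mul, finrank_euclideanSpace,
    Fintype.card_fin, mul_comm (w _) (ζ _)] at this
  rw [this, abs_of_pos (by positivity)]
  simp only [mul_comm]

/-- A change of variables moves the dilation from w to the smooth factor ζ, at the price of the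
Jacobian l^(-N). Differentiating there and applying `HasWeakGradient.integral_div` returns the
derivative to w. A general base point l₀ reduces to 1 by replacing w with w(l₀ ·). -/
lemma HasWeakGradient.hasDerivAt_integral_test {w : E N → ℝ} {G : E N → E N}
    (h : HasWeakGradient w G) {ζ : E N → ℝ} (hζ : IsTest ζ) {l₀ : ℝ} (hl₀ : 0 < l₀) :
    HasDerivAt (fun l : ℝ => ∫ x, ζ x * w (l • x)) (∫ x, ζ x * inner ℝ (G (l₀ • x)) x) l₀ := by
  have key : ∀ {w : E N → ℝ} {G : E N → E N}, HasWeakGradient w G →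
      HasDerivAt (fun l : ℝ => ∫ x, ζ x * w (l • x)) (∫ x, ζ x * inner ℝ (G x) x) 1 := by
    intro w G h
    have h1 := hasDerivAt_integral_comp_inv_smul h.1 hζ
    have h2 : HasDerivAt (fun l : ℝ => (l ^ N)⁻¹) (-(N : ℝ)) 1 := by
      have := (hasDerivAt_pow N (1 : ℝ)).fun_inv (by simp)
      simpa using this
    have h3 := h2.mul h1
    have hev : (fun l : ℝ => ∫ x, ζ x * w (l • x)) =ᶠ[𝓝 1]
        (fun l : ℝ => (l ^ N)⁻¹) * fun l : ℝ => ∫ x, w x * ζ (l⁻¹ • x) := by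
      filter_upwards [lt_mem_nhds (zero_lt_one' ℝ)] with l hl
      exact integral_test_comp_smul hl
    refine (h3.congr_of_eventuallyEq hev).congr_deriv ?_
    have hcl : Continuous fun x => fderiv ℝ ζ x x :=
      (hζ.1.continuous_fderiv (by simp)).clm_apply continuous_id
    have hcs : HasCompactSupport fun x => fderiv ℝ ζ x x :=
      (hζ.2.fderiv ℝ).mono fun x hx => by
        intro h0
        simp [h0] at hx
    have e := h.integral_div hζ
    simp only [mul_add, mul_left_comm _ (N : ℝ)] at e
    rw [integral_add ((h.1.integrable_mul_test hζ.continuous hζ.2).const_mul _)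
      (h.1.integrable_mul_test hcl hcs), integral_const_mul] at e
    simp
    linarith
  have h1 := key (h.comp_smul hl₀)
  have h2 : HasDerivAt (fun l : ℝ => l / l₀) (1 / l₀) l₀ := (hasDerivAt_id l₀).div_const l₀
  have h1' : HasDerivAt (fun l : ℝ => ∫ x, ζ x * w (l₀ • l • x))
      (∫ x, ζ x * inner ℝ (l₀ • G (l₀ • x)) x) (l₀ / l₀) := by rwa [div_self hl₀.ne']
  have h3 := HasDerivAt.comp (h := fun l : ℝ => l / l₀) l₀ h1' h2
  refine (h3.congr_of_eventuallyEq (.of_forall fun l => ?_)).congr_deriv ?_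
  · simp only [Function.comp, smul_smul, mul_div_cancel₀ _ hl₀.ne']
  · simp only [inner_smul_left, conj_trivial, mul_left_comm _ l₀]
    rw [integral_const_mul]
    field_simp

lemma eLpNorm_comp_smul_le {F : Type*} [NormedAddCommGroup F] {w : E N → F} {r : ℝ≥0∞}
    (hw : AEStronglyMeasurable w volume) {l : ℝ} (hl : 1 / 2 < l) :
    eLpNorm (fun x => w (l • x)) r volume ≤
      ENNReal.ofReal (2 ^ N) ^ (1 / r).toReal * eLpNorm w r volume := by
  have hl0 : 0 < l := by linarith
  rcases eq_or_ne r 0 with rfl | hr0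
  · simp
  have hmap := Measure.map_addHaar_smul (volume : Measure (E N)) hl0.ne'
  have hc : ENNReal.ofReal |(l ^ N)⁻¹| ≤ ENNReal.ofReal (2 ^ N) := by
    refine ENNReal.ofReal_le_ofReal ?_
    rw [abs_of_pos (by positivity), ← inv_pow]
    gcongr
    rw [inv_le_comm₀ hl0 (by norm_num)]
    linarith
  have hm : AEStronglyMeasurable w (Measure.map (l • · : E N → E N) volume) := by
    rw [hmap]
    exact hw.smul_measure _
  have := eLpNorm_map_measure (p := r) hm (measurable_const_smul l).aemeasurable
  simp only [Function.comp_def] at this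
  rw [← this, hmap, finrank_euclideanSpace, Fintype.card_fin, eLpNorm_smul_measure_of_ne_zero, smul_eq_mul]
  · gcongr
  · simp [hl0.ne']

lemma memLp_comp_smul {F : Type*} [NormedAddCommGroup F] {w : E N → F} {r : ℝ≥0∞}
    (hw : MemLp w r volume) {l : ℝ} (hl : l ≠ 0) :
    MemLp (fun x => w (l • x)) r volume := by
  have hmap := Measure.map_addHaar_smul (volume : Measure (E N)) hl
  have h2 : MemLp w r (Measure.map (l • · : E N → E N) volume) := by
    rw [hmap]
    exact hw.smul_measure ENNReal.ofReal_ne_top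
  exact h2.comp_of_map (measurable_const_smul l).aemeasurable

/-- Approximate k in L^r by test functions. The derivatives then converge uniformly for l > 1/2,
because the norm of x ↦ G(l x)·x in L^r' is bounded uniformly there, so limit and derivative may be
exchanged. -/
lemma HasWeakGradient.hasDerivAt_integral {w : E N → ℝ} {G : E N → E N} (h : HasWeakGradient w G)
    {r r' : ℝ≥0∞} [hr : ENNReal.HolderConjugate r r'] (hr' : r ≠ ⊤) {k : E N → ℝ}
    (hk : MemLp k r volume) (hw : MemLp w r' volume)
    (hG : MemLp (fun x => inner ℝ (G x) x) r' volume) :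
    HasDerivAt (fun l : ℝ => ∫ x, k x * w (l • x)) (∫ x, k x * inner ℝ (G x) x) 1 := by
  have hr1 : 1 ≤ r := ENNReal.HolderConjugate.one_le r r'
  choose ζ hζc hζs hζ using fun n : ℕ => hk.exist_eLpNorm_sub_le (ε := 1 / (n + 1)) hr' hr1
    (by positivity)
  have hζt : ∀ n, IsTest (ζ n) := fun n => ⟨hζs n, hζc n⟩
  have hlim : Tendsto (fun n => eLpNorm (fun x => ζ n x - k x) r volume) atTop (𝓝 0) := by
    refine tendsto_of_tendsto_of_tendsto_of_le_of_le tendsto_const_nhds ?_ (fun n => zero_le)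
      fun n => (eLpNorm_sub_comm _ _ _ _).trans_le (hζ n)
    have := ENNReal.tendsto_ofReal (tendsto_one_div_add_atTop_nhds_zero_nat (𝕜 := ℝ))
    simpa using this
  have hGl : ∀ l : ℝ, 0 < l → MemLp (fun x => inner ℝ (G (l • x)) x) r' volume := by
    intro l hl
    refine ((memLp_comp_smul hG hl.ne').const_mul l⁻¹).ae_eq (.of_forall fun x => ?_)
    simp only [inner_smul_right]
    field_simp
  have hGb : ∀ l : ℝ, 1 / 2 < l → eLpNorm (fun x => inner ℝ (G (l • x)) x) r' volume ≤
      2 * (ENNReal.ofReal (2 ^ N) ^ (1 / r').toReal *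
        eLpNorm (fun x => inner ℝ (G x) x) r' volume) := by
    intro l hl
    have hl0 : 0 < l := by linarith
    have e : (fun x => inner ℝ (G (l • x)) x) = l⁻¹ • fun x => inner ℝ (G (l • x)) (l • x) := by
      ext x
      simp only [Pi.smul_apply, inner_smul_right, smul_eq_mul]
      field_simp
    rw [e, eLpNorm_const_smul]
    gcongr
    · rw [Real.enorm_of_nonneg (by positivity), ← ENNReal.ofReal_ofNat]
      refine ENNReal.ofReal_le_ofReal ?_
      rw [inv_le_comm₀ hl0 (by norm_num)]
      linarith
    · exact eLpNorm_comp_smul_le (w := fun x => inner ℝ (G x) x) hG.1 hl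
  -- For l > 1/2, the factor 2 bounds l⁻¹ and 2^N bounds the Jacobian l^(-N).
  set M := 2 * (ENNReal.ofReal (2 ^ N) ^ (1 / r').toReal *
        eLpNorm (fun x => inner ℝ (G x) x) r' volume) with hM
  have hMt : M ≠ ⊤ := ENNReal.mul_ne_top (by simp) (ENNReal.mul_ne_top
    (ENNReal.rpow_ne_top_of_nonneg (by simp) ENNReal.ofReal_ne_top) hG.2.ne)
  have hderiv := hasDerivAt_of_tendstoUniformlyOn (l := atTop) (s := Ioi (1 / 2 : ℝ)) isOpen_Ioi
    (f := fun n l => ∫ x, ζ n x * w (l • x)) (g := fun l => ∫ x, k x * w (l • x))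
    (f' := fun n l => ∫ x, ζ n x * inner ℝ (G (l • x)) x)
    (g' := fun l => ∫ x, k x * inner ℝ (G (l • x)) x) (x := 1) ?_
    (.of_forall fun n l hl => h.hasDerivAt_integral_test (hζt n)
      (lt_trans (by norm_num) (mem_Ioi.1 hl))) ?_ (by norm_num)
  · simpa using hderiv
  · rw [EMetric.tendstoUniformlyOn_iff]
    intro ε hε
    have h1 : Tendsto (fun n => eLpNorm (fun x => ζ n x - k x) r volume * M) atTop (𝓝 0) := by
      simpa using ENNReal.Tendsto.mul_const hlim (Or.inr hMt)
    filter_upwards [h1.eventually_lt_const hε] with n hn l hl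
    have hl0 : 0 < l := lt_trans (by norm_num) (mem_Ioi.1 hl)
    have hz : MemLp (ζ n) r volume := (hζs n).continuous.memLp_of_hasCompactSupport (hζc n)
    rw [edist_comm, edist_eq_enorm_sub, ← integral_sub (integrable_mul_of_memLp hz (hGl l hl0))
      (integrable_mul_of_memLp hk (hGl l hl0))]
    simp only [← sub_mul]
    refine (enorm_integral_mul_le (r := r) (r' := r') (hz.1.sub hk.1) (hGl l hl0).1).trans_lt
      (lt_of_le_of_lt ?_ hn)
    exact mul_le_mul_right (hGb l hl) _
  · intro l hl
    have hl0 : l ≠ 0 := (lt_trans (by norm_num) (mem_Ioi.1 hl)).ne'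
    have := tendsto_integral_mul (r := r') (r' := r) (memLp_comp_smul hw hl0) hk
      (fun n => (hζs n).continuous.aestronglyMeasurable) hlim
    simpa only [mul_comm] using this

/-! ### The Riesz kernel and the Hardy-Littlewood-Sobolev inequality -/

/-- The normalising constant of the Riesz potential. -/
def rieszConst (N : ℕ) (α : ℝ) : ℝ :=
  Real.Gamma (((N : ℝ) - α) / 2) /
      (Real.Gamma (α / 2) * Real.pi ^ ((N : ℝ) / 2) * (2 : ℝ) ^ α)

lemma riesz_eq (α : ℝ) (x : E N) : riesz N α x = rieszConst N α / ‖x‖ ^ ((N : ℝ) - α) := rfl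

lemma rieszConst_pos {α : ℝ} (hα : 0 < α) (hαN : α < N) : 0 < rieszConst N α := by
  have := Real.Gamma_pos_of_pos (show 0 < ((N : ℝ) - α) / 2 by linarith)
  have := Real.Gamma_pos_of_pos (show 0 < α / 2 by linarith)
  have := Real.pi_pos
  unfold rieszConst
  positivity

lemma riesz_nonneg {α : ℝ} (hα : 0 < α) (hαN : α < N) (x : E N) : 0 ≤ riesz N α x :=
  div_nonneg (rieszConst_pos hα hαN).le (by positivity)

lemma riesz_neg (α : ℝ) (x : E N) : riesz N α (-x) = riesz N α x := by
  simp [riesz_eq]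

lemma measurable_riesz (α : ℝ) : Measurable (riesz N α) :=
  measurable_const.div (measurable_norm.pow_const _)

/-- The Riesz kernel with values in `[0, ∞]`. -/
def rieszE (N : ℕ) (α : ℝ) (x : E N) : ℝ≥0∞ := ENNReal.ofReal (riesz N α x)

lemma measurable_rieszE (α : ℝ) : Measurable (rieszE N α) := (measurable_riesz α).ennreal_ofReal

lemma rieszE_smul {α R : ℝ} (hR : 0 < R) (x : E N) :
    rieszE N α (R • x) = ENNReal.ofReal (R ^ (-((N : ℝ) - α))) * rieszE N α x := by
  rw [rieszE, rieszE, ← ENNReal.ofReal_mul (by positivity), riesz_eq, riesz_eq, norm_smul,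
    Real.norm_of_nonneg hR.le, Real.mul_rpow hR.le (norm_nonneg _), Real.rpow_neg hR.le]
  congr 1
  rw [mul_comm (R ^ _), ← div_div]
  ring

lemma lintegral_scale {R : ℝ} (hR : 0 < R) (g : E N → ℝ≥0∞) :
    ∫⁻ x, g x = ENNReal.ofReal (R ^ (N : ℝ)) * ∫⁻ x, g (R • x) := by
  have h := lintegral_map_equiv (μ := (volume : Measure (E N))) g
    (Homeomorph.smulOfNeZero R hR.ne').toMeasurableEquiv
  have h2 := Measure.map_addHaar_smul (volume : Measure (E N)) hR.ne'
  have h3 : (⇑(Homeomorph.smulOfNeZero (α := E N) R hR.ne').toMeasurableEquiv) = fun x => R • x := rfl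
  rw [h3] at h
  rw [← h, h2, lintegral_smul_measure, finrank_euclideanSpace, Fintype.card_fin, smul_eq_mul,
    ← mul_assoc, ← ENNReal.ofReal_mul (by positivity), abs_of_pos (by positivity),
    Real.rpow_natCast, mul_inv_cancel₀ (by positivity)]
  simp

lemma lintegral_rieszE_ball_lt_top {α : ℝ} (hα : 0 < α) (hαN : α < N) :
    ∫⁻ x in ball (0 : E N) 1, rieszE N α x < ⊤ := by
  have hN : 1 ≤ N := by
    rcases Nat.eq_zero_or_pos N with rfl | h
    · simp at hαN; linarith
    · exact h
  have h := integrableOn_ball_of_norm_le_rpow (μ := (volume : Measure (E N))) (by simpa using hN)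
    (f := riesz N α) (C := rieszConst N α) (α := N - α) (r := 1) (by simp; linarith)
    (.of_forall fun x => by
      rw [Real.norm_of_nonneg (riesz_nonneg hα hαN x), riesz_eq, Real.rpow_neg (norm_nonneg _)]
      exact le_of_eq (div_eq_mul_inv _ _)) (measurable_riesz α).aestronglyMeasurable
  exact h.lintegral_lt_top

/-- The exponent is conjugate to 2N/(N+α) and turns the kernel into a multiple of |x|^(-2N),
integrable at infinity. The factor 2^(2N) comes from 1 + |x| ≤ 2|x| off the unit ball. -/
lemma lintegral_rieszE_compl_lt_top {α : ℝ} (hα : 0 < α) (hαN : α < N) :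
    ∫⁻ x in (ball (0 : E N) 1)ᶜ, rieszE N α x ^ (2 * N / (N - α)) < ⊤ := by
  have hN : (0 : ℝ) < N := hα.trans hαN
  have hA := rieszConst_pos hα hαN
  have hs : 0 < 2 * N / (N - α) := div_pos (by linarith) (by linarith)
  have h1 : Integrable (fun x : E N => (rieszConst N α) ^ (2 * N / (N - α)) * 2 ^ (2 * N : ℝ) *
      (1 + ‖x‖) ^ (-(2 * N : ℝ))) volume :=
    (integrable_one_add_norm (by simp; linarith)).const_mul _
  refine lt_of_le_of_lt ?_ h1.lintegral_lt_top
  refine (setLIntegral_mono' measurableSet_ball.compl fun x hx => ?_).trans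
    (setLIntegral_le_lintegral _ _)
  have hx1 : 1 ≤ ‖x‖ := by simpa using hx
  rw [rieszE, ENNReal.ofReal_rpow_of_nonneg (riesz_nonneg hα hαN x) hs.le]
  refine ENNReal.ofReal_le_ofReal ?_
  rw [riesz_eq, Real.div_rpow hA.le (by positivity), ← Real.rpow_mul (norm_nonneg _),
    mul_div_cancel₀ _ (by linarith : (N : ℝ) - α ≠ 0), div_eq_mul_inv,
    ← Real.rpow_neg (norm_nonneg _), mul_assoc]
  gcongr
  rw [Real.rpow_neg (by positivity), Real.rpow_neg (by positivity), ← div_eq_mul_inv,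
    ← Real.div_rpow (by positivity) (by positivity), ← Real.inv_rpow (by positivity)]
  gcongr
  rw [le_div_iff₀ (by positivity), inv_mul_le_iff₀ (by positivity)]
  linarith

/-- The constant of the near part of the Riesz kernel. -/
def rieszNear (N : ℕ) (α : ℝ) : ℝ≥0∞ := ∫⁻ x in ball (0 : E N) 1, rieszE N α x

/-- The constant of the far part of the Riesz kernel. -/
def rieszFar (N : ℕ) (α : ℝ) : ℝ≥0∞ :=
  (∫⁻ x in (ball (0 : E N) 1)ᶜ, rieszE N α x ^ (2 * N / (N - α))) ^ ((N - α) / (2 * N))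

lemma lintegral_rieszE_ball {α R : ℝ} (hR : 0 < R) :
    ∫⁻ x, (ball (0 : E N) R).indicator (rieszE N α) x =
      ENNReal.ofReal (R ^ α) * rieszNear N α := by
  rw [lintegral_scale hR]
  have : ∀ x, (ball (0 : E N) R).indicator (rieszE N α) (R • x) =
      ENNReal.ofReal (R ^ (-((N : ℝ) - α))) * (ball (0 : E N) 1).indicator (rieszE N α) x := by
    intro x
    by_cases hx : ‖x‖ < 1
    · rw [indicator_of_mem, indicator_of_mem, rieszE_smul hR]
      · simpa using hx
      · simpa [norm_smul, abs_of_pos hR] using (mul_lt_iff_lt_one_right hR).2 hx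
    · rw [indicator_of_notMem, indicator_of_notMem, mul_zero]
      · simpa using hx
      · simpa [norm_smul, abs_of_pos hR] using le_mul_of_one_le_right hR.le (not_lt.1 hx)
  simp only [this]
  rw [lintegral_const_mul' _ _ ENNReal.ofReal_ne_top, lintegral_indicator measurableSet_ball,
    ← mul_assoc, ← ENNReal.ofReal_mul (by positivity), ← Real.rpow_add hR, rieszNear]
  ring_nf

lemma lintegral_rieszE_compl {α R : ℝ} (hα : 0 < α) (hαN : α < N) (hR : 0 < R) :
    (∫⁻ x, (ball (0 : E N) R)ᶜ.indicator (rieszE N α) x ^ (2 * N / (N - α))) ^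
        ((N - α) / (2 * N)) =
      ENNReal.ofReal (R ^ (-(((N : ℝ) - α) / 2))) * rieszFar N α := by
  have hN : (0 : ℝ) < N := hα.trans hαN
  have hs : 0 < 2 * N / (N - α) := div_pos (by linarith) (by linarith)
  have hs' : 0 < (N - α) / (2 * N) := div_pos (by linarith) (by linarith)
  rw [lintegral_scale hR]
  have : ∀ x, (ball (0 : E N) R)ᶜ.indicator (rieszE N α) (R • x) ^ (2 * N / (N - α)) =
      ENNReal.ofReal (R ^ (-(2 * N : ℝ))) *
      (ball (0 : E N) 1)ᶜ.indicator (fun x => rieszE N α x ^ (2 * N / (N - α))) x := by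
    intro x
    by_cases hx : ‖x‖ < 1
    · rw [indicator_of_notMem, indicator_of_notMem, mul_zero, ENNReal.zero_rpow_of_pos hs]
      · simpa using hx
      · simpa [norm_smul, abs_of_pos hR] using (mul_lt_iff_lt_one_right hR).2 hx
    · rw [indicator_of_mem, indicator_of_mem, rieszE_smul hR, ENNReal.mul_rpow_of_nonneg _ _ hs.le,
        ENNReal.ofReal_rpow_of_nonneg (by positivity) hs.le, ← Real.rpow_mul hR.le]
      · congr 3
        have : (N : ℝ) - α ≠ 0 := by linarith
        field_simp
      · simpa using hx
      · simpa [norm_smul, abs_of_pos hR] using le_mul_of_one_le_right hR.le (not_lt.1 hx)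
  simp only [this]
  rw [lintegral_const_mul' _ _ ENNReal.ofReal_ne_top, lintegral_indicator measurableSet_ball.compl,
    ← mul_assoc, ← ENNReal.ofReal_mul (by positivity), ← Real.rpow_add hR,
    ENNReal.mul_rpow_of_nonneg _ _ hs'.le, rieszFar,
    ENNReal.ofReal_rpow_of_nonneg (by positivity) hs'.le, ← Real.rpow_mul hR.le]
  congr 3
  field_simp
  ring

lemma rieszNear_ne_top {α : ℝ} (hα : 0 < α) (hαN : α < N) : rieszNear N α ≠ ⊤ :=
  (lintegral_rieszE_ball_lt_top hα hαN).ne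

lemma rieszFar_ne_top {α : ℝ} (hα : 0 < α) (hαN : α < N) : rieszFar N α ≠ ⊤ :=
  ENNReal.rpow_ne_top_of_nonneg (div_nonneg (by linarith) (by positivity))
    (lintegral_rieszE_compl_lt_top hα hαN).ne

lemma holderConjugate_riesz {α : ℝ} (hα : 0 < α) (hαN : α < N) :
    (2 * N / (N - α) : ℝ).HolderConjugate (2 * N / (N + α)) := by
  have hN : (0 : ℝ) < N := hα.trans hαN
  rw [Real.holderConjugate_iff]
  constructor
  · rw [lt_div_iff₀ (by linarith)]
    linarith
  · have h1 : (N : ℝ) - α ≠ 0 := by linarith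
    have h2 : (N : ℝ) + α ≠ 0 := by linarith
    field_simp
    ring

/-- Hedberg-type splitting of the kernel at a radius R: inside use f ≤ a and the integrability of
the kernel, outside use Hölder. The resulting power of a is exactly the one that becomes integrable
when a = g(x). -/
lemma lintegral_riesz_truncated_le {α : ℝ} (hα : 0 < α) (hαN : α < N) {f : E N → ℝ≥0∞}
    (hf : Measurable f) (x : E N) {a : ℝ≥0∞} (ha : a ≠ ⊤) :
    a * ∫⁻ y, rieszE N α (x - y) * {y | f y ≤ a}.indicator f y ≤
      a ^ (2 * N / (N + α)) * (rieszNear N α + rieszFar N α *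
        (∫⁻ y, f y ^ (2 * N / (N + α))) ^ ((N + α) / (2 * N))) := by
  have hN : (0 : ℝ) < N := hα.trans hαN
  rcases eq_or_ne a 0 with rfl | ha0
  · simp
  obtain ⟨b, hb, rfl⟩ : ∃ b : ℝ, 0 < b ∧ a = ENNReal.ofReal b :=
    ⟨a.toReal, ENNReal.toReal_pos ha0 ha, (ENNReal.ofReal_toReal ha).symm⟩
  -- This radius balances the two contributions: b²R^α and b R^(-(N-α)/2) both equal b^(2N/(N+α)).
  set R : ℝ := b ^ (-(2 / (N + α))) with hR
  have hR0 : 0 < R := by positivity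
  have hNα : (N : ℝ) + α ≠ 0 := by linarith
  set k1 : E N → ℝ≥0∞ := (ball (0 : E N) R).indicator (rieszE N α) with hk1
  set k2 : E N → ℝ≥0∞ := (ball (0 : E N) R)ᶜ.indicator (rieszE N α) with hk2
  have mk1 : Measurable k1 := (measurable_rieszE α).indicator measurableSet_ball
  have mk2 : Measurable k2 := (measurable_rieszE α).indicator measurableSet_ball.compl
  have mx : Measurable fun y => k1 (x - y) := mk1.comp (measurable_const.sub measurable_id)
  have hpt : ∀ y, rieszE N α (x - y) * {y | f y ≤ ENNReal.ofReal b}.indicator f y ≤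
      k1 (x - y) * ENNReal.ofReal b + k2 (x - y) * f y := by
    intro y
    have hk : rieszE N α (x - y) = k1 (x - y) + k2 (x - y) :=
      (congrFun (indicator_self_add_compl (ball (0 : E N) R) (rieszE N α)) (x - y)).symm
    rw [hk, add_mul]
    by_cases hy : f y ≤ ENNReal.ofReal b
    · rw [indicator_of_mem (show y ∈ {y | f y ≤ ENNReal.ofReal b} from hy)]
      gcongr
    · rw [indicator_of_notMem (show y ∉ {y | f y ≤ ENNReal.ofReal b} from hy)]
      simp
  have h1 : ∫⁻ y, k1 (x - y) * ENNReal.ofReal b =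
      ENNReal.ofReal (R ^ α) * rieszNear N α * ENNReal.ofReal b := by
    rw [lintegral_mul_const _ mx,
      lintegral_sub_left_eq_self k1 x, lintegral_rieszE_ball hR0]
  have h2 : ∫⁻ y, k2 (x - y) * f y ≤ ENNReal.ofReal (R ^ (-(((N : ℝ) - α) / 2))) * rieszFar N α *
        (∫⁻ y, f y ^ (2 * N / (N + α))) ^ ((N + α) / (2 * N)) := by
    have := ENNReal.lintegral_mul_le_Lp_mul_Lq (volume : Measure (E N))
      (holderConjugate_riesz hα hαN) (f := fun y => k2 (x - y)) (g := f)
      (mk2.comp (measurable_const.sub measurable_id)).aemeasurable hf.aemeasurable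
    rw [lintegral_sub_left_eq_self (fun y => k2 y ^ (2 * N / (N - α) : ℝ)) x, one_div_div,
      one_div_div, lintegral_rieszE_compl hα hαN hR0] at this
    exact this
  have h3 := (lintegral_mono (μ := volume) hpt).trans_eq
    (lintegral_add_left (mx.mul_const _) _)
  have e1 : ENNReal.ofReal b * (ENNReal.ofReal (R ^ α) * rieszNear N α * ENNReal.ofReal b) =
      ENNReal.ofReal b ^ (2 * N / (N + α)) * rieszNear N α := by
    rw [ENNReal.ofReal_rpow_of_pos hb, hR, ← Real.rpow_mul hb.le]
    have : b ^ (2 * N / (N + α)) = b * b ^ (-(2 / (N + α)) * α) * b := by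
      nth_rw 2 [← Real.rpow_one b]
      nth_rw 4 [← Real.rpow_one b]
      rw [← Real.rpow_add hb, ← Real.rpow_add hb]
      congr 1
      field_simp
      ring
    rw [this, ENNReal.ofReal_mul (by positivity), ENNReal.ofReal_mul hb.le]
    ring
  have e2 : ENNReal.ofReal b * ENNReal.ofReal (R ^ (-(((N : ℝ) - α) / 2))) =
      ENNReal.ofReal b ^ (2 * N / (N + α)) := by
    rw [ENNReal.ofReal_rpow_of_pos hb, ← ENNReal.ofReal_mul hb.le, hR, ← Real.rpow_mul hb.le,
      ← Real.rpow_one_add' hb.le]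
    · congr 2
      field_simp
      ring
    · have : (1 : ℝ) + -(2 / (N + α)) * -((N - α) / 2) = 2 * N / (N + α) := by
        field_simp
        ring
      rw [this]
      exact (div_pos (by linarith) (by linarith)).ne'
  calc _ ≤ ENNReal.ofReal b * (ENNReal.ofReal (R ^ α) * rieszNear N α * ENNReal.ofReal b +
        ENNReal.ofReal (R ^ (-(((N : ℝ) - α) / 2))) * rieszFar N α *
        (∫⁻ y, f y ^ (2 * N / (N + α))) ^ ((N + α) / (2 * N))) := by
        gcongr
        exact h3.trans (add_le_add h1.le h2)
    _ = _ := by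
        rw [mul_add, e1, mul_assoc (ENNReal.ofReal (R ^ _)), ← mul_assoc (ENNReal.ofReal b), e2,
          mul_add]

/-- The Riesz potential with values in `[0, ∞]`. -/
def rieszPot (α : ℝ) (f : E N → ℝ≥0∞) (x : E N) : ℝ≥0∞ := ∫⁻ y, rieszE N α (x - y) * f y

lemma measurable_rieszKernel (α : ℝ) :
    Measurable (fun z : E N × E N => rieszE N α (z.1 - z.2)) :=
  (measurable_rieszE α).comp (measurable_fst.sub measurable_snd)

lemma rieszE_sub_comm (α : ℝ) (x y : E N) : rieszE N α (x - y) = rieszE N α (y - x) := by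
  rw [rieszE, rieszE, ← riesz_neg, neg_sub]

/-- The diagonal **Hardy-Littlewood-Sobolev inequality**, in additive form. -/
lemma lintegral_mul_rieszPot_le {α : ℝ} (hα : 0 < α) (hαN : α < N) {f g : E N → ℝ≥0∞}
    (hf : Measurable f) (hg : Measurable g) (hf' : ∫⁻ x, f x ^ (2 * N / (N + α)) ≠ ⊤)
    (hg' : ∫⁻ x, g x ^ (2 * N / (N + α)) ≠ ⊤) :
    ∫⁻ x, g x * rieszPot α f x ≤
      (∫⁻ x, g x ^ (2 * N / (N + α))) * (rieszNear N α + rieszFar N α *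
        (∫⁻ y, f y ^ (2 * N / (N + α))) ^ ((N + α) / (2 * N))) +
      (∫⁻ x, f x ^ (2 * N / (N + α))) * (rieszNear N α + rieszFar N α *
        (∫⁻ y, g y ^ (2 * N / (N + α))) ^ ((N + α) / (2 * N))) := by
  have hN : (0 : ℝ) < N := hα.trans hαN
  have hs : 0 < 2 * N / (N + α) := div_pos (by linarith) (by linarith)
  have fin : ∀ {f : E N → ℝ≥0∞}, Measurable f → ∫⁻ x, f x ^ (2 * N / (N + α)) ≠ ⊤ →
      ∀ᵐ x, f x ≠ ⊤ := by
    intro f hf hf'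
    filter_upwards [ae_lt_top (hf.pow_const _) hf'] with x hx h
    rw [h, ENNReal.top_rpow_of_pos hs] at hx
    exact lt_irrefl _ hx
  have half : ∀ {f g : E N → ℝ≥0∞}, Measurable f → Measurable g →
      ∫⁻ x, f x ^ (2 * N / (N + α)) ≠ ⊤ → ∫⁻ x, g x ^ (2 * N / (N + α)) ≠ ⊤ →
      ∫⁻ x, g x * ∫⁻ y, rieszE N α (x - y) * {y | f y ≤ g x}.indicator f y ≤
      (∫⁻ x, g x ^ (2 * N / (N + α))) * (rieszNear N α + rieszFar N α *
        (∫⁻ y, f y ^ (2 * N / (N + α))) ^ ((N + α) / (2 * N))) := by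
    intro f g hf hg hf' hg'
    rw [← lintegral_mul_const _ (hg.pow_const _)]
    refine lintegral_mono_ae ?_
    filter_upwards [fin hg hg'] with x hx
    exact lintegral_riesz_truncated_le hα hαN hf x hx
  have mset : ∀ {f g : E N → ℝ≥0∞}, Measurable f → Measurable g → Measurable
      (fun z : E N × E N => g z.1 * (rieszE N α (z.1 - z.2) *
        {y | f y ≤ g z.1}.indicator f z.2)) := by
    intro f g hf hg
    have : (fun z : E N × E N => {y | f y ≤ g z.1}.indicator f z.2) =
      {z : E N × E N | f z.2 ≤ g z.1}.indicator (fun z => f z.2) := by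
      ext z
      simp [indicator]
    refine (hg.comp measurable_fst).mul ((measurable_rieszKernel α).mul ?_)
    rw [this]
    exact (hf.comp measurable_snd).indicator
      (measurableSet_le (hf.comp measurable_snd) (hg.comp measurable_fst))
  have mslice : ∀ {f g : E N → ℝ≥0∞} (x : E N), Measurable f → Measurable fun y =>
      rieszE N α (x - y) * {y | f y ≤ g x}.indicator f y := by
    intro f g x hf
    exact ((measurable_rieszE α).comp (measurable_const.sub measurable_id)).mul
      (hf.indicator (measurableSet_le hf measurable_const))
  -- Every pair (x, y) satisfies f(y) ≤ g(x) or g(x) ≤ f(y). On each region the smaller function is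
  -- truncated by the value of the larger, and since the kernel is even the two regions are treated
  -- by the same bound `half`.
  calc ∫⁻ x, g x * rieszPot α f x
      ≤ ∫⁻ x, ((∫⁻ y, g x * (rieszE N α (x - y) * {y | f y ≤ g x}.indicator f y)) +
          ∫⁻ y, f y * (rieszE N α (y - x) * {x | g x ≤ f y}.indicator g x)) := by
        refine lintegral_mono fun x => ?_
        have m1 : Measurable fun y => g x * (rieszE N α (x - y) * {y | f y ≤ g x}.indicator f y) :=
          (mslice x hf).const_mul _
        have m0 : Measurable fun y => rieszE N α (x - y) * f y :=
          ((measurable_rieszE α).comp (measurable_const.sub measurable_id)).mul hf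
        dsimp only
        rw [rieszPot, ← lintegral_const_mul _ m0, ← lintegral_add_left m1]
        refine lintegral_mono fun y => ?_
        dsimp only
        rcases le_total (f y) (g x) with h | h
        · rw [indicator_of_mem (show y ∈ {y | f y ≤ g x} from h)]
          exact le_self_add
        · rw [indicator_of_mem (show x ∈ {x | g x ≤ f y} from h), rieszE_sub_comm α y x]
          refine le_trans (le_of_eq ?_) le_add_self
          ring
    _ = (∫⁻ x, ∫⁻ y, g x * (rieszE N α (x - y) * {y | f y ≤ g x}.indicator f y)) +
          ∫⁻ x, ∫⁻ y, f y * (rieszE N α (y - x) * {x | g x ≤ f y}.indicator g x) :=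
        lintegral_add_left (mset hf hg).lintegral_prod_right' _
    _ = (∫⁻ x, g x * ∫⁻ y, (rieszE N α (x - y) * {y | f y ≤ g x}.indicator f y)) +
          ∫⁻ y, f y * ∫⁻ x, (rieszE N α (y - x) * {x | g x ≤ f y}.indicator g x) := by
        congr 1
        · exact lintegral_congr fun x => lintegral_const_mul _ (mslice x hf)
        · have hsw : Measurable (Function.uncurry fun x y =>
              f y * (rieszE N α (y - x) * {x | g x ≤ f y}.indicator g x)) :=
            (mset hg hf).comp measurable_swap
          rw [lintegral_lintegral_swap hsw.aemeasurable]
          exact lintegral_congr fun y => lintegral_const_mul _ (mslice y hg)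
    _ ≤ _ := add_le_add (half hf hg hf' hg') (half hg hf hg' hf')

lemma measurable_rieszPot {α : ℝ} {f : E N → ℝ≥0∞} (hf : Measurable f) :
    Measurable (rieszPot α f) :=
  ((measurable_rieszKernel α).mul (hf.comp measurable_snd)).lintegral_prod_right'

/-- Duality: test the bilinear bound with a normalised power of a truncation of the potential.
Truncating in height and in space makes the integral `M` finite beforehand, so it can be divided
out. The bound does not depend on n, and Fatou removes the truncation. -/
lemma lintegral_rieszPot_rpow_lt_top {α : ℝ} (hα : 0 < α) (hαN : α < N) {f : E N → ℝ≥0∞}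
    (hf : Measurable f) (hf' : ∫⁻ x, f x ^ (2 * N / (N + α)) ≠ ⊤) :
    ∫⁻ x, rieszPot α f x ^ (2 * N / (N - α)) < ⊤ := by
  have hN : (0 : ℝ) < N := hα.trans hαN
  have hNα : (N : ℝ) + α ≠ 0 := by linarith
  have hNα' : (N : ℝ) - α ≠ 0 := by linarith
  have hs : 0 < 2 * N / (N + α) := div_pos (by linarith) (by linarith)
  have hs' : 0 < 2 * N / (N - α) := div_pos (by linarith) (by linarith)
  have hs'' : 0 < (N + α) / (N - α) := div_pos (by linarith) (by linarith)
  set C := (rieszNear N α + rieszFar N α *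
        (∫⁻ y, f y ^ (2 * N / (N + α))) ^ ((N + α) / (2 * N))) +
      (∫⁻ x, f x ^ (2 * N / (N + α))) * (rieszNear N α + rieszFar N α) with hC
  have hCt : C ≠ ⊤ := by
    have h1 := rieszNear_ne_top hα hαN
    have h2 := rieszFar_ne_top hα hαN
    have h3 : (∫⁻ y, f y ^ (2 * N / (N + α))) ^ ((N + α) / (2 * N)) ≠ ⊤ :=
      ENNReal.rpow_ne_top_of_nonneg (div_nonneg (by linarith) (by linarith)) hf'
    finiteness
  set T := rieszPot α f with hT
  have mT : Measurable T := measurable_rieszPot hf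
  let B : ℕ → Set (E N) := fun n => closedBall 0 n
  let m : ℕ → E N → ℝ≥0∞ := fun n => (B n).indicator fun x => min (T x) n
  have mm : ∀ n, Measurable (m n) := fun n =>
    (mT.min measurable_const).indicator measurableSet_closedBall
  have bound : ∀ n, ∫⁻ x, m n x ^ (2 * N / (N - α)) ≤ C ^ (2 * N / (N - α)) := by
    intro n
    set M := ∫⁻ x, m n x ^ (2 * N / (N - α)) with hM
    have hMt : M ≠ ⊤ := by
      have : M ≤ ∫⁻ x, (B n).indicator (fun _ => (n : ℝ≥0∞) ^ (2 * N / (N - α))) x := by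
        refine lintegral_mono fun x => ?_
        by_cases hx : x ∈ B n
        · simp only [m, indicator_of_mem hx]
          gcongr
          exact min_le_right _ _
        · simp [m, indicator_of_notMem hx, hs']
      rw [lintegral_indicator measurableSet_closedBall, setLIntegral_const] at this
      exact (this.trans_lt (ENNReal.mul_lt_top (ENNReal.rpow_lt_top_of_nonneg hs'.le (by simp))
        (isCompact_closedBall _ _).measure_lt_top)).ne
    rcases eq_or_ne M 0 with h0 | h0
    · rw [h0]; exact zero_le
    -- Normalisation giving ∫ g^(2N/(N+α)) = 1, which is what makes the additive form of the
    -- inequality sufficient.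
    set c : ℝ≥0∞ := M ^ (-((N + α) / (2 * N))) with hc
    set g : E N → ℝ≥0∞ := fun x => c * m n x ^ ((N + α) / (N - α)) with hg
    have mg : Measurable g := ((mm n).pow_const _).const_mul _
    have hg1 : ∫⁻ x, g x ^ (2 * N / (N + α)) = 1 := by
      have : ∀ x, g x ^ (2 * N / (N + α)) = M⁻¹ * m n x ^ (2 * N / (N - α)) := by
        intro x
        rw [hg, ENNReal.mul_rpow_of_nonneg _ _ hs.le, hc, ← ENNReal.rpow_mul, ← ENNReal.rpow_mul,
          ← ENNReal.rpow_neg_one]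
        congr 2 <;> field_simp
      simp only [this]
      rw [lintegral_const_mul _ ((mm n).pow_const _), ← hM, ENNReal.inv_mul_cancel h0 hMt]
    have h1 := lintegral_mul_rieszPot_le hα hαN hf mg hf' (by rw [hg1]; exact ENNReal.one_ne_top)
    rw [hg1, ENNReal.one_rpow, one_mul, mul_one, ← hC] at h1
    have h2 : c * M ≤ ∫⁻ x, g x * T x := by
      rw [hM, ← lintegral_const_mul _ ((mm n).pow_const _)]
      refine lintegral_mono fun x => ?_
      have hle : m n x ≤ T x := by
        by_cases hx : x ∈ B n
        · simp only [m, indicator_of_mem hx]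
          exact min_le_left _ _
        · simp [m, indicator_of_notMem hx]
      have he : m n x ^ (2 * N / (N - α)) = m n x ^ ((N + α) / (N - α)) * m n x := by
        nth_rw 3 [← ENNReal.rpow_one (m n x)]
        rw [← ENNReal.rpow_add_of_nonneg _ _ hs''.le zero_le_one]
        congr 1
        field_simp
        ring
      rw [he, hg, mul_assoc]
      gcongr
    have h3 : c * M = M ^ ((N - α) / (2 * N)) := by
      have : c * M = c * M ^ (1 : ℝ) := by rw [ENNReal.rpow_one]
      rw [this, hc, ← ENNReal.rpow_add _ _ h0 hMt]
      congr 1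
      field_simp
      ring
    have h4 : M ^ ((N - α) / (2 * N)) ≤ C := h3 ▸ h2.trans h1
    calc M = (M ^ ((N - α) / (2 * N))) ^ (2 * N / (N - α)) := by
          rw [← ENNReal.rpow_mul]
          have : (N - α) / (2 * N) * (2 * N / (N - α)) = 1 := by field_simp
          rw [this, ENNReal.rpow_one]
      _ ≤ _ := by gcongr
  have hlim : ∀ x, T x ^ (2 * N / (N - α)) = liminf (fun n => m n x ^ (2 * N / (N - α))) atTop := by
    intro x
    refine (Tendsto.liminf_eq ?_).symm
    have h1 : Tendsto (fun n : ℕ => min (T x) (n : ℝ≥0∞)) atTop (𝓝 (T x)) := by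
      have := (tendsto_const_nhds (x := T x) (f := (atTop : Filter ℕ))).min ENNReal.tendsto_nat_nhds_top
      simpa using this
    refine (h1.ennrpow_const (2 * N / (N - α))).congr' ?_
    filter_upwards [eventually_ge_atTop ⌈‖x‖⌉₊] with n hn
    have hx : x ∈ B n := by simpa [B] using Nat.ceil_le.1 hn
    simp only [m, indicator_of_mem hx]
  calc ∫⁻ x, T x ^ (2 * N / (N - α))
      = ∫⁻ x, liminf (fun n => m n x ^ (2 * N / (N - α))) atTop := lintegral_congr hlim
    _ ≤ liminf (fun n => ∫⁻ x, m n x ^ (2 * N / (N - α))) atTop :=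
        lintegral_liminf_le fun n => (mm n).pow_const _
    _ ≤ C ^ (2 * N / (N - α)) := by
        refine (liminf_le_liminf (.of_forall bound)).trans_eq ?_
        simp
    _ < ⊤ := ENNReal.rpow_lt_top_of_nonneg hs'.le hCt

lemma lintegral_rpow_enorm_ne_top {f : E N → ℝ} {s : ℝ} (hs : 0 < s)
    (hf : MemLp f (ENNReal.ofReal s) volume) : ∫⁻ x, ‖f x‖ₑ ^ s ≠ ⊤ := by
  have := lintegral_rpow_enorm_lt_top_of_eLpNorm_lt_top (by simpa using hs) ENNReal.ofReal_ne_top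
    hf.2
  rw [ENNReal.toReal_ofReal hs.le] at this
  exact this.ne

lemma enorm_riesz {α : ℝ} (hα : 0 < α) (hαN : α < N) (x : E N) :
    ‖riesz N α x‖ₑ = rieszE N α x :=
  Real.enorm_of_nonneg (riesz_nonneg hα hαN x)

lemma memLp_rieszConv {α : ℝ} (hα : 0 < α) (hαN : α < N) {f : E N → ℝ}
    (hf : MemLp f (ENNReal.ofReal (2 * N / (N + α))) volume) :
    MemLp (rieszConv α f) (ENNReal.ofReal (2 * N / (N - α))) volume := by
  have hN : (0 : ℝ) < N := hα.trans hαN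
  have hs : 0 < 2 * N / (N + α) := div_pos (by linarith) (by linarith)
  have hs' : 0 < 2 * N / (N - α) := div_pos (by linarith) (by linarith)
  obtain ⟨g, hg, hfg⟩ := hf.1
  have hconv : rieszConv α f = rieszConv α g := by
    ext x
    exact integral_congr_ae (hfg.mono fun y hy => by simp only [hy])
  rw [hconv]
  have hgL := (memLp_congr_ae hfg).1 hf
  have hmeas : StronglyMeasurable (rieszConv α g) := by
    have : StronglyMeasurable (Function.uncurry fun x y : E N => riesz N α (x - y) * g y) :=
      (((measurable_riesz α).comp (measurable_fst.sub measurable_snd)).mul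
        (hg.measurable.comp measurable_snd)).stronglyMeasurable
    exact this.integral_prod_right
  refine ⟨hmeas.aestronglyMeasurable, ?_⟩
  rw [eLpNorm_lt_top_iff_lintegral_rpow_enorm_lt_top (by simpa using hs') ENNReal.ofReal_ne_top,
    ENNReal.toReal_ofReal hs'.le]
  refine lt_of_le_of_lt (lintegral_mono fun x => ?_) (lintegral_rieszPot_rpow_lt_top hα hαN
    hg.enorm (lintegral_rpow_enorm_ne_top hs hgL))
  gcongr
  refine (enorm_integral_le_lintegral_enorm _).trans (le_of_eq ?_)
  simp only [enorm_mul, enorm_riesz hα hαN]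
  rfl

/-- Absolute convergence of the double integral. It licenses Fubini and supplies the dominating
function whenever the kernel is regularised. -/
lemma integrable_riesz_prod {α : ℝ} (hα : 0 < α) (hαN : α < N) {f g : E N → ℝ}
    (hf : MemLp f (ENNReal.ofReal (2 * N / (N + α))) volume)
    (hg : MemLp g (ENNReal.ofReal (2 * N / (N + α))) volume) :
    Integrable (fun z : E N × E N => riesz N α (z.1 - z.2) * f z.2 * g z.1)
      (volume.prod volume) := by
  have hN : (0 : ℝ) < N := hα.trans hαN
  have hs : 0 < 2 * N / (N + α) := div_pos (by linarith) (by linarith)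
  obtain ⟨f', hf', hff⟩ := hf.1
  obtain ⟨g', hg', hgg⟩ := hg.1
  have hfL := (memLp_congr_ae hff).1 hf
  have hgL := (memLp_congr_ae hgg).1 hg
  have hae : (fun z : E N × E N => riesz N α (z.1 - z.2) * f z.2 * g z.1)
      =ᵐ[volume.prod volume] fun z => riesz N α (z.1 - z.2) * f' z.2 * g' z.1 := by
    have h1 := Measure.quasiMeasurePreserving_snd.ae_eq_comp (μ := (volume : Measure (E N)).prod
      (volume : Measure (E N))) hff
    have h2 := Measure.quasiMeasurePreserving_fst.ae_eq_comp (μ := (volume : Measure (E N)).prod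
      (volume : Measure (E N))) hgg
    filter_upwards [h1, h2] with z h1 h2
    simp only [Function.comp] at h1 h2
    rw [h1, h2]
  rw [integrable_congr hae]
  have hm : Measurable fun z : E N × E N => riesz N α (z.1 - z.2) * f' z.2 * g' z.1 :=
    (((measurable_riesz α).comp (measurable_fst.sub measurable_snd)).mul
        (hf'.measurable.comp measurable_snd)).mul (hg'.measurable.comp measurable_fst)
  refine ⟨hm.aestronglyMeasurable, ?_⟩
  rw [HasFiniteIntegral, lintegral_prod _ hm.enorm.aemeasurable]
  have hF := lintegral_rpow_enorm_ne_top hs hfL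
  have hG := lintegral_rpow_enorm_ne_top hs hgL
  have hle := lintegral_mul_rieszPot_le hα hαN hf'.enorm hg'.enorm hF hG
  have h1 := rieszNear_ne_top hα hαN
  have h2 := rieszFar_ne_top hα hαN
  have h3 : 0 ≤ (N + α) / (2 * N) := div_nonneg (by linarith) (by linarith)
  have h4 := ENNReal.rpow_ne_top_of_nonneg h3 hF
  have h5 := ENNReal.rpow_ne_top_of_nonneg h3 hG
  refine lt_of_le_of_lt (le_of_eq ?_) (hle.trans_lt (by finiteness))
  refine lintegral_congr fun x => ?_
  have hmx : Measurable fun y => rieszE N α (x - y) * ‖f' y‖ₑ :=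
    ((measurable_rieszE α).comp (measurable_const.sub measurable_id)).mul hf'.enorm
  rw [rieszPot, ← lintegral_const_mul _ hmx]
  refine lintegral_congr fun y => ?_
  rw [enorm_mul, enorm_mul, enorm_riesz hα hαN, mul_comm]

/-! ### Exponent bookkeeping -/

lemma holderTriple_ofReal {a b c : ℝ} (ha : 0 < a) (hb : 0 < b) (hc : 0 < c)
    (h : a⁻¹ + b⁻¹ = c⁻¹) :
    ENNReal.HolderTriple (ENNReal.ofReal a) (ENNReal.ofReal b) (ENNReal.ofReal c) := by
  constructor
  rw [← ENNReal.ofReal_inv_of_pos ha, ← ENNReal.ofReal_inv_of_pos hb,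
    ← ENNReal.ofReal_inv_of_pos hc, ← ENNReal.ofReal_add (by positivity) (by positivity), h]

lemma holderConjugate_ofReal {a b : ℝ} (h : a.HolderConjugate b) :
    ENNReal.HolderConjugate (ENNReal.ofReal a) (ENNReal.ofReal b) := by
  have := holderTriple_ofReal h.pos h.symm.pos one_pos (by rw [inv_one]; exact h.inv_add_inv_eq_one)
  simpa using this

lemma memLp_abs_rpow {u : E N → ℝ} {s t : ℝ} (ht : 0 < t)
    (hu : MemLp u (ENNReal.ofReal s) volume) :
    MemLp (fun x => |u x| ^ t) (ENNReal.ofReal (s / t)) volume := by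
  have := hu.norm_rpow_div (ENNReal.ofReal t)
  rw [ENNReal.toReal_ofReal ht.le, ← ENNReal.ofReal_div_of_pos ht] at this
  exact this

lemma memLp_rpow_sub_two_mul {u : E N → ℝ} {s p : ℝ} (hp : 1 < p)
    (hu : MemLp u (ENNReal.ofReal s) volume) :
    MemLp (fun x => |u x| ^ (p - 2) * u x) (ENNReal.ofReal (s / (p - 1))) volume := by
  refine (memLp_abs_rpow (by linarith : 0 < p - 1) hu).mono ?_ (.of_forall fun x => ?_)
  · exact ((hu.1.norm.aemeasurable.pow_const _).aestronglyMeasurable).mul hu.1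
  · rw [Real.norm_eq_abs, abs_rpow_sub_two_mul_self _ hp, Real.norm_of_nonneg (by positivity)]

lemma memLp_of_memLp_abs_rpow {u : E N → ℝ} {s t : ℝ} (ht : 0 < t) (hu : AEStronglyMeasurable u volume)
    (h : MemLp (fun x => |u x| ^ t) (ENNReal.ofReal s) volume) :
    MemLp u (ENNReal.ofReal (s * t)) volume := by
  have := (memLp_norm_rpow_iff (q := ENNReal.ofReal t) (p := ENNReal.ofReal (s * t)) hu
    (by simpa using ht) ENNReal.ofReal_ne_top).1
  rw [ENNReal.toReal_ofReal ht.le, ← ENNReal.ofReal_div_of_pos ht,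
    mul_div_cancel_right₀ _ ht.ne'] at this
  exact this h

/-! ### Solutions: admissible test functions, energy identities, sign of φ -/

/-- A weak solution of the system in the regularity class, with its weak gradients fixed. -/
structure Solution (N : ℕ) (α p q K : ℝ) (u φ : E N → ℝ) (Du Dφ : E N → E N) : Prop where
  hN : 3 ≤ N
  hα : 0 < α
  hαN : α < N
  hp : 1 < p
  hq : 1 < q
  hK : 0 < K
  wu : HasWeakGradient u Du
  wφ : HasWeakGradient φ Dφ
  u2 : MemLp u 2 volume
  Du2 : MemLp Du 2 volume
  φ2 : MemLp φ 2 volume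
  Dφ2 : MemLp Dφ 2 volume
  uσ : MemLp u (ENNReal.ofReal (2 * N * p / (N + α))) volume
  Duσ : MemLpLoc (fun x => ‖Du x‖) (ENNReal.ofReal (2 * N * p / (N + α)))
  Kuq : MemLp (fun x => K * |u x| ^ q) (ENNReal.ofReal (2 * N / (N + 2))) volume
  eq₁ : ∀ η : E N → ℝ, IsTest η →
      (∫ x, fderiv ℝ η x (Du x)) + (∫ x, u x * η x) +
          (∫ x, K * φ x * (|u x| ^ (q - 2) * u x) * η x) =
        ∫ x, rieszConv α (fun y => |u y| ^ p) x * (|u x| ^ (p - 2) * u x) * η x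
  eq₂ : ∀ η : E N → ℝ, IsTest η →
      ∫ x, fderiv ℝ η x (Dφ x) = ∫ x, K * |u x| ^ q * η x

namespace Solution

variable {α p q K : ℝ} {u φ : E N → ℝ} {Du Dφ : E N → E N}

lemma three_le (S : Solution N α p q K u φ Du Dφ) : (3 : ℝ) ≤ N := by exact_mod_cast S.hN

lemma one_lt_sigma (S : Solution N α p q K u φ Du Dφ) : 1 < 2 * N * p / (N + α) := by
  have := S.three_le
  have := S.hα
  have := S.hαN
  have := S.hp
  rw [lt_div_iff₀ (by linarith)]
  nlinarith

lemma one_lt_tau (S : Solution N α p q K u φ Du Dφ) : 1 < 2 * N * q / (N + 2) := by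
  have := S.three_le
  have := S.hq
  rw [lt_div_iff₀ (by linarith)]
  nlinarith

lemma uτ (S : Solution N α p q K u φ Du Dφ) :
    MemLp u (ENNReal.ofReal (2 * N * q / (N + 2))) volume := by
  have h : MemLp (fun x => |u x| ^ q) (ENNReal.ofReal (2 * N / (N + 2))) volume := by
    refine (S.Kuq.const_mul K⁻¹).ae_eq (.of_forall fun x => ?_)
    have := S.hK.ne'
    simp only
    field_simp
  have := memLp_of_memLp_abs_rpow (by linarith [S.hq]) S.u2.1 h
  convert this using 2
  ring

lemma φstar (S : Solution N α p q K u φ Du Dφ) :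
    MemLp φ (ENNReal.ofReal (2 * N / (N - 2))) volume :=
  S.wφ.memLp_sobolev S.hN S.φ2 S.Dφ2

lemma memLp_up (S : Solution N α p q K u φ Du Dφ) :
    MemLp (fun x => |u x| ^ p) (ENNReal.ofReal (2 * N / (N + α))) volume := by
  have := memLp_abs_rpow (by linarith [S.hp] : 0 < p) S.uσ
  convert this using 2
  have := S.hp
  field_simp

/-- The Choquard nonlinearity lies in the dual of `L^{2Np/(N+α)}`. -/
lemma memLp_choquard (S : Solution N α p q K u φ Du Dφ) :
    MemLp (fun x => rieszConv α (fun y => |u y| ^ p) x * (|u x| ^ (p - 2) * u x))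
      (ENNReal.ofReal (2 * N * p / (N + α)).conjExponent) volume := by
  have := S.three_le
  have hα := S.hα
  have hαN := S.hαN
  have hp := S.hp
  have hσ := S.one_lt_sigma
  have h1 := memLp_rieszConv S.hα S.hαN S.memLp_up
  have h2 := memLp_rpow_sub_two_mul S.hp S.uσ
  have hc := Real.HolderConjugate.conjExponent hσ
  have e : (2 * N * p / (N + α)).conjExponent⁻¹ = 1 - (2 * N * p / (N + α))⁻¹ := by
    linarith [hc.inv_add_inv_eq_one]
  -- With σ = 2Np/(N+α) one has p/σ = (N+α)/(2N), hence (N-α)/(2N) + (p-1)/σ = 1 - 1/σ.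
  have := holderTriple_ofReal (a := 2 * N / (N - α)) (b := 2 * N * p / (N + α) / (p - 1))
    (c := (2 * N * p / (N + α)).conjExponent) (div_pos (by linarith) (by linarith))
    (div_pos (by linarith) (by linarith)) hc.symm.pos (by
      rw [e]
      have h1 : (N : ℝ) - α ≠ 0 := by linarith
      have h2 : (N : ℝ) + α ≠ 0 := by linarith
      have h3 : p - 1 ≠ 0 := by linarith
      field_simp
      ring)
  exact h2.mul (p := ENNReal.ofReal (2 * N / (N - α))) h1

/-- With τ = 2Nq/(N+2), Sobolev puts φ in L^(2N/(N-2)), and (N-2)/(2N) + (q-1)/τ = 1 - 1/τ. The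
coupling term thus pairs with functions in L^τ, a space containing u because K|u|^q ∈ L^(2N/(N+2)).
-/
lemma memLp_coupling (S : Solution N α p q K u φ Du Dφ) :
    MemLp (fun x => K * φ x * (|u x| ^ (q - 2) * u x))
      (ENNReal.ofReal (2 * N * q / (N + 2)).conjExponent) volume := by
  have := S.three_le
  have hq := S.hq
  have hσ := S.one_lt_tau
  have h1 := S.φstar.const_mul K
  have h2 := memLp_rpow_sub_two_mul S.hq S.uτ
  have hc := Real.HolderConjugate.conjExponent hσ
  have e : (2 * N * q / (N + 2)).conjExponent⁻¹ = 1 - (2 * N * q / (N + 2))⁻¹ := by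
    linarith [hc.inv_add_inv_eq_one]
  have := holderTriple_ofReal (a := 2 * N / (N - 2)) (b := 2 * N * q / (N + 2) / (q - 1))
    (c := (2 * N * q / (N + 2)).conjExponent) (div_pos (by linarith) (by linarith))
    (div_pos (by linarith) (by linarith)) hc.symm.pos (by
      rw [e]
      have h1 : (N : ℝ) - 2 ≠ 0 := by linarith
      have h2 : (N : ℝ) + 2 ≠ 0 := by linarith
      have h3 : q - 1 ≠ 0 := by linarith
      field_simp
      ring)
  exact h2.mul (p := ENNReal.ofReal (2 * N / (N - 2))) h1

lemma holder_sigma (S : Solution N α p q K u φ Du Dφ) :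
    ENNReal.HolderConjugate (ENNReal.ofReal (2 * N * p / (N + α)).conjExponent)
      (ENNReal.ofReal (2 * N * p / (N + α))) :=
  holderConjugate_ofReal (Real.HolderConjugate.conjExponent S.one_lt_sigma).symm

lemma holder_tau (S : Solution N α p q K u φ Du Dφ) :
    ENNReal.HolderConjugate (ENNReal.ofReal (2 * N * q / (N + 2)).conjExponent)
      (ENNReal.ofReal (2 * N * q / (N + 2))) :=
  holderConjugate_ofReal (Real.HolderConjugate.conjExponent S.one_lt_tau).symm

lemma holder_star (S : Solution N α p q K u φ Du Dφ) :
    ENNReal.HolderConjugate (ENNReal.ofReal (2 * N / (N + 2)))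
      (ENNReal.ofReal (2 * N / (N - 2))) := by
  have := S.three_le
  refine holderConjugate_ofReal (Real.holderConjugate_iff.2 ⟨?_, ?_⟩)
  · rw [lt_div_iff₀ (by linarith)]
    linarith
  · have h1 : (N : ℝ) - 2 ≠ 0 := by linarith
    have h2 : (N : ℝ) + 2 ≠ 0 := by linarith
    field_simp
    ring

lemma integrable_coupling_mul (S : Solution N α p q K u φ Du Dφ) {v : E N → ℝ}
    (hv : MemLp v (ENNReal.ofReal (2 * N * q / (N + 2))) volume) :
    Integrable fun x => K * φ x * (|u x| ^ (q - 2) * u x) * v x :=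
  have := S.holder_tau
  integrable_mul_of_memLp S.memLp_coupling hv

/-- The first equation may be tested with finite energy functions. -/
lemma eq₁_ext (S : Solution N α p q K u φ Du Dφ) {v : E N → ℝ} {G : E N → E N}
    (h : HasWeakGradient v G) (v2 : MemLp v 2 volume) (G2 : MemLp G 2 volume)
    (vσ : MemLp v (ENNReal.ofReal (2 * N * p / (N + α))) volume)
    (vτ : MemLp v (ENNReal.ofReal (2 * N * q / (N + 2))) volume) :
    (∫ x, inner ℝ (G x) (Du x)) + (∫ x, u x * v x) +
          (∫ x, K * φ x * (|u x| ^ (q - 2) * u x) * v x) =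
        ∫ x, rieszConv α (fun y => |u y| ^ p) x * (|u x| ^ (p - 2) * u x) * v x := by
  obtain ⟨η, hη, hη2, hη3⟩ := h.exists_test_seq v2 G2
  have := S.holder_sigma
  have := S.holder_tau
  have hm : ∀ n, AEStronglyMeasurable (η n) volume := fun n => (hη n).continuous.aestronglyMeasurable
  have t1 := tendsto_integral_inner S.Du2 G2
    (fun n => (contDiff_gradient (hη n).1).continuous.aestronglyMeasurable) hη2
  have t2 := tendsto_integral_mul S.u2 v2 hm (hη3 2 (by norm_num) (by norm_num) v2)
  have t3 := tendsto_integral_mul S.memLp_coupling vτ hm (hη3 _ (by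
    rw [← ENNReal.ofReal_one]; exact ENNReal.ofReal_le_ofReal S.one_lt_tau.le)
    ENNReal.ofReal_ne_top vτ)
  have t4 := tendsto_integral_mul S.memLp_choquard vσ hm (hη3 _ (by
    rw [← ENNReal.ofReal_one]; exact ENNReal.ofReal_le_ofReal S.one_lt_sigma.le)
    ENNReal.ofReal_ne_top vσ)
  refine tendsto_nhds_unique ((t1.add t2).add t3) (t4.congr fun n => ?_)
  rw [← S.eq₁ _ (hη n)]
  simp only [inner_gradient_left]

/-- The second equation may be tested with `H¹` functions. -/
lemma eq₂_ext (S : Solution N α p q K u φ Du Dφ) {v : E N → ℝ} {G : E N → E N}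
    (h : HasWeakGradient v G) (v2 : MemLp v 2 volume) (G2 : MemLp G 2 volume) :
    ∫ x, inner ℝ (G x) (Dφ x) = ∫ x, K * |u x| ^ q * v x := by
  obtain ⟨η, hη, hη2, hη3⟩ := h.exists_test_seq v2 G2
  have := S.holder_star
  have h3 := S.three_le
  have hm : ∀ n, AEStronglyMeasurable (η n) volume := fun n => (hη n).continuous.aestronglyMeasurable
  have vs := h.memLp_sobolev S.hN v2 G2
  have t1 := tendsto_integral_inner S.Dφ2 G2
    (fun n => (contDiff_gradient (hη n).1).continuous.aestronglyMeasurable) hη2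
  have t2 := tendsto_integral_mul S.Kuq vs hm (hη3 _
    (ENNReal.HolderConjugate.one_le _ (ENNReal.ofReal (2 * N / (N + 2))))
    ENNReal.ofReal_ne_top vs)
  refine tendsto_nhds_unique t1 (t2.congr fun n => ?_)
  rw [← S.eq₂ _ (hη n)]
  simp only [inner_gradient_left]

lemma energy_φ (S : Solution N α p q K u φ Du Dφ) :
    ∫ x, ‖Dφ x‖ ^ 2 = ∫ x, K * |u x| ^ q * φ x := by
  simpa using S.eq₂_ext S.wφ S.φ2 S.Dφ2

/-- Test the first equation with u itself. The coupling term becomes ∫K|u|^qφ, which `energy_φ`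
identifies with the Dirichlet energy of φ. -/
lemma nehari (S : Solution N α p q K u φ Du Dφ) :
    (∫ x, ‖Du x‖ ^ 2) + (∫ x, u x ^ 2) + (∫ x, ‖Dφ x‖ ^ 2) =
      ∫ x, rieszConv α (fun y => |u y| ^ p) x * |u x| ^ p := by
  have h := S.eq₁_ext S.wu S.u2 S.Du2 S.uσ S.uτ
  have h1 : ∀ x, inner ℝ (Du x) (Du x) = ‖Du x‖ ^ 2 := fun x => real_inner_self_eq_norm_sq _
  have h2 : ∀ x, K * φ x * (|u x| ^ (q - 2) * u x) * u x = K * |u x| ^ q * φ x := fun x => by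
    rw [← rpow_sub_two_mul_self_mul_self (u x) S.hq]
    ring
  have h3 : ∀ x, rieszConv α (fun y => |u y| ^ p) x * (|u x| ^ (p - 2) * u x) * u x =
      rieszConv α (fun y => |u y| ^ p) x * |u x| ^ p := fun x => by
    rw [← rpow_sub_two_mul_self_mul_self (u x) S.hp]
    ring
  simp only [h1, h2, h3, ← sq] at h
  rw [S.energy_φ, h]

/-- Weak maximum principle. Testing the second equation with F(φ), where F ≥ 0 is positive exactly
on the negative half-line and nonincreasing, gives ∫F'(φ)|∇φ|² = ∫K|u|^qF(φ). The left side is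
nonpositive and the right side nonnegative, so the gradient of F(φ) vanishes and F(φ) = 0. -/
lemma φ_nonneg (S : Solution N α p q K u φ Du Dφ) : ∀ᵐ x, 0 ≤ φ x := by
  -- A C¹ substitute for the negative part: F' is bounded by 1 and 1-Lipschitz, as
  -- `HasWeakGradient.comp` requires.
  set F' : ℝ → ℝ := fun t => max (-1) (min t 0) with hF'
  have hc : Continuous F' := by fun_prop
  set F : ℝ → ℝ := fun t => ∫ s in (0 : ℝ)..t, F' s with hF
  have hd : ∀ t, HasDerivAt F (F' t) t := fun t => hc.integral_hasStrictDerivAt 0 t |>.hasDerivAt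
  have hF'0 : ∀ t, F' t ≤ 0 := fun t => max_le (by norm_num) (min_le_right _ _)
  have hF'1 : ∀ t, |F' t| ≤ 1 := fun t => abs_le.2 ⟨le_max_left _ _, (hF'0 t).trans zero_le_one⟩
  have hF'L : ∀ a b, |F' a - F' b| ≤ |a - b| := fun a b => by
    have h1 := abs_max_sub_max_le_max (-1) (min a 0) (-1) (min b 0)
    have h2 := abs_min_sub_min_le_max a 0 b 0
    simp only [sub_self, abs_zero, abs_nonneg, sup_of_le_left, sup_of_le_right] at h1 h2
    exact h1.trans h2
  have hFpos : ∀ t, t < 0 → 0 < F t := fun t ht => by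
    have : 0 < ∫ s in t..0, -F' s := by
      refine intervalIntegral.intervalIntegral_pos_of_pos_on (hc.neg.intervalIntegrable _ _)
        (fun s hs => ?_) ht
      have : F' s < 0 := max_lt (by norm_num) (min_lt_of_left_lt hs.2)
      linarith
    rw [intervalIntegral.integral_neg, ← intervalIntegral.integral_symm] at this
    exact this
  have hFnn : ∀ t, 0 ≤ F t := fun t => by
    rcases lt_or_ge t 0 with ht | ht
    · exact (hFpos t ht).le
    · refine intervalIntegral.integral_nonneg ht fun s hs => ?_
      simp [hF', hs.1]
  have hF0 : F 0 = 0 := by simp [hF]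
  have hw := S.wφ.comp S.φ2 S.Dφ2 hd hF'1 hF'L hF0
  have m' : AEStronglyMeasurable (fun x => F' (φ x)) volume := hc.comp_aestronglyMeasurable S.φ2.1
  have hFc : Continuous F := continuous_iff_continuousAt.2 fun t => (hd t).continuousAt
  have G2 : MemLp (fun x => F' (φ x) • Dφ x) 2 volume := S.Dφ2.mono (m'.smul S.Dφ2.1)
    (.of_forall fun x => by
      rw [norm_smul]
      exact mul_le_of_le_one_left (norm_nonneg _) (hF'1 _))
  have v2 : MemLp (fun x => F (φ x)) 2 volume := by
    refine S.φ2.mono (hFc.comp_aestronglyMeasurable S.φ2.1) (.of_forall fun x => ?_)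
    have := Convex.norm_image_sub_le_of_norm_hasDerivWithin_le (f := F) (f' := F') (s := univ)
      (C := 1) (x := 0) (y := φ x) (fun x _ => (hd x).hasDerivWithinAt) (fun x _ => hF'1 x)
      convex_univ (mem_univ _) (mem_univ _)
    simpa [hF0] using this
  have e := S.eq₂_ext hw v2 G2
  have h1 : 0 ≤ ∫ x, inner ℝ (F' (φ x) • Dφ x) (Dφ x) := by
    rw [e]
    refine integral_nonneg fun x => mul_nonneg (mul_nonneg S.hK.le (by positivity)) (hFnn _)
  have hi := integrable_inner G2 S.Dφ2
  have hneg : ∀ x, inner ℝ (F' (φ x) • Dφ x) (Dφ x) ≤ 0 := fun x => by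
    rw [inner_smul_left]
    exact mul_nonpos_of_nonpos_of_nonneg (hF'0 _) real_inner_self_nonneg
  have h2 : (fun x => -inner ℝ (F' (φ x) • Dφ x) (Dφ x)) =ᵐ[volume] 0 := by
    refine (integral_eq_zero_iff_of_nonneg (fun x => neg_nonneg.2 (hneg x)) hi.neg).1 ?_
    rw [integral_neg]
    have := integral_nonpos (μ := volume) hneg
    linarith
  have h3 : (fun x => F' (φ x) • Dφ x) =ᵐ[volume] 0 := by
    filter_upwards [h2] with x hx
    simp only [Pi.zero_apply, neg_eq_zero, inner_smul_left, conj_trivial, mul_eq_zero,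
      inner_self_eq_zero] at hx ⊢
    rcases hx with hx | hx <;> simp [hx]
  filter_upwards [hw.eq_zero S.hN v2 h3] with x hx
  by_contra hlt
  exact (hFpos _ (not_le.1 hlt)).ne' hx

end Solution

/-! ### Dilations against factors of bounded support -/

lemma IsTest.exists_radius {ζ : E N → ℝ} (hζ : IsTest ζ) :
    ∃ R : ℝ, 0 < R ∧ ∀ x, R < ‖x‖ → ζ x = 0 := by
  obtain ⟨R, hR⟩ := hζ.2.isBounded.subset_closedBall (0 : E N)
  refine ⟨max R 1, by positivity, fun x hx => image_eq_zero_of_notMem_tsupport fun h => ?_⟩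
  have := mem_closedBall_zero_iff.1 (hR h)
  linarith [le_max_left R 1]

/-- A locally `L^r` function multiplied by a bounded function of bounded support is in `L^r`. -/
lemma memLp_mul_of_memLpLoc {g ζ : E N → ℝ} {r : ℝ≥0∞} (hg : AEStronglyMeasurable g volume)
    (h : MemLpLoc g r) (hζ : AEStronglyMeasurable ζ volume) {C R : ℝ} (hC : ∀ x, |ζ x| ≤ C)
    (hR : ∀ x, R < ‖x‖ → ζ x = 0) : MemLp (fun x => ζ x * g x) r volume := by
  have h1 := (memLp_indicator_iff_restrict (f := g) (measurableSet_closedBall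
    (x := (0 : E N)) (ε := R))).2 (h _ (isCompact_closedBall _ _))
  refine (h1.const_mul C).mono (hζ.mul hg) (.of_forall fun x => ?_)
  have hC0 : 0 ≤ C := (abs_nonneg _).trans (hC x)
  by_cases hx : x ∈ closedBall (0 : E N) R
  · rw [indicator_of_mem hx, norm_mul, norm_mul, Real.norm_eq_abs, Real.norm_of_nonneg hC0]
    exact mul_le_mul_of_nonneg_right (hC x) (norm_nonneg _)
  · rw [hR x (by simpa using hx), zero_mul, norm_zero]
    exact norm_nonneg _

lemma memLpLoc_inner_self {G : E N → E N} {r : ℝ≥0∞} (hm : AEStronglyMeasurable G volume)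
    (h : MemLpLoc (fun x => ‖G x‖) r) : MemLpLoc (fun x => inner ℝ (G x) x) r := by
  intro C hC
  obtain ⟨R, hR⟩ := hC.isBounded.subset_closedBall (0 : E N)
  refine ((h C hC).const_mul R).mono (hm.restrict.inner aestronglyMeasurable_id)
    ((ae_restrict_iff' hC.measurableSet).2 (.of_forall fun x hx => ?_))
  have hxR : ‖x‖ ≤ R := mem_closedBall_zero_iff.1 (hR hx)
  refine (norm_inner_le_norm _ _).trans ?_
  rw [mul_comm, Real.norm_of_nonneg (mul_nonneg ((norm_nonneg _).trans hxR) (norm_nonneg _))]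
  exact mul_le_mul_of_nonneg_right hxR (norm_nonneg _)

/-- Differentiation under dilations against a factor of bounded support. -/
lemma HasWeakGradient.hasDerivAt_integral_of_support {w : E N → ℝ} {G : E N → E N}
    (h : HasWeakGradient w G) {r r' : ℝ≥0∞} [hr : ENNReal.HolderConjugate r r'] (hr' : r ≠ ⊤)
    {k : E N → ℝ} (hk : MemLp k r volume) (hw : MemLp w r' volume)
    (hG : MemLpLoc (fun x => ‖G x‖) r') {R : ℝ} (hR0 : 0 < R) (hR : ∀ x, R < ‖x‖ → k x = 0) :
    HasDerivAt (fun l : ℝ => ∫ x, k x * w (l • x)) (∫ x, k x * inner ℝ (G x) x) 1 := by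
  have hR2 : 0 < 2 * R := by positivity
  have hχ := isTest_cutoff (N := N) hR2
  -- Replacing w by χw makes the radial derivative globally L^r'. The cutoff is 1 on the ball of
  -- radius 2R, so for l < 2 it is invisible on the support of k.
  have h1 := h.contDiff_mul hχ.1
  obtain ⟨C, -, hC⟩ := exists_fderiv_cutoff_le N
  have w1 : MemLp (fun x => cutoff N (2 * R) x * w x) r' volume :=
    hw.mono (hχ.continuous.aestronglyMeasurable.mul hw.1) (.of_forall fun x => by
      rw [norm_mul, Real.norm_of_nonneg (cutoff_nonneg _ _)]
      exact mul_le_of_le_one_left (norm_nonneg _) (cutoff_le_one _ _))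
  have g1 : MemLp (fun x => cutoff N (2 * R) x * inner ℝ (G x) x) r' volume :=
    memLp_mul_of_memLpLoc (h.2.1.aestronglyMeasurable.inner aestronglyMeasurable_id)
      (memLpLoc_inner_self h.2.1.aestronglyMeasurable hG) hχ.continuous.aestronglyMeasurable
      (C := 1) (R := 2 * (2 * R))
      (fun x => by rw [abs_of_nonneg (cutoff_nonneg _ _)]; exact cutoff_le_one _ _)
      (fun x hx => cutoff_eq_zero hR2 hx.le)
  have hd : Continuous fun x => fderiv ℝ (cutoff N (2 * R)) x x :=
    (hχ.1.continuous_fderiv (by simp)).clm_apply continuous_id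
  have g2 : MemLp (fun x => w x * fderiv ℝ (cutoff N (2 * R)) x x) r' volume := by
    refine (hw.const_mul (C / (2 * R) * (2 * (2 * R)))).mono
      (hw.1.mul hd.aestronglyMeasurable) (.of_forall fun x => ?_)
    have hc0 : 0 ≤ C / (2 * R) := (norm_nonneg _).trans (hC _ hR2 x)
    have hc1 : 0 ≤ C / (2 * R) * (2 * (2 * R)) := by positivity
    rw [norm_mul, norm_mul, mul_comm ‖w x‖, Real.norm_of_nonneg hc1]
    refine mul_le_mul_of_nonneg_right ?_ (norm_nonneg _)
    rcases le_or_gt ‖x‖ (2 * (2 * R)) with hx | hx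
    · exact (ContinuousLinearMap.le_opNorm _ _).trans
        (mul_le_mul (hC _ hR2 x) hx (norm_nonneg _) hc0)
    · rw [fderiv_cutoff_eq_zero_of_lt hR2 hx]
      simpa using hc1
  have key := h1.hasDerivAt_integral hr' hk w1 ((g1.add g2).ae_eq (.of_forall fun x => by
    simp only [Pi.add_apply]
    rw [inner_add_left, inner_smul_left, inner_smul_left, inner_gradient_left]
    rfl))
  refine HasDerivAt.congr_of_eventuallyEq ?_ (f := fun l : ℝ =>
    ∫ x, k x * (cutoff N (2 * R) (l • x) * w (l • x))) ?_
  · refine key.congr_deriv (integral_congr_ae (.of_forall fun x => ?_))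
    rcases le_or_gt ‖x‖ R with hx | hx
    · simp only
      rw [inner_add_left, inner_smul_left, inner_smul_left, inner_gradient_left,
        cutoff_eq_one hR2 (by linarith), fderiv_cutoff_eq_zero hR2 (by linarith)]
      simp
    · simp [hR x hx]
  · filter_upwards [Ioo_mem_nhds (by norm_num : (0 : ℝ) < 1) (by norm_num : (1 : ℝ) < 2)] with l hl
    refine integral_congr_ae (.of_forall fun x => ?_)
    rcases le_or_gt ‖x‖ R with hx | hx
    · simp only
      rw [cutoff_eq_one hR2, one_mul]
      rw [norm_smul, Real.norm_of_nonneg hl.1.le]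
      exact mul_le_mul hl.2.le hx (norm_nonneg _) (by norm_num)
    · simp [hR x hx]

/-! ### The regularised kernel and the local Choquard term -/

/-- Regularisation of the Riesz kernel. -/
def rieszReg (N : ℕ) (α ε : ℝ) (x : E N) : ℝ :=
  rieszConst N α * (‖x‖ ^ 2 + ε) ^ (-(((N : ℝ) - α) / 2))

lemma contDiff_rieszReg {α ε : ℝ} (hε : 0 < ε) : ContDiff ℝ ∞ (rieszReg N α ε) := by
  refine contDiff_const.mul (ContDiff.rpow_const_of_ne ?_ fun x => by positivity)
  exact (contDiff_norm_sq ℝ).add contDiff_const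

lemma rieszReg_nonneg {α ε : ℝ} (hα : 0 < α) (hαN : α < N) (hε : 0 < ε) (x : E N) :
    0 ≤ rieszReg N α ε x :=
  mul_nonneg (rieszConst_pos hα hαN).le (by positivity)

lemma rieszReg_neg {α ε : ℝ} (x : E N) : rieszReg N α ε (-x) = rieszReg N α ε x := by
  simp [rieszReg]

lemma riesz_eq_rieszReg_zero {α : ℝ} {x : E N} (hx : x ≠ 0) :
    riesz N α x = rieszReg N α 0 x := by
  have : 0 < ‖x‖ := norm_pos_iff.2 hx
  rw [riesz_eq, rieszReg, add_zero, Real.rpow_neg (by positivity), ← Real.rpow_natCast,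
    ← Real.rpow_mul this.le, div_eq_mul_inv]
  congr 3
  push_cast
  ring

lemma rieszReg_le_riesz {α ε : ℝ} (hα : 0 < α) (hαN : α < N) (hε : 0 < ε) {x : E N} (hx : x ≠ 0) :
    rieszReg N α ε x ≤ riesz N α x := by
  have : 0 < ‖x‖ := norm_pos_iff.2 hx
  rw [riesz_eq_rieszReg_zero hx]
  refine mul_le_mul_of_nonneg_left ?_ (rieszConst_pos hα hαN).le
  exact Real.rpow_le_rpow_of_nonpos (by positivity) (by linarith) (by linarith)

lemma tendsto_rieszReg {α : ℝ} {x : E N} (hx : x ≠ 0) {ε : ℕ → ℝ}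
    (hε : Tendsto ε atTop (𝓝 0)) :
    Tendsto (fun n => rieszReg N α (ε n) x) atTop (𝓝 (riesz N α x)) := by
  have : 0 < ‖x‖ := norm_pos_iff.2 hx
  rw [riesz_eq_rieszReg_zero hx]
  exact ((tendsto_const_nhds.add hε).rpow_const (.inl (by positivity))).const_mul _

lemma fderiv_rieszReg {α ε : ℝ} (hε : 0 < ε) (x v : E N) :
    fderiv ℝ (rieszReg N α ε) x v =
      -((N - α) * rieszReg N α ε x * (inner ℝ x v / (‖x‖ ^ 2 + ε))) := by
  have hpos : 0 < ‖x‖ ^ 2 + ε := by positivity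
  have h1 := (((hasStrictFDerivAt_norm_sq x).hasFDerivAt.add_const ε).rpow_const
    (p := -(((N : ℝ) - α) / 2)) (.inl hpos.ne')).const_mul (rieszConst N α)
  have h2 : HasFDerivAt (rieszReg N α ε) _ x := h1
  rw [h2.fderiv, rieszReg]
  simp only [smul_apply, innerSL_apply_apply, smul_eq_mul, nsmul_eq_mul]
  rw [Real.rpow_sub_one hpos.ne']
  field_simp
  push_cast
  ring

lemma volume_diagonal (hN : 1 ≤ N) :
    ∀ᵐ z : E N × E N ∂(volume.prod volume), z.1 - z.2 ≠ 0 := by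
  have : Nonempty (Fin N) := ⟨⟨0, hN⟩⟩
  have hd : MeasurableSet {z : E N × E N | z.1 - z.2 ≠ 0} :=
    (measurable_fst.sub measurable_snd) (measurableSet_singleton 0).compl
  refine (Measure.ae_prod_iff_ae_ae hd).2 (.of_forall fun x => ?_)
  filter_upwards [compl_mem_ae_iff.2 (measure_singleton x)] with y hy h
  exact hy (sub_eq_zero.1 h).symm

lemma integrable_kernel_prod {α : ℝ} (hα : 0 < α) (hαN : α < N) {J : E N → ℝ}
    (hJ : Measurable J) (hJr : ∀ x, x ≠ 0 → ‖J x‖ ≤ riesz N α x) {f g : E N → ℝ}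
    (hf : MemLp f (ENNReal.ofReal (2 * N / (N + α))) volume)
    (hg : MemLp g (ENNReal.ofReal (2 * N / (N + α))) volume) {m : E N × E N → ℝ}
    (hm : AEStronglyMeasurable m (volume.prod volume)) {C : ℝ} (hC : ∀ z, ‖m z‖ ≤ C) :
    Integrable (fun z : E N × E N => J (z.1 - z.2) * f z.2 * g z.1 * m z)
      (volume.prod volume) := by
  have hN : 1 ≤ N := by
    have : (0 : ℝ) < N := hα.trans hαN
    exact_mod_cast this
  refine ((integrable_riesz_prod hα hαN hf hg).norm.mul_const C).mono
    ((((hJ.comp (measurable_fst.sub measurable_snd)).aestronglyMeasurable.mul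
      hf.1.comp_snd).mul hg.1.comp_fst).mul hm) ?_
  filter_upwards [volume_diagonal hN] with z hz
  have hC0 : 0 ≤ C := (norm_nonneg _).trans (hC z)
  have h1 := (hJr _ hz).trans (le_abs_self _)
  simp only [norm_mul, norm_norm, Real.norm_of_nonneg hC0]
  gcongr
  · exact h1
  · exact hC z

lemma tendsto_integral_rieszReg {α : ℝ} (hα : 0 < α) (hαN : α < N) {f g : E N → ℝ}
    (hf : MemLp f (ENNReal.ofReal (2 * N / (N + α))) volume)
    (hg : MemLp g (ENNReal.ofReal (2 * N / (N + α))) volume) {m : ℕ → E N × E N → ℝ}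
    {m' : E N × E N → ℝ} (hm : ∀ n, AEStronglyMeasurable (m n) (volume.prod volume))
    {C : ℝ} (hC : ∀ n z, ‖m n z‖ ≤ C) {ε : ℕ → ℝ} (hε0 : ∀ n, 0 < ε n)
    (hε : Tendsto ε atTop (𝓝 0))
    (h : ∀ z, z.1 - z.2 ≠ 0 → Tendsto (fun n => m n z) atTop (𝓝 (m' z))) :
    Tendsto (fun n => ∫ z : E N × E N, rieszReg N α (ε n) (z.1 - z.2) * f z.2 * g z.1 * m n z
      ∂(volume.prod volume)) atTop
      (𝓝 (∫ z : E N × E N, riesz N α (z.1 - z.2) * f z.2 * g z.1 * m' z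
        ∂(volume.prod volume))) := by
  have hN : 1 ≤ N := by
    have : (0 : ℝ) < N := hα.trans hαN
    exact_mod_cast this
  refine tendsto_integral_of_dominated_convergence _ (fun n => ?_)
    ((integrable_riesz_prod hα hαN hf hg).norm.mul_const C) (fun n => ?_) ?_
  · exact ((((contDiff_rieszReg (hε0 n)).continuous.measurable.comp
      (measurable_fst.sub measurable_snd)).aestronglyMeasurable.mul
      hf.1.comp_snd).mul hg.1.comp_fst).mul (hm n)
  · filter_upwards [volume_diagonal hN] with z hz
    have h1 := (rieszReg_le_riesz hα hαN (hε0 n) hz).trans (le_abs_self _)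
    simp only [norm_mul]
    rw [Real.norm_of_nonneg (rieszReg_nonneg hα hαN (hε0 n) _)]
    gcongr
    · exact h1
    · exact hC n z
  · filter_upwards [volume_diagonal hN] with z hz
    exact (((tendsto_rieszReg hz hε).mul_const _).mul_const _).mul (h z hz)

namespace Solution

variable {α p q K : ℝ} {u φ : E N → ℝ} {Du Dφ : E N → E N}

/-- On compact sets L^(σ/(p-1)) embeds in L^(σ/(σ-1)) because p ≤ σ = 2Np/(N+α), which is N + α ≤
2N. -/
lemma memLpLoc_rpow_sub_two_mul (S : Solution N α p q K u φ Du Dφ) :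
    MemLpLoc (fun x => |u x| ^ (p - 2) * u x)
      (ENNReal.ofReal (2 * N * p / (N + α)).conjExponent) := by
  intro C hC
  have : IsFiniteMeasure (volume.restrict C) := ⟨by simpa using hC.measure_lt_top⟩
  refine ((memLp_rpow_sub_two_mul S.hp S.uσ).restrict C).mono_exponent
    (ENNReal.ofReal_le_ofReal ?_)
  have h1 := S.one_lt_sigma
  have h2 := S.three_le
  have hp := S.hp
  have hα := S.hα
  have hαN := S.hαN
  rw [Real.conjExponent]
  refine div_le_div_of_nonneg_left (by linarith) (by linarith) ?_
  have : p ≤ 2 * N * p / (N + α) := by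
    rw [le_div_iff₀ (by linarith)]
    nlinarith
  linarith

/-- The chain rule for `|u|^p`, in the form of the identity against `x · ∇`. -/
lemma integral_rpow_dilation (S : Solution N α p q K u φ Du Dφ) {ζ : E N → ℝ} (hζ : IsTest ζ)
    (h0 : ∀ x, 0 ≤ ζ x) :
    ∫ x, ζ x * (|u x| ^ (p - 2) * u x) * inner ℝ (Du x) x =
      -(1 / p) * ∫ x, |u x| ^ p * (N * ζ x + fderiv ℝ ζ x x) := by
  have hp := S.hp
  have := S.holder_sigma
  obtain ⟨R, hR0, hR⟩ := hζ.exists_radius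
  obtain ⟨B, hB⟩ := hζ.2.exists_bound_of_continuous hζ.continuous
  have hk : MemLp (fun x => ζ x * (|u x| ^ (p - 2) * u x))
      (ENNReal.ofReal (2 * N * p / (N + α)).conjExponent) volume :=
    memLp_mul_of_memLpLoc (memLp_rpow_sub_two_mul S.hp S.uσ).1 S.memLpLoc_rpow_sub_two_mul
      hζ.continuous.aestronglyMeasurable hB hR
  have hf : LocallyIntegrable (fun x => |u x| ^ p) volume :=
    S.memLp_up.locallyIntegrable (ENNReal.one_le_ofReal.2 (by
      have := S.three_le
      have hα := S.hα
      have hαN := S.hαN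
      rw [le_div_iff₀ (by linarith)]
      linarith))
  have D1 := S.wu.hasDerivAt_integral_of_support ENNReal.ofReal_ne_top hk S.uσ S.Duσ hR0
    (fun x hx => by rw [hR x hx, zero_mul])
  have D2 := hasDerivAt_integral_comp_inv_smul hf hζ
  have D3 : HasDerivAt (fun l : ℝ => (l ^ N)⁻¹) (-N) 1 := by
    have := (hasDerivAt_pow N (1 : ℝ)).inv (by simp)
    simp only [one_pow, mul_one, div_one] at this
    exact this
  have D := (((D3.mul D2).sub_const (∫ x, |u x| ^ p * ζ x)).const_mul (1 / p)).sub
    (D1.sub_const (∫ x, ζ x * (|u x| ^ (p - 2) * u x) * u x))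
  -- By `rpow_convexity`, (1/p)∫ζ(|u(l·)|^p - |u|^p) - ∫ζ|u|^(p-2)u(u(l·) - u) is nonnegative, and
  -- it is zero at l = 1. Its vanishing derivative is the desired identity.
  have hmin : IsLocalMin (((fun y : ℝ => (1 / p) * (((fun l : ℝ => (l ^ N)⁻¹) *
      fun l : ℝ => ∫ x, |u x| ^ p * ζ (l⁻¹ • x)) y - ∫ x, |u x| ^ p * ζ x)) -
      fun y : ℝ => (∫ x, ζ x * (|u x| ^ (p - 2) * u x) * u (y • x)) -
        ∫ x, ζ x * (|u x| ^ (p - 2) * u x) * u x)) 1 := by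
    filter_upwards [lt_mem_nhds (zero_lt_one (α := ℝ))] with l hl
    simp only [Pi.sub_apply, Pi.mul_apply, one_pow, inv_one, one_smul, one_mul, sub_self, mul_zero]
    have i1 := integrable_mul_of_memLp hk (memLp_comp_smul S.uσ hl.ne')
    have i2 := integrable_mul_of_memLp hk S.uσ
    have i3 := hf.integrable_test_mul hζ.continuous hζ.2
    have i4 := (hf.comp_smul hl.ne').integrable_test_mul hζ.continuous hζ.2
    rw [← integral_test_comp_smul hl (w := fun x => |u x| ^ p), ← integral_sub i1 i2]
    simp only [mul_comm (|u _| ^ p)]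
    have i43 : Integrable fun x => 1 / p * (ζ x * |u (l • x)| ^ p - ζ x * |u x| ^ p) :=
      (i4.sub i3).const_mul _
    have i12 : Integrable fun x => ζ x * (|u x| ^ (p - 2) * u x) * u (l • x) -
      ζ x * (|u x| ^ (p - 2) * u x) * u x := i1.sub i2
    rw [← integral_sub i4 i3, ← integral_const_mul, ← integral_sub i43 i12]
    refine integral_nonneg fun x => ?_
    have := mul_le_mul_of_nonneg_left (rpow_convexity (u x) (u (l • x)) hp) (h0 x)
    simp only [Pi.zero_apply]
    have e : 1 / p * (ζ x * |u (l • x)| ^ p - ζ x * |u x| ^ p) =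
      ζ x * ((|u (l • x)| ^ p - |u x| ^ p) / p) := by ring
    rw [e]
    linarith
  have hz := hmin.hasDerivAt_eq_zero D
  have i3 := hf.integrable_mul_test hζ.continuous hζ.2
  have hd : Continuous fun x => fderiv ℝ ζ x x :=
    (hζ.1.continuous_fderiv (by simp)).clm_apply continuous_id
  have i5 := hf.integrable_mul_test hd (hζ.2.mono' (fun x hx => by
    refine support_fderiv_subset ℝ fun h => hx ?_
    simp [h]))
  have e : ∫ x, |u x| ^ p * (N * ζ x + fderiv ℝ ζ x x) =
      N * (∫ x, |u x| ^ p * ζ x) + ∫ x, |u x| ^ p * fderiv ℝ ζ x x := by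
    rw [← integral_const_mul, ← integral_add (i3.const_mul _) i5]
    refine integral_congr_ae (.of_forall fun x => ?_)
    ring
  rw [e]
  simp only [inv_one, one_smul, one_pow, one_mul] at hz
  linarith

/-- Since (p-1)/σ + 1/σ = (N+α)/(2N), this density is an admissible entry for the
Hardy-Littlewood-Sobolev bound. The weight x is harmless on the support of η. -/
lemma memLp_test_mul (S : Solution N α p q K u φ Du Dφ) {η : E N → ℝ} (hη : IsTest η) :
    MemLp (fun x => η x * (|u x| ^ (p - 2) * u x) * inner ℝ (Du x) x)
      (ENNReal.ofReal (2 * N / (N + α))) volume := by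
  have := S.three_le
  have hα := S.hα
  have hαN := S.hαN
  have hp := S.hp
  obtain ⟨R, hR0, hR⟩ := hη.exists_radius
  obtain ⟨B, hB⟩ := hη.2.exists_bound_of_continuous hη.continuous
  have h1 := memLp_mul_of_memLpLoc (S.wu.2.1.aestronglyMeasurable.inner aestronglyMeasurable_id)
      (memLpLoc_inner_self S.wu.2.1.aestronglyMeasurable S.Duσ) hη.continuous.aestronglyMeasurable
      hB hR
  have h2 := memLp_rpow_sub_two_mul S.hp S.uσ
  have := holderTriple_ofReal (a := 2 * N * p / (N + α) / (p - 1)) (b := 2 * N * p / (N + α))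
    (c := 2 * N / (N + α)) (div_pos (by linarith [S.one_lt_sigma]) (by linarith))
    (by linarith [S.one_lt_sigma]) (div_pos (by linarith) (by linarith)) (by
      have h2 : (N : ℝ) + α ≠ 0 := by linarith
      have h3 : p - 1 ≠ 0 := by linarith
      field_simp
      ring)
  refine (h1.mul (p := ENNReal.ofReal (2 * N * p / (N + α) / (p - 1))) h2).ae_eq
    (.of_forall fun x => ?_)
  simp only [Pi.mul_apply, id]
  ring

/-- Freeze y, apply `integral_rpow_dilation` with ζ(x) = η(x) times the smooth kernel at x - y, and
integrate in y. Differentiating the kernel yields η(x)(x-y)·x/(|x-y|²+ε). Averaging with the swapped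
variables replaces it by half of (x-y)·(η(x)x - η(y)y)/(|x-y|²+ε), which stays bounded as ε → 0. -/
lemma integral_rieszReg_dilation (S : Solution N α p q K u φ Du Dφ) {η : E N → ℝ} (hη : IsTest η)
    (h0 : ∀ x, 0 ≤ η x) {ε : ℝ} (hε : 0 < ε) :
    ∫ z : E N × E N, rieszReg N α ε (z.1 - z.2) * |u z.2| ^ p *
        (η z.1 * (|u z.1| ^ (p - 2) * u z.1) * inner ℝ (Du z.1) z.1) * 1 ∂(volume.prod volume) =
      -(1 / p) * ∫ z : E N × E N, rieszReg N α ε (z.1 - z.2) * |u z.2| ^ p * |u z.1| ^ p *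
        (N * η z.1 + fderiv ℝ η z.1 z.1 - (N - α) / 2 *
          (inner ℝ (z.1 - z.2) (η z.1 • z.1 - η z.2 • z.2) / (‖z.1 - z.2‖ ^ 2 + ε)))
        ∂(volume.prod volume) := by
  have hα := S.hα
  have hαN := S.hαN
  have hf := S.memLp_up
  have hJ : Measurable (rieszReg N α ε) := (contDiff_rieszReg hε).continuous.measurable
  have hJr : ∀ x, x ≠ 0 → ‖rieszReg N α ε x‖ ≤ riesz N α x := fun x hx => by
    rw [Real.norm_of_nonneg (rieszReg_nonneg hα hαN hε x)]
    exact rieszReg_le_riesz hα hαN hε hx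
  obtain ⟨B, hB⟩ := hη.2.exists_bound_of_continuous hη.continuous
  obtain ⟨R, hR0, hR⟩ := hη.exists_radius
  have hB0 : 0 ≤ B := (norm_nonneg _).trans (hB 0)
  have hd : Continuous fun x => fderiv ℝ η x x :=
    (hη.1.continuous_fderiv (by simp)).clm_apply continuous_id
  have hdc : HasCompactSupport fun x => fderiv ℝ η x x := hη.2.mono' (fun x hx => by
    refine support_fderiv_subset ℝ fun h => hx ?_
    simp [h])
  obtain ⟨B', hB'⟩ := hdc.exists_bound_of_continuous hd
  have hηc := hη.continuous
  have c1 : Continuous fun z : E N × E N => N * η z.1 + fderiv ℝ η z.1 z.1 :=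
    (continuous_const.mul (hηc.comp continuous_fst)).add (hd.comp continuous_fst)
  have c2 : Continuous fun z : E N × E N =>
      η z.1 * (inner ℝ (z.1 - z.2) z.1 / (‖z.1 - z.2‖ ^ 2 + ε)) :=
    (hηc.comp continuous_fst).mul
      (((continuous_fst.sub continuous_snd).inner continuous_fst).div
        (((continuous_fst.sub continuous_snd).norm.pow 2).add continuous_const)
        fun z => by positivity)
  -- This bound degenerates as ε → 0. It only serves to split integrals at fixed ε, before
  -- symmetrisation.
  have b2 : ∀ z : E N × E N, ‖η z.1 * (inner ℝ (z.1 - z.2) z.1 / (‖z.1 - z.2‖ ^ 2 + ε))‖ ≤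
      B * (1 / 2 + R ^ 2 / (2 * ε)) := fun z => by
    rcases le_or_gt ‖z.1‖ R with hz | hz
    · rw [norm_mul]
      refine mul_le_mul (hB _) ?_ (norm_nonneg _) hB0
      have hp : 0 < ‖z.1 - z.2‖ ^ 2 + ε := by positivity
      rw [norm_div, Real.norm_of_nonneg hp.le, div_le_iff₀ hp]
      have h1 := norm_inner_le_norm (𝕜 := ℝ) (z.1 - z.2) z.1
      have h2 : ‖z.1‖ ^ 2 ≤ R ^ 2 := by gcongr
      have h3 : (1 / 2 + R ^ 2 / (2 * ε)) * (‖z.1 - z.2‖ ^ 2 + ε) =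
        ‖z.1 - z.2‖ ^ 2 / 2 + R ^ 2 / 2 + (ε / 2 + R ^ 2 / (2 * ε) * ‖z.1 - z.2‖ ^ 2) := by
        field_simp
        ring
      have h4 : 0 ≤ ε / 2 + R ^ 2 / (2 * ε) * ‖z.1 - z.2‖ ^ 2 := by positivity
      nlinarith [sq_nonneg (‖z.1 - z.2‖ - ‖z.1‖)]
    · rw [hR _ hz, zero_mul, norm_zero]
      positivity
  have i0 := integrable_kernel_prod hα hαN hJ hJr hf (S.memLp_test_mul hη)
    (m := fun _ => 1) aestronglyMeasurable_const (C := 1) (by simp)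
  have i1 := integrable_kernel_prod hα hαN hJ hJr hf hf c1.aestronglyMeasurable
    (C := N * B + B') fun z => (norm_add_le _ _).trans (add_le_add (by
      rw [norm_mul, Real.norm_of_nonneg (Nat.cast_nonneg N)]
      exact mul_le_mul_of_nonneg_left (hB _) (Nat.cast_nonneg N)) (hB' _))
  have i2 := integrable_kernel_prod hα hαN hJ hJr hf hf c2.aestronglyMeasurable b2
  have key : ∀ y, ∫ x, rieszReg N α ε (x - y) * |u y| ^ p *
        (η x * (|u x| ^ (p - 2) * u x) * inner ℝ (Du x) x) * 1 =
      -(1 / p) * ∫ x, (rieszReg N α ε (x - y) * |u y| ^ p * |u x| ^ p *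
          (N * η x + fderiv ℝ η x x) - (N - α) * (rieszReg N α ε (x - y) * |u y| ^ p * |u x| ^ p *
          (η x * (inner ℝ (x - y) x / (‖x - y‖ ^ 2 + ε))))) := fun y => by
    have hJs : ContDiff ℝ ∞ fun x => rieszReg N α ε (x - y) :=
      (contDiff_rieszReg hε).comp (contDiff_id.sub contDiff_const)
    have h := S.integral_rpow_dilation (hη.contDiff_mul hJs)
      fun x => mul_nonneg (rieszReg_nonneg hα hαN hε _) (h0 x)
    have hl : ∀ x, rieszReg N α ε (x - y) * |u y| ^ p *
        (η x * (|u x| ^ (p - 2) * u x) * inner ℝ (Du x) x) * 1 =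
        |u y| ^ p * (rieszReg N α ε (x - y) * η x * (|u x| ^ (p - 2) * u x) *
          inner ℝ (Du x) x) := fun x => by ring
    simp only [hl]
    rw [integral_const_mul, h, mul_left_comm, ← integral_const_mul]
    congr 2
    ext x
    have hdx : fderiv ℝ (fun x => rieszReg N α ε (x - y) * η x) x x =
        rieszReg N α ε (x - y) * fderiv ℝ η x x + η x * fderiv ℝ (rieszReg N α ε) (x - y) x := by
      rw [fderiv_fun_mul (hJs.differentiable (by simp) x) (hη.differentiable x),
        fderiv_comp_sub]
      simp
    rw [hdx, fderiv_rieszReg hε]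
    ring
  rw [integral_prod_symm _ i0]
  simp only [key]
  rw [integral_const_mul, ← integral_prod_symm
    (fun z : E N × E N => rieszReg N α ε (z.1 - z.2) * |u z.2| ^ p * |u z.1| ^ p *
          (N * η z.1 + fderiv ℝ η z.1 z.1) -
        (N - α) * (rieszReg N α ε (z.1 - z.2) * |u z.2| ^ p * |u z.1| ^ p *
          (η z.1 * (inner ℝ (z.1 - z.2) z.1 / (‖z.1 - z.2‖ ^ 2 + ε)))))
    (i1.sub (i2.const_mul _))]
  congr 1
  have i3 := i2.swap
  have e := integral_prod_swap (μ := volume) (ν := volume) fun z : E N × E N =>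
    rieszReg N α ε (z.1 - z.2) * |u z.2| ^ p * |u z.1| ^ p *
          (η z.1 * (inner ℝ (z.1 - z.2) z.1 / (‖z.1 - z.2‖ ^ 2 + ε)))
  have e2 := integral_add i2 i3
  simp only [Function.comp_apply] at e2
  rw [e, ← two_mul] at e2
  rw [integral_sub i1 (i2.const_mul _), integral_const_mul]
  have e3 : ∀ z : E N × E N, rieszReg N α ε (z.1 - z.2) * |u z.2| ^ p * |u z.1| ^ p *
        (N * η z.1 + fderiv ℝ η z.1 z.1 - (N - α) / 2 *
          (inner ℝ (z.1 - z.2) (η z.1 • z.1 - η z.2 • z.2) / (‖z.1 - z.2‖ ^ 2 + ε))) =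
      rieszReg N α ε (z.1 - z.2) * |u z.2| ^ p * |u z.1| ^ p *
        (N * η z.1 + fderiv ℝ η z.1 z.1) - (N - α) / 2 *
      (rieszReg N α ε (z.1 - z.2) * |u z.2| ^ p * |u z.1| ^ p *
          (η z.1 * (inner ℝ (z.1 - z.2) z.1 / (‖z.1 - z.2‖ ^ 2 + ε))) +
        rieszReg N α ε (z.swap.1 - z.swap.2) * |u z.swap.2| ^ p * |u z.swap.1| ^ p *
          (η z.swap.1 * (inner ℝ (z.swap.1 - z.swap.2) z.swap.1 /
            (‖z.swap.1 - z.swap.2‖ ^ 2 + ε)))) := fun z => by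
    simp only [Prod.fst_swap, Prod.snd_swap]
    rw [← neg_sub z.1 z.2, rieszReg_neg, norm_neg, inner_neg_left, inner_sub_right,
      inner_smul_right, inner_smul_right]
    ring
  simp only [e3]
  have i23 := (i2.add i3).const_mul ((N - α) / 2)
  simp only [Pi.add_apply, Function.comp_apply] at i23
  rw [integral_sub i1 i23, integral_const_mul, e2]
  ring

lemma lipschitz_const_nonneg (S : Solution N α p q K u φ Du Dφ) {η : E N → ℝ} {L : ℝ}
    (hL : ∀ x y : E N, |inner ℝ (x - y) (η x • x - η y • y)| ≤ L * ‖x - y‖ ^ 2) : 0 ≤ L := by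
  have : Nontrivial (E N) := by
    have : Nonempty (Fin N) := ⟨⟨0, by linarith [S.hN]⟩⟩
    infer_instance
  obtain ⟨x, hx⟩ := exists_ne (0 : E N)
  have h1 := (abs_nonneg _).trans (hL x 0)
  rw [sub_zero] at h1
  have : 0 < ‖x‖ ^ 2 := by positivity
  exact nonneg_of_mul_nonneg_left h1 this

/-- The local Pohozaev term of the Choquard nonlinearity. -/
lemma integral_choquard_dilation (S : Solution N α p q K u φ Du Dφ) {η : E N → ℝ} (hη : IsTest η)
    (h0 : ∀ x, 0 ≤ η x) {L : ℝ}
    (hL : ∀ x y : E N, |inner ℝ (x - y) (η x • x - η y • y)| ≤ L * ‖x - y‖ ^ 2) :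
    ∫ x, rieszConv α (fun y => |u y| ^ p) x *
        (η x * (|u x| ^ (p - 2) * u x) * inner ℝ (Du x) x) =
      -(1 / p) * ∫ z : E N × E N, riesz N α (z.1 - z.2) * |u z.2| ^ p * |u z.1| ^ p *
        (N * η z.1 + fderiv ℝ η z.1 z.1 - (N - α) / 2 *
          (inner ℝ (z.1 - z.2) (η z.1 • z.1 - η z.2 • z.2) / ‖z.1 - z.2‖ ^ 2))
        ∂(volume.prod volume) := by
  have hα := S.hα
  have hαN := S.hαN
  have hf := S.memLp_up
  have hε : Tendsto (fun n : ℕ => 1 / ((n : ℝ) + 1)) atTop (𝓝 0) :=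
    tendsto_one_div_add_atTop_nhds_zero_nat
  have hε0 : ∀ n : ℕ, 0 < 1 / ((n : ℝ) + 1) := fun n => by positivity
  obtain ⟨B, hB⟩ := hη.2.exists_bound_of_continuous hη.continuous
  have hd : Continuous fun x => fderiv ℝ η x x :=
    (hη.1.continuous_fderiv (by simp)).clm_apply continuous_id
  have hdc : HasCompactSupport fun x => fderiv ℝ η x x := hη.2.mono' (fun x hx => by
    refine support_fderiv_subset ℝ fun h => hx ?_
    simp [h])
  obtain ⟨B', hB'⟩ := hdc.exists_bound_of_continuous hd
  have hηc := hη.continuous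
  have t1 := tendsto_integral_rieszReg hα hαN hf (S.memLp_test_mul hη) (m := fun _ _ => 1)
    (m' := fun _ => 1) (fun _ => aestronglyMeasurable_const) (C := 1) (by simp) hε0 hε
    (fun _ _ => tendsto_const_nhds)
  have t2 := tendsto_integral_rieszReg hα hαN hf hf (m := fun n z =>
      N * η z.1 + fderiv ℝ η z.1 z.1 - (N - α) / 2 *
          (inner ℝ (z.1 - z.2) (η z.1 • z.1 - η z.2 • z.2) /
            (‖z.1 - z.2‖ ^ 2 + 1 / ((n : ℝ) + 1))))
    (m' := fun z => N * η z.1 + fderiv ℝ η z.1 z.1 - (N - α) / 2 *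
          (inner ℝ (z.1 - z.2) (η z.1 • z.1 - η z.2 • z.2) / ‖z.1 - z.2‖ ^ 2))
    (fun n => by
      refine Continuous.aestronglyMeasurable ?_
      refine ((continuous_const.mul (hηc.comp continuous_fst)).add (hd.comp continuous_fst)).sub
        (continuous_const.mul (Continuous.div ?_ ?_ fun z => ?_))
      · fun_prop
      · fun_prop
      · have := hε0 n
        positivity)
    -- After symmetrisation the numerator is at most L|x-y|², so this bound is independent of ε and
    -- dominated convergence applies.
    (C := N * B + B' + (N - α) / 2 * L) (fun n z => by
      refine (norm_sub_le _ _).trans (add_le_add ((norm_add_le _ _).trans (add_le_add ?_ (hB' _)))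
        ?_)
      · rw [norm_mul, Real.norm_of_nonneg (Nat.cast_nonneg N)]
        exact mul_le_mul_of_nonneg_left (hB _) (Nat.cast_nonneg N)
      · have hp : 0 < ‖z.1 - z.2‖ ^ 2 + 1 / ((n : ℝ) + 1) := by
          have := hε0 n
          positivity
        rw [norm_mul, Real.norm_of_nonneg (by linarith : 0 ≤ (N - α) / 2)]
        refine mul_le_mul_of_nonneg_left ?_ (by linarith)
        rw [norm_div, Real.norm_of_nonneg hp.le, div_le_iff₀ hp]
        have := S.lipschitz_const_nonneg hL
        have := mul_nonneg this (hε0 n).le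
        refine (hL _ _).trans ?_
        linarith) hε0 hε (fun z hz => by
      refine tendsto_const_nhds.sub (tendsto_const_nhds.mul (tendsto_const_nhds.div ?_ ?_))
      · simpa using tendsto_const_nhds.add hε
      · simpa using hz)
  have h := tendsto_nhds_unique t1 ((t2.const_mul (-(1 / p))).congr fun n =>
    (S.integral_rieszReg_dilation hη h0 (hε0 n)).symm)
  have ir := integrable_riesz_prod hα hαN hf (S.memLp_test_mul hη)
  simp only [mul_one] at h
  rw [← h, integral_prod _ ir]
  simp only [integral_mul_const]
  rfl

end Solution

/-! ### The localised Pohozaev identity -/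

lemma hasDerivAt_inv_pow (k : ℕ) : HasDerivAt (fun l : ℝ => (l ^ k)⁻¹) (-k) 1 := by
  have := (hasDerivAt_pow k (1 : ℝ)).inv (by simp)
  simp only [one_pow, mul_one, div_one] at this
  exact this

lemma IsTest.memLp_mul {F : Type*} [NormedAddCommGroup F] [NormedSpace ℝ F] {η : E N → ℝ}
    (hη : IsTest η) {f : E N → F} {r : ℝ≥0∞} (hf : MemLp f r volume) :
    MemLp (fun x => η x • f x) r volume := by
  obtain ⟨B, hB⟩ := hη.2.exists_bound_of_continuous hη.continuous
  have hB0 : 0 ≤ B := (norm_nonneg _).trans (hB 0)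
  refine (hf.norm.const_mul B).mono (hη.continuous.aestronglyMeasurable.smul hf.1)
    (.of_forall fun x => ?_)
  rw [norm_smul, norm_mul, norm_norm, Real.norm_of_nonneg hB0]
  exact mul_le_mul_of_nonneg_right (hB x) (norm_nonneg _)

lemma IsTest.memLp_smul_gradient {η : E N → ℝ} (hη : IsTest η) {f : E N → ℝ} {r : ℝ≥0∞}
    (hf : MemLp f r volume) : MemLp (fun x => f x • gradient η x) r volume := by
  have hc := (contDiff_gradient hη.1).continuous
  obtain ⟨B, hB⟩ := hη.gradient_hasCompactSupport.exists_bound_of_continuous hc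
  have hB0 : 0 ≤ B := (norm_nonneg _).trans (hB 0)
  refine (hf.norm.const_mul B).mono (hf.1.smul hc.aestronglyMeasurable)
    (.of_forall fun x => ?_)
  rw [norm_smul, norm_mul, norm_norm, Real.norm_of_nonneg hB0, mul_comm]
  exact mul_le_mul_of_nonneg_right (hB x) (norm_nonneg _)

lemma IsTest.hasCompactSupport_fderiv_self {η : E N → ℝ} (hη : IsTest η) :
    HasCompactSupport fun x => fderiv ℝ η x x := hη.2.mono' (fun x hx => by
  refine support_fderiv_subset ℝ fun h => hx ?_
  simp [h])

lemma IsTest.continuous_fderiv_self {η : E N → ℝ} (hη : IsTest η) :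
    Continuous fun x => fderiv ℝ η x x :=
  (hη.1.continuous_fderiv (by simp)).clm_apply continuous_id

lemma integrable_normSq {F : Type*} [NormedAddCommGroup F] {G : E N → F} (hG : MemLp G 2 volume) :
    Integrable fun x => ‖G x‖ ^ 2 := hG.integrable_norm_pow two_ne_zero

/-- Dilation estimate for a quadratic energy density. -/
lemma integral_inner_dilation_le {F : Type*} [NormedAddCommGroup F] [InnerProductSpace ℝ F]
    {G : E N → F} (hG : MemLp G 2 volume) {η : E N → ℝ}
    (hη : IsTest η) (h0 : ∀ x, 0 ≤ η x) {l : ℝ} (hl : 0 < l) (c : ℝ) :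
    ∫ x, inner ℝ (η x • (c • G (l • x) - G x)) (G x) ≤
      1 / 2 * (c ^ 2 * (l ^ N)⁻¹ * (∫ x, ‖G x‖ ^ 2 * η (l⁻¹ • x)) - ∫ x, ‖G x‖ ^ 2 * η x) := by
  have hGl := memLp_comp_smul hG hl.ne'
  have i1 : Integrable fun x => η x * ‖G (l • x)‖ ^ 2 :=
    (integrable_normSq hGl).locallyIntegrable.integrable_test_mul hη.continuous hη.2
  have i2 : Integrable fun x => η x * ‖G x‖ ^ 2 :=
    (integrable_normSq hG).locallyIntegrable.integrable_test_mul hη.continuous hη.2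
  rw [mul_assoc, ← integral_test_comp_smul hl (w := fun x => ‖G x‖ ^ 2)]
  simp only [mul_comm (‖G _‖ ^ 2)]
  have i12 : Integrable fun x => c ^ 2 * (η x * ‖G (l • x)‖ ^ 2) - η x * ‖G x‖ ^ 2 :=
    (i1.const_mul _).sub i2
  rw [← integral_const_mul, ← integral_sub (i1.const_mul _) i2, ← integral_const_mul]
  have iv : MemLp (fun x => c • G (l • x) - G x) 2 volume := (hGl.const_smul c).sub hG
  refine integral_mono (integrable_inner (hη.memLp_mul iv) hG) (i12.const_mul _) fun x => ?_
  · simp only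
    rw [inner_smul_left, inner_sub_left, inner_smul_left, real_inner_self_eq_norm_sq]
    have h1 : c * inner ℝ (G (l • x)) (G x) ≤ (c ^ 2 * ‖G (l • x)‖ ^ 2 + ‖G x‖ ^ 2) / 2 := by
      have h2 := real_inner_le_norm (c • G (l • x)) (G x)
      rw [inner_smul_left, norm_smul] at h2
      simp only [conj_trivial, Real.norm_eq_abs] at h2
      have h3 := sq_abs c
      rw [← h3]
      nlinarith [sq_nonneg (|c| * ‖G (l • x)‖ - ‖G x‖)]
    have := mul_le_mul_of_nonneg_left h1 (h0 x)
    simp only [conj_trivial]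
    linarith

namespace Solution

variable {α p q K : ℝ} {u φ : E N → ℝ} {Du Dφ : E N → E N}

/-- Convexity turns the coupling into a difference of ∫K|u|^qηφ under dilation. Moving the dilation
onto ηφ makes it the right side of the second equation for ψ = l^(-N)(ηφ)(·/l) - ηφ, hence ∫∇ψ·∇φ.
Only the term pairing ∇φ(·/l) with ∇φ is then estimated, by Young; the ∇η terms are kept exactly. -/
lemma integral_coupling_dilation_le (S : Solution N α p q K u φ Du Dφ) {η : E N → ℝ}
    (hη : IsTest η) (h0 : ∀ x, 0 ≤ η x) {l : ℝ} (hl : 0 < l) :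
    ∫ x, K * φ x * (|u x| ^ (q - 2) * u x) * (η x * (u (l • x) - u x)) ≤
      1 / q * (1 / 2 * (l ^ 1)⁻¹ * (∫ x, ‖Dφ x‖ ^ 2 * η x) +
        1 / 2 * (l ^ (N + 1))⁻¹ * (∫ x, ‖Dφ x‖ ^ 2 * η (l⁻¹ • x)) - (∫ x, ‖Dφ x‖ ^ 2 * η x) +
        ((l ^ (N + 1))⁻¹ *
          (∫ x, inner ℝ (φ (l⁻¹ • x) • gradient η (l⁻¹ • x)) (Dφ x)) -
          ∫ x, inner ℝ (φ x • gradient η x) (Dφ x))) := by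
  have hq := S.hq
  have := S.holder_star
  have hl' : 0 < l⁻¹ := by positivity
  have hs : MemLp (fun x => η x * φ x) (ENNReal.ofReal (2 * N / (N - 2))) volume :=
    hη.memLp_mul S.φstar
  have hη2 := (hη.comp_smul hl'.ne')
  have vτ : MemLp (fun x => η x * (u (l • x) - u x)) (ENNReal.ofReal (2 * N * q / (N + 2)))
    volume := hη.memLp_mul ((memLp_comp_smul S.uτ hl.ne').sub S.uτ)
  have i1 := integrable_mul_of_memLp (memLp_comp_smul S.Kuq hl.ne') hs
  have i2 := integrable_mul_of_memLp S.Kuq hs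
  have i3 := integrable_mul_of_memLp S.Kuq (memLp_comp_smul hs hl'.ne')
  have step1 : ∫ x, K * φ x * (|u x| ^ (q - 2) * u x) * (η x * (u (l • x) - u x)) ≤
      1 / q * ∫ x, K * |u x| ^ q * ((l ^ N)⁻¹ * (η (l⁻¹ • x) * φ (l⁻¹ • x)) - η x * φ x) := by
    have e1 : ∫ x, K * |u (l • x)| ^ q * (η x * φ x) =
        (l ^ N)⁻¹ * ∫ x, K * |u x| ^ q * (η (l⁻¹ • x) * φ (l⁻¹ • x)) := by
      rw [← integral_test_comp_smul hl (w := fun x => K * |u x| ^ q) (ζ := fun x => η x * φ x)]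
      simp only [mul_comm (K * _)]
    have e2 : ∫ x, K * |u x| ^ q * ((l ^ N)⁻¹ * (η (l⁻¹ • x) * φ (l⁻¹ • x)) - η x * φ x) =
        ∫ x, (K * |u (l • x)| ^ q * (η x * φ x) - K * |u x| ^ q * (η x * φ x)) := by
      rw [integral_sub i1 i2, e1, ← integral_const_mul, ← integral_sub (i3.const_mul _) i2]
      congr 1
      ext x
      ring
    rw [e2, ← integral_const_mul]
    refine integral_mono_ae (S.integrable_coupling_mul vτ) ((i1.sub i2).const_mul _) ?_
    -- The sign of φ is essential: the convexity inequality is multiplied by Kφη.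
    filter_upwards [S.φ_nonneg] with x hx
    have h1 := mul_le_mul_of_nonneg_left (rpow_convexity (u x) (u (l • x)) hq)
      (mul_nonneg (mul_nonneg S.hK.le hx) (h0 x))
    calc _ = K * φ x * η x * (|u x| ^ (q - 2) * u x * (u (l • x) - u x)) := by ring
      _ ≤ _ := h1
      _ = _ := by ring
  refine step1.trans (mul_le_mul_of_nonneg_left ?_ (by positivity))
  have w := S.wφ.contDiff_mul hη.1
  have w2 : MemLp (fun x => η x * φ x) 2 volume := hη.memLp_mul S.φ2
  have a1 : MemLp (fun x => η x • Dφ x) 2 volume := hη.memLp_mul S.Dφ2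
  have a2 : MemLp (fun x => φ x • gradient η x) 2 volume := hη.memLp_smul_gradient S.φ2
  have a1l := memLp_comp_smul a1 hl'.ne'
  have a2l := memLp_comp_smul a2 hl'.ne'
  have wψ := ((w.comp_smul hl').const_mul (l ^ N)⁻¹).sub w
  rw [← S.eq₂_ext wψ (((memLp_comp_smul w2 hl'.ne').const_mul _).sub w2)
    ((((memLp_comp_smul (a1.add a2) hl'.ne').const_smul l⁻¹).const_smul (l ^ N)⁻¹).sub
      (a1.add a2))]
  have j1 := integrable_inner a1l S.Dφ2
  have j2 := integrable_inner a2l S.Dφ2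
  have j3 := integrable_inner a1 S.Dφ2
  have j4 := integrable_inner a2 S.Dφ2
  have n1 : Integrable fun x => ‖Dφ x‖ ^ 2 * η x :=
    (integrable_normSq S.Dφ2).locallyIntegrable.integrable_mul_test hη.continuous hη.2
  have n2 : Integrable fun x => ‖Dφ x‖ ^ 2 * η (l⁻¹ • x) :=
    (integrable_normSq S.Dφ2).locallyIntegrable.integrable_mul_test hη2.continuous hη2.2
  have n3 : Integrable fun x => ‖Dφ (l⁻¹ • x)‖ ^ 2 * η (l⁻¹ • x) :=
    (integrable_normSq (memLp_comp_smul S.Dφ2 hl'.ne')).locallyIntegrable.integrable_mul_test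
      hη2.continuous hη2.2
  have ej : ∫ x, inner ℝ (η (l⁻¹ • x) • Dφ (l⁻¹ • x)) (Dφ x) ≤
      1 / 2 * (l ^ N * (∫ x, ‖Dφ x‖ ^ 2 * η x) + ∫ x, ‖Dφ x‖ ^ 2 * η (l⁻¹ • x)) := by
    have e := integral_test_comp_smul hl' (w := fun x => ‖Dφ x‖ ^ 2 * η x) (ζ := fun _ => 1)
    simp only [one_mul, mul_one, inv_pow, inv_inv] at e
    rw [← e, ← integral_add n3 n2, ← integral_const_mul]
    refine integral_mono j1 ((n3.add n2).const_mul _) fun x => ?_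
    simp only
    rw [inner_smul_left]
    have h2 := real_inner_le_norm (Dφ (l⁻¹ • x)) (Dφ x)
    have h3 : inner ℝ (Dφ (l⁻¹ • x)) (Dφ x) ≤ (‖Dφ (l⁻¹ • x)‖ ^ 2 + ‖Dφ x‖ ^ 2) / 2 := by
      nlinarith [sq_nonneg (‖Dφ (l⁻¹ • x)‖ - ‖Dφ x‖)]
    have := mul_le_mul_of_nonneg_left h3 (h0 (l⁻¹ • x))
    simp only [conj_trivial]
    linarith
  have ej3 : ∫ x, inner ℝ (η x • Dφ x) (Dφ x) = ∫ x, ‖Dφ x‖ ^ 2 * η x := by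
    congr 1
    ext x
    rw [inner_smul_left, real_inner_self_eq_norm_sq, mul_comm]
    rfl
  have et : ∫ x, inner ℝ ((l ^ N)⁻¹ • l⁻¹ • (η (l⁻¹ • x) • Dφ (l⁻¹ • x) +
        φ (l⁻¹ • x) • gradient η (l⁻¹ • x)) - (η x • Dφ x + φ x • gradient η x)) (Dφ x) =
      (l ^ (N + 1))⁻¹ * ((∫ x, inner ℝ (η (l⁻¹ • x) • Dφ (l⁻¹ • x)) (Dφ x)) +
        ∫ x, inner ℝ (φ (l⁻¹ • x) • gradient η (l⁻¹ • x)) (Dφ x)) -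
      ((∫ x, inner ℝ (η x • Dφ x) (Dφ x)) + ∫ x, inner ℝ (φ x • gradient η x) (Dφ x)) := by
    have j12 : Integrable fun x => (l ^ (N + 1))⁻¹ *
      (inner ℝ (η (l⁻¹ • x) • Dφ (l⁻¹ • x)) (Dφ x) +
        inner ℝ (φ (l⁻¹ • x) • gradient η (l⁻¹ • x)) (Dφ x)) := (j1.add j2).const_mul _
    have j34 : Integrable fun x => inner ℝ (η x • Dφ x) (Dφ x) +
        inner ℝ (φ x • gradient η x) (Dφ x) := j3.add j4
    rw [← integral_add j1 j2, ← integral_add j3 j4, ← integral_const_mul, ← integral_sub j12 j34]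
    congr 1
    ext x
    rw [inner_sub_left, inner_add_left, smul_smul, real_inner_smul_left, inner_add_left, pow_succ,
      mul_inv]
  rw [et, ej3]
  have hp : 0 ≤ (l ^ (N + 1))⁻¹ := by positivity
  have h := mul_le_mul_of_nonneg_left ej hp
  have e5 : (l ^ (N + 1))⁻¹ * l ^ N = (l ^ 1)⁻¹ := by
    field_simp
    ring
  have e6 : (l ^ (N + 1))⁻¹ * (1 / 2 * (l ^ N * (∫ x, ‖Dφ x‖ ^ 2 * η x) +
      ∫ x, ‖Dφ x‖ ^ 2 * η (l⁻¹ • x))) = 1 / 2 * (l ^ 1)⁻¹ * (∫ x, ‖Dφ x‖ ^ 2 * η x) +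
        1 / 2 * (l ^ (N + 1))⁻¹ * (∫ x, ‖Dφ x‖ ^ 2 * η (l⁻¹ • x)) := by
    rw [← e5]
    ring
  rw [e6] at h
  linarith

end Solution

/-- Derivative under dilations of `∫ ∇ζ(x) · G(y)` type pairings. -/
lemma HasWeakGradient.hasDerivAt_integral_gradient {w : E N → ℝ} {G : E N → E N}
    (h : HasWeakGradient w G) (hw : MemLp w 2 volume) (hG : MemLp G 2 volume)
    {η : E N → ℝ} (hη : IsTest η) :
    HasDerivAt (fun l : ℝ => ∫ x, inner ℝ (w (l • x) • gradient η (l • x)) (G x))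
      (∑ i : Fin N, ∫ x, G x i *
        (fderiv ℝ η x (EuclideanSpace.basisFun (Fin N) ℝ i) * inner ℝ (G x) x +
          w x * fderiv ℝ (fun y => fderiv ℝ η y (EuclideanSpace.basisFun (Fin N) ℝ i)) x x)) 1 := by
  set b := EuclideanSpace.basisFun (Fin N) ℝ with hb
  have hGi : ∀ i, MemLp (fun x => G x i) 2 volume := fun i =>
    hG.mono (((EuclideanSpace.proj (𝕜 := ℝ) i).continuous).comp_aestronglyMeasurable hG.1)
      (.of_forall fun x => PiLp.norm_apply_le _ _)
  have ηi : ∀ i, IsTest fun x => fderiv ℝ η x (b i) := fun i => hη.fderiv_apply _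
  have wi := fun i => h.contDiff_mul (ηi i).1
  have wi2 : ∀ i, MemLp (fun x => fderiv ℝ η x (b i) * w x) 2 volume := fun i =>
    (ηi i).memLp_mul hw
  -- The vector pairing is split into coordinates so that the scalar differentiation lemma applies
  -- to the weakly differentiable functions ∂_iη·w.
  have D : ∀ i, HasDerivAt (fun l : ℝ => ∫ x, G x i * (fderiv ℝ η (l • x) (b i) * w (l • x)))
      (∫ x, G x i * (fderiv ℝ η x (b i) * inner ℝ (G x) x +
          w x * fderiv ℝ (fun y => fderiv ℝ η y (b i)) x x)) 1 := fun i => by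
    obtain ⟨R, hR0, hR⟩ := (ηi i).exists_radius
    obtain ⟨B, hB⟩ := (ηi i).2.exists_bound_of_continuous (ηi i).continuous
    obtain ⟨B', hB'⟩ := (ηi i).hasCompactSupport_fderiv_self.exists_bound_of_continuous
      (ηi i).continuous_fderiv_self
    have hB0 : 0 ≤ B' := (norm_nonneg _).trans (hB' 0)
    have m1 : MemLp (fun x => fderiv ℝ η x (b i) * inner ℝ (G x) x) 2 volume :=
      memLp_mul_of_memLpLoc (hG.1.inner aestronglyMeasurable_id)
        (memLpLoc_inner_self hG.1 fun C _ => hG.norm.restrict C)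
        (ηi i).continuous.aestronglyMeasurable hB hR
    have m2 : MemLp (fun x => w x * fderiv ℝ (fun y => fderiv ℝ η y (b i)) x x) 2 volume :=
      (hw.const_mul B').mono (hw.1.mul (ηi i).continuous_fderiv_self.aestronglyMeasurable)
        (.of_forall fun x => by
          rw [norm_mul, norm_mul, mul_comm, Real.norm_of_nonneg hB0]
          exact mul_le_mul_of_nonneg_right (hB' x) (norm_nonneg _))
    have e : ∀ x, inner ℝ (fderiv ℝ η x (b i) • G x + w x •
        gradient (fun y => fderiv ℝ η y (b i)) x) x = fderiv ℝ η x (b i) * inner ℝ (G x) x +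
          w x * fderiv ℝ (fun y => fderiv ℝ η y (b i)) x x := fun x => by
      rw [inner_add_left, real_inner_smul_left, real_inner_smul_left, inner_gradient_left]
    have := (wi i).hasDerivAt_integral (r := 2) (r' := 2) (by norm_num) (hGi i) (wi2 i)
      ((m1.add m2).ae_eq (.of_forall fun x => (e x).symm))
    simp only [e] at this
    exact this
  refine (HasDerivAt.fun_sum (u := Finset.univ) fun i _ => D i).congr_of_eventuallyEq ?_
  filter_upwards [lt_mem_nhds (zero_lt_one (α := ℝ))] with l hl
  rw [← integral_finsetSum _ fun i _ => ?_]
  · congr 1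
    ext x
    rw [real_inner_smul_left, inner_gradient_left]
    conv_lhs => rw [← b.sum_repr (G x)]
    rw [map_sum, Finset.mul_sum]
    refine Finset.sum_congr rfl fun i _ => ?_
    rw [map_smul, smul_eq_mul, hb, EuclideanSpace.basisFun_repr]
    ring
  · exact integrable_mul_of_memLp (r := 2) (r' := 2) (hGi i) (memLp_comp_smul (wi2 i) hl.ne')

/-- First order condition at `l = 1` for the dilation inequality. -/
lemma dilation_first_order {N : ℕ} {q : ℝ} {X₁ X₂ X₃ T B E : ℝ → ℝ} {x₁ x₂ x₃ t b e : ℝ}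
    (h₁ : HasDerivAt X₁ x₁ 1) (h₂ : HasDerivAt X₂ x₂ 1) (h₃ : HasDerivAt X₃ x₃ 1)
    (hT : HasDerivAt T t 1) (hB : HasDerivAt B b 1) (hE : HasDerivAt E e 1)
    (h : ∀ l : ℝ, 0 < l → 0 ≤ 1 / 2 * (l ^ 2 * (l ^ N)⁻¹ * X₁ l - X₁ 1) +
      1 / 2 * ((l ^ N)⁻¹ * X₂ l - X₂ 1) +
      1 / q * (1 / 2 * (l ^ 1)⁻¹ * X₃ 1 + 1 / 2 * (l ^ (N + 1))⁻¹ * X₃ l - X₃ 1 +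
        ((l ^ (N + 1))⁻¹ * T l⁻¹ - T 1)) + (B l - B 1) - (E l - E 1)) :
    1 / 2 * (-(N - 2) * X₁ 1 + x₁) + 1 / 2 * (-N * X₂ 1 + x₂) +
      1 / q * (1 / 2 * (-(N + 2) * X₃ 1 + x₃) - (N + 1) * T 1 - t) + b = e := by
  have hT' : HasDerivAt (fun l : ℝ => T l⁻¹) (-t) 1 := by
    have hT1 : HasDerivAt T t (1 : ℝ)⁻¹ := by rwa [inv_one]
    exact (hT1.comp (1 : ℝ) (hasDerivAt_inv one_ne_zero)).congr_deriv (by norm_num)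
  have p₁ := ((((hasDerivAt_pow 2 (1 : ℝ)).fun_mul (hasDerivAt_inv_pow N)).fun_mul h₁).sub_const
    (X₁ 1)).const_mul (1 / 2)
  have p₂ := (((hasDerivAt_inv_pow N).fun_mul h₂).sub_const (X₂ 1)).const_mul (1 / 2)
  have p₃ := ((((((hasDerivAt_inv_pow 1).const_mul (1 / 2)).mul_const (X₃ 1)).fun_add
    (((hasDerivAt_inv_pow (N + 1)).const_mul (1 / 2)).fun_mul h₃)).sub_const (X₃ 1)).fun_add
    (((hasDerivAt_inv_pow (N + 1)).fun_mul hT').sub_const (T 1))).const_mul (1 / q)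
  have D := (((p₁.fun_add p₂).fun_add p₃).fun_add (hB.sub_const (B 1))).fun_sub
    (hE.sub_const (E 1))
  -- The bracket vanishes at l = 1 and is nonnegative for l > 0, so l = 1 is a minimum. `T` enters
  -- through l⁻¹, hence the sign of t.
  have hz := IsLocalMin.hasDerivAt_eq_zero (by
    filter_upwards [lt_mem_nhds (zero_lt_one (α := ℝ))] with l hl
    refine le_trans (le_of_eq ?_) (h l hl)
    simp only [one_pow, inv_one]
    ring) D
  simp only [one_pow, inv_one, Nat.cast_ofNat, Nat.cast_add, Nat.cast_one] at hz
  linear_combination hz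

namespace Solution

variable {α p q K : ℝ} {u φ : E N → ℝ} {Du Dφ : E N → E N}

/-- The localised Pohozaev identity. -/
lemma local_pohozaev (S : Solution N α p q K u φ Du Dφ) {η : E N → ℝ}
    (hη : IsTest η) (h0 : ∀ x, 0 ≤ η x) :
    1 / 2 * (-(N - 2) * (∫ x, ‖Du x‖ ^ 2 * η x) - ∫ x, ‖Du x‖ ^ 2 * fderiv ℝ η x x) +
      1 / 2 * (-N * (∫ x, ‖u x‖ ^ 2 * η x) - ∫ x, ‖u x‖ ^ 2 * fderiv ℝ η x x) +
      1 / q * (1 / 2 * (-(N + 2) * (∫ x, ‖Dφ x‖ ^ 2 * η x) - ∫ x, ‖Dφ x‖ ^ 2 * fderiv ℝ η x x) -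
        (N + 1) * (∫ x, inner ℝ (φ x • gradient η x) (Dφ x)) -
        ∑ i : Fin N, ∫ x, Dφ x i *
          (fderiv ℝ η x (EuclideanSpace.basisFun (Fin N) ℝ i) * inner ℝ (Dφ x) x +
          φ x * fderiv ℝ (fun y => fderiv ℝ η y (EuclideanSpace.basisFun (Fin N) ℝ i)) x x)) +
      (∫ x, fderiv ℝ η x (Du x) * inner ℝ (Du x) x) =
    ∫ x, rieszConv α (fun y => |u y| ^ p) x *
        (η x * (|u x| ^ (p - 2) * u x) * inner ℝ (Du x) x) := by
  have hq := S.hq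
  have := S.holder_sigma
  obtain ⟨R, hR0, hR⟩ := hη.exists_radius
  have hgR : ∀ x, 2 * R < ‖x‖ → fderiv ℝ η x = 0 := fun x hx => by
    have : η =ᶠ[𝓝 x] fun _ => 0 := by
      filter_upwards [(isOpen_lt continuous_const continuous_norm).mem_nhds
        (show R < ‖x‖ by linarith)] with y hy using hR y hy
    rw [this.fderiv_eq, fderiv_const_apply]
  set c : E N → ℝ := fun x => rieszConv α (fun y => |u y| ^ p) x * (|u x| ^ (p - 2) * u x) with hc
  have hk : MemLp (fun x => η x * c x)
      (ENNReal.ofReal (2 * N * p / (N + α)).conjExponent) volume := hη.memLp_mul S.memLp_choquard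
  have hk2 : MemLp (fun x => fderiv ℝ η x (Du x)) 2 volume := by
    have hcg := hη.1.continuous_fderiv (by simp)
    obtain ⟨B, hB⟩ := (hη.2.fderiv ℝ).exists_bound_of_continuous hcg
    refine (S.Du2.norm.const_mul B).mono ?_ (.of_forall fun x => ?_)
    · have := (contDiff_gradient hη.1).continuous.aestronglyMeasurable.inner (𝕜 := ℝ) S.Du2.1
        (μ := volume)
      simpa only [inner_gradient_left] using this
    · rw [norm_mul, norm_norm, Real.norm_of_nonneg ((norm_nonneg _).trans (hB 0))]
      exact (ContinuousLinearMap.le_opNorm _ _).trans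
        (mul_le_mul_of_nonneg_right (hB x) (norm_nonneg _))
  have dE := S.wu.hasDerivAt_integral_of_support ENNReal.ofReal_ne_top hk S.uσ S.Duσ hR0
    (fun x hx => by rw [hR x hx, zero_mul])
  have dB := S.wu.hasDerivAt_integral_of_support (r := 2) (r' := 2) (by norm_num) hk2 S.u2
    (fun C _ => S.Du2.norm.restrict C) (R := 2 * R) (by positivity)
    (fun x hx => by rw [hgR x hx]; simp)
  have d1 := hasDerivAt_integral_comp_inv_smul (integrable_normSq S.Du2).locallyIntegrable hη
  have d2 := hasDerivAt_integral_comp_inv_smul (integrable_normSq S.u2).locallyIntegrable hη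
  have d3 := hasDerivAt_integral_comp_inv_smul (integrable_normSq S.Dφ2).locallyIntegrable hη
  have d4 := S.wφ.hasDerivAt_integral_gradient S.φ2 S.Dφ2 hη
  have main := dilation_first_order (N := N) (q := q) d1 d2 d3 d4 dB dE fun l hl => by
    have hl' : 0 < l⁻¹ := by positivity
    simp only [inv_one, one_smul]
    -- The test function η(u(l·) - u) stands in for η x·∇u.
    have w := ((S.wu.comp_smul hl).sub S.wu).contDiff_mul hη.1
    have m2 := (memLp_comp_smul S.u2 hl.ne').sub S.u2
    have mG := ((memLp_comp_smul S.Du2 hl.ne').const_smul l).sub S.Du2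
    have g1 : MemLp (fun x => η x • (l • Du (l • x) - Du x)) 2 volume := hη.memLp_mul mG
    have g2 : MemLp (fun x => (u (l • x) - u x) • gradient η x) 2 volume :=
      hη.memLp_smul_gradient m2
    have e := S.eq₁_ext w (hη.memLp_mul m2) (g1.add g2)
      (hη.memLp_mul ((memLp_comp_smul S.uσ hl.ne').sub S.uσ))
      (hη.memLp_mul ((memLp_comp_smul S.uτ hl.ne').sub S.uτ))
    have e1 : ∫ x, inner ℝ (η x • (l • Du (l • x) - Du x) + (u (l • x) - u x) • gradient η x)
        (Du x) = (∫ x, inner ℝ (η x • (l • Du (l • x) - Du x)) (Du x)) +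
          ((∫ x, fderiv ℝ η x (Du x) * u (l • x)) - ∫ x, fderiv ℝ η x (Du x) * u x) := by
      have i1 := integrable_mul_of_memLp (r := 2) (r' := 2) hk2 (memLp_comp_smul S.u2 hl.ne')
      have i2 := integrable_mul_of_memLp (r := 2) (r' := 2) hk2 S.u2
      have i12 : Integrable fun x => fderiv ℝ η x (Du x) * u (l • x) - fderiv ℝ η x (Du x) * u x :=
        i1.sub i2
      rw [← integral_sub i1 i2, ← integral_add (integrable_inner g1 S.Du2) i12]
      congr 1
      ext x
      rw [inner_add_left, real_inner_smul_left (gradient η x), inner_gradient_left]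
      ring
    have e2 : ∫ x, c x * (η x * (u (l • x) - u x)) =
        (∫ x, η x * c x * u (l • x)) - ∫ x, η x * c x * u x := by
      rw [← integral_sub (integrable_mul_of_memLp hk (memLp_comp_smul S.uσ hl.ne'))
        (integrable_mul_of_memLp hk S.uσ)]
      congr 1
      ext x
      ring
    -- Upper bounds for the gradient, mass and coupling terms, each sharp at l = 1. The ∇η and
    -- Choquard terms are linear in u(l·) and need no estimate. The scaling factor is l for Du and 1
    -- for u.
    have q1 := integral_inner_dilation_le S.Du2 hη h0 hl l
    have q2 := integral_inner_dilation_le S.u2 hη h0 hl 1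
    have q3 := S.integral_coupling_dilation_le hη h0 hl
    have e3 : ∫ x, inner ℝ (η x • ((1 : ℝ) • u (l • x) - u x)) (u x) =
        ∫ x, u x * (η x * (u (l • x) - u x)) := by
      congr 1
      ext x
      simp [RCLike.inner_apply]
    rw [e1, e2] at e
    rw [e3] at q2
    simp only [one_pow, one_mul] at q2
    linarith
  simp only [inv_one, one_smul] at main
  have e4 : ∫ x, rieszConv α (fun y => |u y| ^ p) x *
      (η x * (|u x| ^ (p - 2) * u x) * inner ℝ (Du x) x) = ∫ x, η x * c x * inner ℝ (Du x) x := by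
    congr 1
    ext x
    simp only [hc]
    ring
  rw [e4, ← main]
  ring

end Solution

/-! ### Removing the cutoff: the global Pohozaev identity -/

lemma tendsto_integral_mul_of_bounded {X : Type*} [MeasurableSpace X] {μ : Measure X} {g : X → ℝ}
    (hg : Integrable g μ) {m : ℕ → X → ℝ} {m' : X → ℝ} (hm : ∀ n, AEStronglyMeasurable (m n) μ)
    {C : ℝ} (hC : ∀ n x, |m n x| ≤ C) (h : ∀ x, Tendsto (fun n => m n x) atTop (𝓝 (m' x))) :
    Tendsto (fun n => ∫ x, g x * m n x ∂μ) atTop (𝓝 (∫ x, g x * m' x ∂μ)) := by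
  refine tendsto_integral_of_dominated_convergence _ (fun n => hg.1.mul (hm n))
    (hg.norm.mul_const C) (fun n => .of_forall fun x => ?_)
    (.of_forall fun x => tendsto_const_nhds.mul (h x))
  rw [norm_mul]
  exact mul_le_mul_of_nonneg_left (hC n x) (norm_nonneg _)

lemma tendsto_cutoff (x : E N) : Tendsto (fun n : ℕ => cutoff N (n + 1) x) atTop (𝓝 1) := by
  refine tendsto_const_nhds.congr' ?_
  filter_upwards [tendsto_natCast_atTop_atTop.eventually_ge_atTop ‖x‖] with n hn
  rw [cutoff_eq_one (by positivity) (by linarith)]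

lemma eventually_fderiv_cutoff_eq_zero (x : E N) :
    ∀ᶠ n : ℕ in atTop, fderiv ℝ (cutoff N (n + 1)) x = 0 := by
  filter_upwards [tendsto_natCast_atTop_atTop.eventually_ge_atTop ‖x‖] with n hn
  exact fderiv_cutoff_eq_zero (by positivity) (by linarith)

/-- The gradient is O(1/R) and supported in |x| ≤ 2R, so the product is bounded uniformly in R. -/
lemma exists_norm_fderiv_cutoff_mul_le (N : ℕ) : ∃ C : ℝ, 0 ≤ C ∧ ∀ R : ℝ, 0 < R → ∀ x : E N,
    ‖fderiv ℝ (cutoff N R) x‖ * ‖x‖ ≤ C := by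
  obtain ⟨C, hC0, hC⟩ := exists_fderiv_cutoff_le N
  refine ⟨2 * C, by positivity, fun R hR x => ?_⟩
  rcases le_or_gt ‖x‖ (2 * R) with hx | hx
  · calc _ ≤ C / R * (2 * R) := mul_le_mul (hC R hR x) hx (norm_nonneg _) (by positivity)
      _ = 2 * C := by field_simp
  · rw [fderiv_cutoff_eq_zero_of_lt hR hx, norm_zero, zero_mul]
    positivity

/-- The field x ↦ χ_R(x)x has derivative χ_R·id + x⊗∇χ_R, bounded by 1 + C uniformly in R, so it is
Lipschitz with that constant. -/
lemma exists_inner_cutoff_smul_sub_le (N : ℕ) : ∃ L : ℝ, ∀ R : ℝ, 0 < R → ∀ x y : E N,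
    |inner ℝ (x - y) (cutoff N R x • x - cutoff N R y • y)| ≤ L * ‖x - y‖ ^ 2 := by
  obtain ⟨C, hC0, hC⟩ := exists_norm_fderiv_cutoff_mul_le N
  refine ⟨1 + C, fun R hR x y => ?_⟩
  have hd := (isTest_cutoff (N := N) hR).differentiable
  have h := Convex.norm_image_sub_le_of_norm_hasFDerivWithin_le (𝕜 := ℝ) (s := univ)
    (f := fun x : E N => cutoff N R x • x) (C := 1 + C) (x := y) (y := x)
    (fun z _ => ((hd z).hasFDerivAt.smul (hasFDerivAt_id z)).hasFDerivWithinAt) (fun z _ => by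
      refine (norm_add_le _ _).trans (add_le_add ?_ ?_)
      · rw [norm_smul, Real.norm_of_nonneg (cutoff_nonneg _ _)]
        exact (mul_le_of_le_one_left (norm_nonneg _) (cutoff_le_one _ _)).trans
          ContinuousLinearMap.norm_id_le
      · exact (ContinuousLinearMap.norm_smulRight_apply _ _).le.trans (hC R hR z))
    convex_univ (mem_univ _) (mem_univ _)
  refine (abs_real_inner_le_norm _ _).trans ?_
  rw [sq, mul_comm, ← mul_assoc]
  exact mul_le_mul_of_nonneg_right h (norm_nonneg _)

lemma exists_fderiv_fderiv_cutoff_le (N : ℕ) (v : E N) : ∃ C : ℝ, 0 ≤ C ∧ ∀ R : ℝ, 0 < R →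
    ∀ x : E N, |fderiv ℝ (fun y => fderiv ℝ (cutoff N R) y v) x x| ≤ C / R := by
  have hχ : IsTest (unitBump N) := ⟨(unitBump N).contDiff, (unitBump N).hasCompactSupport⟩
  have h := hχ.fderiv_apply v
  obtain ⟨C, hC⟩ := h.hasCompactSupport_fderiv_self.exists_bound_of_continuous
    h.continuous_fderiv_self
  refine ⟨C, (norm_nonneg _).trans (hC 0), fun R hR x => ?_⟩
  simp only [fderiv_cutoff]
  rw [fderiv_const_mul ((h.comp_smul (inv_ne_zero hR.ne')).differentiable x)]
  rw [smul_apply, fderiv_comp_const_smul h.differentiable, ← smul_eq_mul R⁻¹ (fderiv _ _ _ x),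
    ← map_smul, smul_eq_mul, abs_mul, abs_of_pos (inv_pos.2 hR), inv_mul_eq_div]
  exact div_le_div_of_nonneg_right (hC _) hR.le

namespace Solution

variable {α p q K : ℝ} {u φ : E N → ℝ} {Du Dφ : E N → E N}

/-- As χ_R → 1 the symmetrised factor tends to N - (N-α)/2 = (N+α)/2 off the diagonal, and the
uniform Lipschitz constant dominates it. -/
lemma tendsto_integral_choquard (S : Solution N α p q K u φ Du Dφ) :
    Tendsto (fun n : ℕ => ∫ x, rieszConv α (fun y => |u y| ^ p) x *
        (cutoff N (n + 1) x * (|u x| ^ (p - 2) * u x) * inner ℝ (Du x) x)) atTop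
      (𝓝 (-(1 / p) * ((∫ x, rieszConv α (fun y => |u y| ^ p) x * |u x| ^ p) *
        ((N + α) / 2)))) := by
  have hα := S.hα
  have hαN := S.hαN
  obtain ⟨L, hL⟩ := exists_inner_cutoff_smul_sub_le N
  obtain ⟨C, hC0, hC⟩ := exists_norm_fderiv_cutoff_mul_le N
  have hn : ∀ n : ℕ, (0 : ℝ) < n + 1 := fun n => by positivity
  have hL0 := S.lipschitz_const_nonneg (hL 1 one_pos)
  have ir := integrable_riesz_prod hα hαN S.memLp_up S.memLp_up
  have e : ∫ x, rieszConv α (fun y => |u y| ^ p) x * |u x| ^ p =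
      ∫ z : E N × E N, riesz N α (z.1 - z.2) * |u z.2| ^ p * |u z.1| ^ p
        ∂(volume.prod volume) := by
    rw [integral_prod _ ir]
    simp only [integral_mul_const]
    rfl
  rw [e, ← integral_mul_const]
  have hN1 : 1 ≤ N := by linarith [S.hN]
  have ed : ∫ z : E N × E N, riesz N α (z.1 - z.2) * |u z.2| ^ p * |u z.1| ^ p * ((N + α) / 2)
        ∂(volume.prod volume) =
      ∫ z : E N × E N, riesz N α (z.1 - z.2) * |u z.2| ^ p * |u z.1| ^ p *
        (N * 1 + 0 - (N - α) / 2 * (inner ℝ (z.1 - z.2) ((1 : ℝ) • z.1 - (1 : ℝ) • z.2) /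
          ‖z.1 - z.2‖ ^ 2)) ∂(volume.prod volume) := by
    refine integral_congr_ae ?_
    filter_upwards [volume_diagonal hN1] with z hz
    have : 0 < ‖z.1 - z.2‖ := norm_pos_iff.2 hz
    rw [one_smul, one_smul, real_inner_self_eq_norm_sq, div_self (by positivity)]
    ring
  rw [ed]
  refine ((tendsto_integral_mul_of_bounded ir (C := N + C + (N - α) / 2 * L) (fun n => ?_)
    (fun n z => ?_) (fun z => ?_)).const_mul (-(1 / p))).congr fun n =>
      (S.integral_choquard_dilation (isTest_cutoff (hn n)) (cutoff_nonneg _) (hL _ (hn n))).symm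
  · have hη := isTest_cutoff (N := N) (hn n)
    have hηc := hη.continuous
    refine (((continuous_const.mul (hηc.comp continuous_fst)).add
      (hη.continuous_fderiv_self.comp continuous_fst)).aestronglyMeasurable).sub
        (aestronglyMeasurable_const.mul ?_)
    refine AEStronglyMeasurable.div₀ (Continuous.aestronglyMeasurable ?_)
      (Continuous.aestronglyMeasurable ?_)
    · fun_prop
    · fun_prop
  · refine (abs_sub _ _).trans (add_le_add ((abs_add_le _ _).trans (add_le_add ?_ ?_)) ?_)
    · rw [abs_of_nonneg (mul_nonneg (Nat.cast_nonneg N) (cutoff_nonneg _ _))]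
      exact mul_le_of_le_one_right (Nat.cast_nonneg N) (cutoff_le_one _ _)
    · exact (ContinuousLinearMap.le_opNorm _ _).trans (hC _ (hn n) _)
    · rw [abs_mul, abs_of_nonneg (by linarith : 0 ≤ (N - α) / 2)]
      refine mul_le_mul_of_nonneg_left ?_ (by linarith)
      rw [abs_div, abs_of_nonneg (sq_nonneg ‖z.1 - z.2‖)]
      exact div_le_of_le_mul₀ (sq_nonneg _) hL0 (hL _ (hn n) _ _)
  · refine ((tendsto_const_nhds.mul (tendsto_cutoff _)).add ?_).sub (tendsto_const_nhds.mul
      (Tendsto.div_const (tendsto_const_nhds.inner (((tendsto_cutoff _).smul_const _).sub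
        ((tendsto_cutoff _).smul_const _))) _))
    refine tendsto_const_nhds.congr' ?_
    filter_upwards [eventually_fderiv_cutoff_eq_zero z.1] with n hn
    simp [hn]

/-- The Pohozaev identity. -/
lemma pohozaev (S : Solution N α p q K u φ Du Dφ) :
    (N - 2) / 2 * (∫ x, ‖Du x‖ ^ 2) + N / 2 * (∫ x, u x ^ 2) +
      (N + 2) / (2 * q) * (∫ x, ‖Dφ x‖ ^ 2) =
    (N + α) / (2 * p) * ∫ x, rieszConv α (fun y => |u y| ^ p) x * |u x| ^ p := by
  obtain ⟨C, hC0, hC⟩ := exists_norm_fderiv_cutoff_mul_le N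
  obtain ⟨C', hC0', hC'⟩ := exists_fderiv_cutoff_le N
  have hn : ∀ n : ℕ, (0 : ℝ) < n + 1 := fun n => by positivity
  have hη : ∀ n : ℕ, IsTest (cutoff N (n + 1)) := fun n => isTest_cutoff (hn n)
  have hfx : ∀ (n : ℕ) (x : E N), |fderiv ℝ (cutoff N (n + 1)) x x| ≤ C := fun n x =>
    (ContinuousLinearMap.le_opNorm _ _).trans (hC _ (hn n) _)
  have hdiv : ∀ c : ℝ, Tendsto (fun n : ℕ => c / ((n : ℝ) + 1)) atTop (𝓝 0) := fun c =>
    tendsto_const_div_atTop_nhds_zero_nat c |>.comp (tendsto_add_atTop_nat 1) |>.congr fun n => by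
      simp
  have hle : ∀ (c : ℝ) (n : ℕ), 0 ≤ c → c / ((n : ℝ) + 1) ≤ c := fun c n hc =>
    div_le_self hc (by linarith [Nat.cast_nonneg (α := ℝ) n])
  have t1 : ∀ {g : E N → ℝ}, Integrable g →
      Tendsto (fun n : ℕ => ∫ x, g x * cutoff N (n + 1) x) atTop (𝓝 (∫ x, g x)) := fun {g} hg => by
    have := tendsto_integral_mul_of_bounded hg (m := fun n : ℕ => cutoff N (n + 1))
      (fun n => (hη n).continuous.aestronglyMeasurable) (C := 1) (fun n x => by
        rw [abs_of_nonneg (cutoff_nonneg _ _)]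
        exact cutoff_le_one _ _) (m' := fun _ => 1) tendsto_cutoff
    simpa only [mul_one] using this
  have t2 : ∀ {g : E N → ℝ}, Integrable g → Tendsto
      (fun n : ℕ => ∫ x, g x * fderiv ℝ (cutoff N (n + 1)) x x) atTop (𝓝 0) := fun {g} hg => by
    have := tendsto_integral_mul_of_bounded hg (m := fun (n : ℕ) x => fderiv ℝ (cutoff N (n + 1)) x x)
      (fun n => (hη n).continuous_fderiv_self.aestronglyMeasurable) hfx (m' := fun _ => 0)
      fun x => by
        refine tendsto_const_nhds.congr' ?_
        filter_upwards [eventually_fderiv_cutoff_eq_zero x] with n hn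
        simp [hn]
    simpa only [mul_zero, integral_zero] using this
  have hgm : ∀ n : ℕ, AEStronglyMeasurable (gradient (cutoff N (n + 1))) volume := fun n =>
    (contDiff_gradient (hη n).1).continuous.aestronglyMeasurable
  -- This is where φ ∈ L² enters: it dominates the terms in which derivatives of the cutoff fall
  -- next to φ.
  have iφ : Integrable fun x => ‖Dφ x‖ * |φ x| :=
    integrable_mul_of_memLp (r := 2) (r' := 2) S.Dφ2.norm S.φ2.norm
  have t3 : Tendsto (fun n : ℕ => ∫ x, inner ℝ (φ x • gradient (cutoff N (n + 1)) x) (Dφ x)) atTop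
      (𝓝 0) := by
    have := tendsto_integral_of_dominated_convergence (μ := volume)
      (F := fun (n : ℕ) x => inner ℝ (φ x • gradient (cutoff N (n + 1)) x) (Dφ x))
      (f := fun _ => (0 : ℝ)) (fun x => C' * (‖Dφ x‖ * |φ x|))
      (fun n => (S.φ2.1.smul (hgm n)).inner S.Dφ2.1) (iφ.const_mul C')
      (fun n => .of_forall fun x => by
        refine (norm_inner_le_norm _ _).trans ?_
        rw [norm_smul, norm_gradient, Real.norm_eq_abs]
        have := (hC' _ (hn n) x).trans (hle C' n hC0')
        calc _ = (|φ x| * ‖Dφ x‖) * ‖fderiv ℝ (cutoff N (n + 1)) x‖ := by ring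
          _ ≤ (|φ x| * ‖Dφ x‖) * C' := mul_le_mul_of_nonneg_left this (by positivity)
          _ = _ := by ring)
      (.of_forall fun x => by
        refine tendsto_const_nhds.congr' ?_
        filter_upwards [eventually_fderiv_cutoff_eq_zero x] with n hn
        simp [real_inner_smul_left, inner_gradient_left, hn])
    simpa only [integral_zero] using this
  have t4 : ∀ i : Fin N, Tendsto (fun n : ℕ => ∫ x, Dφ x i *
          (fderiv ℝ (cutoff N (n + 1)) x (EuclideanSpace.basisFun (Fin N) ℝ i) * inner ℝ (Dφ x) x +
          φ x * fderiv ℝ (fun y => fderiv ℝ (cutoff N (n + 1)) y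
            (EuclideanSpace.basisFun (Fin N) ℝ i)) x x)) atTop (𝓝 0) := fun i => by
    set b := EuclideanSpace.basisFun (Fin N) ℝ i with hb
    have hbn : ‖b‖ = 1 := (EuclideanSpace.basisFun (Fin N) ℝ).norm_eq_one i
    obtain ⟨M, hM0, hM⟩ := exists_fderiv_fderiv_cutoff_le N b
    have mi : AEStronglyMeasurable (fun x => Dφ x i) volume :=
      (EuclideanSpace.proj (𝕜 := ℝ) i).continuous.comp_aestronglyMeasurable S.Dφ2.1
    have := tendsto_integral_of_dominated_convergence (μ := volume)
      (F := fun (n : ℕ) x => Dφ x i *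
          (fderiv ℝ (cutoff N (n + 1)) x b * inner ℝ (Dφ x) x +
          φ x * fderiv ℝ (fun y => fderiv ℝ (cutoff N (n + 1)) y b) x x))
      (f := fun _ => (0 : ℝ)) (fun x => C * ‖Dφ x‖ ^ 2 + M * (‖Dφ x‖ * |φ x|))
      (fun n => mi.mul ((((hη n).fderiv_apply b).continuous.aestronglyMeasurable.mul
        (S.Dφ2.1.inner aestronglyMeasurable_id)).add (S.φ2.1.mul
          ((hη n).fderiv_apply b).continuous_fderiv_self.aestronglyMeasurable)))
      (((integrable_normSq S.Dφ2).const_mul C).add (iφ.const_mul M))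
      (fun n => .of_forall fun x => by
        have h1 : ‖Dφ x i‖ ≤ ‖Dφ x‖ := PiLp.norm_apply_le _ _
        have h2 : ‖fderiv ℝ (cutoff N (n + 1)) x b * inner ℝ (Dφ x) x‖ ≤ C * ‖Dφ x‖ := by
          rw [norm_mul]
          have a1 := ContinuousLinearMap.le_opNorm (fderiv ℝ (cutoff N (n + 1)) x) b
          rw [hbn, mul_one] at a1
          calc _ ≤ ‖fderiv ℝ (cutoff N (n + 1)) x‖ * (‖Dφ x‖ * ‖x‖) :=
                mul_le_mul a1 (norm_inner_le_norm _ _) (norm_nonneg _) (norm_nonneg _)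
            _ = ‖fderiv ℝ (cutoff N (n + 1)) x‖ * ‖x‖ * ‖Dφ x‖ := by ring
            _ ≤ _ := mul_le_mul_of_nonneg_right (hC _ (hn n) x) (norm_nonneg _)
        have h3 : ‖φ x * fderiv ℝ (fun y => fderiv ℝ (cutoff N (n + 1)) y b) x x‖ ≤ M * |φ x| := by
          rw [norm_mul, mul_comm]
          exact mul_le_mul_of_nonneg_right ((hM _ (hn n) x).trans (hle M n hM0)) (norm_nonneg _)
        rw [norm_mul]
        calc _ ≤ ‖Dφ x‖ * (C * ‖Dφ x‖ + M * |φ x|) := mul_le_mul h1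
              ((norm_add_le _ _).trans (add_le_add h2 h3)) (norm_nonneg _) (norm_nonneg _)
          _ = _ := by ring)
      (.of_forall fun x => by
        have a1 : Tendsto (fun n : ℕ => fderiv ℝ (cutoff N (n + 1)) x b) atTop (𝓝 0) := by
          refine tendsto_const_nhds.congr' ?_
          filter_upwards [eventually_fderiv_cutoff_eq_zero x] with n hn
          simp [hn]
        have a2 : Tendsto (fun n : ℕ => fderiv ℝ (fun y => fderiv ℝ (cutoff N (n + 1)) y b) x x)
          atTop (𝓝 0) := squeeze_zero_norm (fun n => hM _ (hn n) x) (hdiv M)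
        simpa using ((a1.mul_const _).add (a2.const_mul (φ x))).const_mul (Dφ x i))
    simpa only [integral_zero] using this
  have t5 : Tendsto (fun n : ℕ => ∫ x, fderiv ℝ (cutoff N (n + 1)) x (Du x) * inner ℝ (Du x) x)
      atTop (𝓝 0) := by
    have := tendsto_integral_of_dominated_convergence (μ := volume)
      (F := fun (n : ℕ) x => fderiv ℝ (cutoff N (n + 1)) x (Du x) * inner ℝ (Du x) x)
      (f := fun _ => (0 : ℝ)) (fun x => C * ‖Du x‖ ^ 2)
      (fun n => by
        have := (hgm n).inner (𝕜 := ℝ) S.Du2.1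
        simp only [inner_gradient_left] at this
        exact this.mul (S.Du2.1.inner aestronglyMeasurable_id)) ((integrable_normSq S.Du2).const_mul C)
      (fun n => .of_forall fun x => by
        rw [norm_mul]
        calc _ ≤ ‖fderiv ℝ (cutoff N (n + 1)) x‖ * ‖Du x‖ * (‖Du x‖ * ‖x‖) :=
              mul_le_mul (ContinuousLinearMap.le_opNorm _ _) (norm_inner_le_norm _ _)
                (norm_nonneg _) (by positivity)
          _ = ‖fderiv ℝ (cutoff N (n + 1)) x‖ * ‖x‖ * ‖Du x‖ ^ 2 := by ring
          _ ≤ _ := mul_le_mul_of_nonneg_right (hC _ (hn n) x) (by positivity))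
      (.of_forall fun x => by
        refine tendsto_const_nhds.congr' ?_
        filter_upwards [eventually_fderiv_cutoff_eq_zero x] with n hn
        simp [hn])
    simpa only [integral_zero] using this
  have iA := integrable_normSq S.Du2
  have iB := integrable_normSq S.u2
  have iD := integrable_normSq S.Dφ2
  have lim := ((((((t1 iA).const_mul (-((N : ℝ) - 2))).sub (t2 iA)).const_mul (1 / 2)).add
    ((((t1 iB).const_mul (-(N : ℝ))).sub (t2 iB)).const_mul (1 / 2))).add
    ((((((t1 iD).const_mul (-((N : ℝ) + 2))).sub (t2 iD)).const_mul (1 / 2)).sub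
      (t3.const_mul ((N : ℝ) + 1))).sub (tendsto_finsetSum Finset.univ fun i _ => t4 i)
        |>.const_mul (1 / q))).add t5
  -- In the limit only the terms weighted by χ itself survive; every term containing a derivative of
  -- χ tends to zero.
  have h := tendsto_nhds_unique (lim.congr fun n =>
    S.local_pohozaev (hη n) (cutoff_nonneg _)) S.tendsto_integral_choquard
  simp only [Real.norm_eq_abs, sq_abs, Finset.sum_const_zero] at h
  have hp : p ≠ 0 := by linarith [S.hp]
  have hq : q ≠ 0 := by linarith [S.hq]
  have e1 : (N + α) / (2 * p) = 1 / p * ((N + α) / 2) := by field_simp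
  have e2 : ((N : ℝ) + 2) / (2 * q) = 1 / q * ((N + 2) / 2) := by field_simp
  rw [e1, e2]
  linarith

end Solution

/-! ### Conclusion: combining the two identities -/

namespace Solution

variable {α p q K : ℝ} {u φ : E N → ℝ} {Du Dφ : E N → E N}

lemma ae_eq_zero_of_integral_norm_sq {F : Type*} [NormedAddCommGroup F] {G : E N → F}
    (hG : MemLp G 2 volume) (h : ∫ x, ‖G x‖ ^ 2 = 0) : G =ᵐ[volume] 0 := by
  filter_upwards [(integral_eq_zero_iff_of_nonneg (fun x => sq_nonneg ‖G x‖)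
    (integrable_normSq hG)).1 h] with x hx
  simpa using hx

/-- Eliminating the Choquard integral gives (N-2-a)A + (N-a)B + (b-a)D = 0, and each condition on
the exponents gives all coefficients the same weak sign. -/
lemma u_eq_zero (S : Solution N α p q K u φ Du Dφ)
    (hcond : (((N : ℝ) + α) / ((N : ℝ) - 2) ≤ p ∧ ((N : ℝ) + α) / p ≤ ((N : ℝ) + 2) / q) ∨
      (p ≤ ((N : ℝ) + α) / (N : ℝ) ∧ ((N : ℝ) + 2) / q < ((N : ℝ) + α) / p)) :
    u =ᵐ[volume] 0 := by
  have h3 := S.three_le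
  have hα := S.hα
  have hp : 0 < p := by linarith [S.hp]
  have hq : 0 < q := by linarith [S.hq]
  have hn := S.nehari
  have hP := S.pohozaev
  rw [← hn] at hP
  have e1 : ((N : ℝ) + α) / (2 * p) = (N + α) / p / 2 := by field_simp
  have e2 : ((N : ℝ) + 2) / (2 * q) = (N + 2) / q / 2 := by field_simp
  rw [e1, e2] at hP
  set a := ((N : ℝ) + α) / p
  set b := ((N : ℝ) + 2) / q
  have hA : 0 ≤ ∫ x, ‖Du x‖ ^ 2 := integral_nonneg fun x => sq_nonneg _
  have hB : 0 ≤ ∫ x, u x ^ 2 := integral_nonneg fun x => sq_nonneg _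
  have hD : 0 ≤ ∫ x, ‖Dφ x‖ ^ 2 := integral_nonneg fun x => sq_nonneg _
  rcases hcond with ⟨h1, h2⟩ | ⟨h1, h2⟩
  · have ha : a ≤ N - 2 := by
      rw [div_le_iff₀ (by linarith)] at h1
      rw [div_le_iff₀ hp]
      linarith
    refine ae_eq_zero_of_integral_norm_sq S.u2 ?_
    simp only [Real.norm_eq_abs, sq_abs]
    -- The relation reads (N-2-a)A + (N-2-a)B + 2B + (b-a)D = 0 with nonnegative summands, so B = 0.
    nlinarith [mul_nonneg (sub_nonneg.2 ha) hA, mul_nonneg (sub_nonneg.2 ha) hB,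
      mul_nonneg (sub_nonneg.2 h2) hD]
  · have ha : N ≤ a := by
      rw [le_div_iff₀ (by linarith)] at h1
      rw [le_div_iff₀ hp]
      linarith
    refine S.wu.eq_zero S.hN S.u2 (ae_eq_zero_of_integral_norm_sq S.Du2 ?_)
    -- Here 2A + (a-N)A + (a-N)B + (a-b)D = 0, so A = 0.
    nlinarith [mul_nonneg (sub_nonneg.2 ha) hA, mul_nonneg (sub_nonneg.2 ha) hB,
      mul_nonneg (sub_nonneg.2 h2.le) hD]

lemma φ_eq_zero (S : Solution N α p q K u φ Du Dφ) (hu : u =ᵐ[volume] 0) : φ =ᵐ[volume] 0 := by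
  refine S.wφ.eq_zero S.hN S.φ2 (ae_eq_zero_of_integral_norm_sq S.Dφ2 ?_)
  rw [S.energy_φ]
  refine integral_eq_zero_of_ae ?_
  filter_upwards [hu] with x hx
  have hq : q ≠ 0 := by linarith [S.hq]
  simp [hx, Real.zero_rpow hq]

end Solution

/-- Uniqueness of weak gradients transfers the integrability stated for the gradients in `IsRegular`
to those appearing in the equations. -/
lemma exists_solution {α p q K : ℝ} {u φ : E N → ℝ} (hN : 3 ≤ N) (hα : 0 < α) (hαN : α < N)
    (hp : 1 < p) (hq : 1 < q) (hK : 0 < K) (hw : IsWeakSolution α p q (fun _ => K) u φ)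
    (hr : IsRegular α p q (fun _ => K) u φ) : ∃ Du Dφ, Solution N α p q K u φ Du Dφ := by
  obtain ⟨Du, Dφ, wu, wφ, eq₁, eq₂⟩ := hw
  obtain ⟨⟨u2, G, hG, G2⟩, uσ, ⟨φ2, H, hH, H2⟩, Kuq, D, hD, -, Dσ⟩ := hr
  refine ⟨Du, Dφ, hN, hα, hαN, hp, hq, hK, wu, wφ, u2, G2.ae_eq (hG.unique wu), φ2,
    H2.ae_eq (hH.unique wφ), uσ, fun C hC => (Dσ C hC).ae_eq ?_, Kuq, eq₁, eq₂⟩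
  filter_upwards [ae_restrict_of_ae (hD.unique wu)] with x hx
  rw [hx]

lemma trivial_isWeakSolution {α p q K : ℝ} {u φ : E N → ℝ} (hq : 1 < q)
    (hu : u =ᵐ[volume] 0) (hφ : φ =ᵐ[volume] 0) : IsWeakSolution α p q (fun _ => K) u φ := by
  refine ⟨fun _ => 0, fun _ => 0, HasWeakGradient.zero.congr hu.symm .rfl,
    HasWeakGradient.zero.congr hφ.symm .rfl, fun η _ => ?_, fun η _ => ?_⟩
  · rw [integral_eq_zero_of_ae (f := fun x => fderiv ℝ η x 0) (.of_forall fun x => by simp),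
      integral_eq_zero_of_ae (f := fun x => u x * η x) (hu.mono fun x hx => by simp [hx]),
      integral_eq_zero_of_ae (f := fun x => K * φ x * (|u x| ^ (q - 2) * u x) * η x)
        (hu.mono fun x hx => by simp [hx]),
      integral_eq_zero_of_ae
        (f := fun x => rieszConv α (fun y => |u y| ^ p) x * (|u x| ^ (p - 2) * u x) * η x)
        (hu.mono fun x hx => by simp [hx])]
    simp
  · have hq : q ≠ 0 := by linarith
    rw [integral_eq_zero_of_ae (f := fun x => fderiv ℝ η x 0) (.of_forall fun x => by simp),
      integral_eq_zero_of_ae (f := fun x => K * |u x| ^ q * η x)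
        (hu.mono fun x hx => by simp [hx, Real.zero_rpow hq])]

lemma trivial_isRegular {α p q K : ℝ} {u φ : E N → ℝ} (hq : 1 < q)
    (hu : u =ᵐ[volume] 0) (hφ : φ =ᵐ[volume] 0) : IsRegular α p q (fun _ => K) u φ := by
  have hq : q ≠ 0 := by linarith
  have z : ∀ {f : E N → ℝ}, f =ᵐ[volume] 0 → ∀ r, MemLp f r volume := fun hf r =>
    MemLp.ae_eq hf.symm MemLp.zero
  have h1 : ∀ {f : E N → ℝ}, f =ᵐ[volume] 0 → HasWeakGradient f fun _ => 0 := fun hf =>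
    HasWeakGradient.zero.congr hf.symm .rfl
  refine ⟨⟨z hu _, _, h1 hu, MemLp.zero⟩, z hu _, ⟨z hφ _, _, h1 hφ, MemLp.zero⟩,
    z (hu.mono fun x hx => by simp [hx, Real.zero_rpow hq]) _, _, h1 hu, ⟨fun C _ => ?_, _, h1 ?_, fun C _ => ?_⟩,
    fun C _ => ?_⟩
  · simp
  · exact .of_forall fun x => by simp
  · simp
  · simp

end ChoquardSP

end

theorem corollary2p3 (N : ℕ) (hN : 3 ≤ N) (α p q : ℝ) (hα : 0 < α) (hαN : α < N)
    (hp : 1 < p) (hq : 1 < q) (K : ℝ) (hK : 0 < K)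
    (hcond :
      (((N : ℝ) + α) / ((N : ℝ) - 2) ≤ p ∧ ((N : ℝ) + α) / p ≤ ((N : ℝ) + 2) / q) ∨
      (p ≤ ((N : ℝ) + α) / (N : ℝ) ∧ ((N : ℝ) + 2) / q < ((N : ℝ) + α) / p))
    (u φ : ChoquardSP.E N → ℝ) :
    (ChoquardSP.IsWeakSolution α p q (fun _ => K) u φ ∧
        ChoquardSP.IsRegular α p q (fun _ => K) u φ) ↔
      (u =ᵐ[MeasureTheory.volume] 0 ∧ φ =ᵐ[MeasureTheory.volume] 0) := by
  constructor
  · rintro ⟨hw, hr⟩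
    obtain ⟨Du, Dφ, S⟩ := ChoquardSP.exists_solution hN hα hαN hp hq hK hw hr
    have hu := S.u_eq_zero hcond
    exact ⟨hu, S.φ_eq_zero hu⟩
  · rintro ⟨hu, hφ⟩
    exact ⟨ChoquardSP.trivial_isWeakSolution hq hu hφ, ChoquardSP.trivial_isRegular hq hu hφ⟩
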